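/- Function spaces on $\mathbb R$ (complex-valued functions, weak derivatives): $\|f\|_{L^{2,1}}=\|(1+x^2)^{1/2}f\|_{L^2}$; $\|f\|_{H^1}^2=\|f\|_{L^2}^2+\|f'\|_{L^2}^2$; $\|f\|_{H^2}^2=\|f\|_{L^2}^2+\|f'\|_{L^2}^2+\|f''\|_{L^2}^2$; $\|f\|_{H^{1,1}}^2=\|f\|_{L^{2,1}}^2+\|f'\|_{L^{2,1}}^2$; and $\|f\|_{H^2\cap H^{1,1}}=\|f\|_{H^2}+\|f\|_{H^{1,1}}$. For a potential $u:\mathbb R\to\mathbb C$ and $k\in\mathbb R\cup i\mathbb R$ put $$Q(x;k)=\begin{pmatrix}\frac i2|u|^2& ku\\ -k\overline u&-\frac i2|u|^2\end{pmatrix},$$ and let $\varphi_\pm(x;k)$, $\phi_+(x;k)\in\mathbb C^2$ be the bounded continuous solutions of the Volterra equations $$\varphi_\pm(x;k)=e_1+\int_{\pm\infty}^x\begin{pmatrix}1&0\\0&e^{2i(k^2+1)(x-y)}\end{pmatrix}Q(y;k)\varphi_\pm(y;k)\,dy,$$ $$\phi_+(x;k)=e_2+\int_{+\infty}^x\begin{pmatrix}e^{-2i(k^2+1)(x-y)}&0\\0&1\end{pmatrix}Q(y;k)\phi_+(y;k)\,dy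 .$$ Put $a(k)=\det[\varphi_-(0;k),\phi_+(0;k)]$ and $b(k)=\det[\varphi_+(0;k),\varphi_-(0;k)]$. **Lemma.** (i) Let $u\in H^{1,1}(\mathbb R)$. Then for every $k\in\mathbb R\cup i\mathbb R$ the functions $\varphi_\pm,\phi_+$ exist and are unique, and $\varphi_-(x;k)=a(k)\varphi_+(x;k)+b(k)e^{2i(k^2+1)x}\phi_+(x;k)$ for all $x\in\mathbb R$. The function $a(k)$ continues analytically, with respect to $z=k^2$, to the upper half-plane: there is a function $A$, continuous on $\{\operatorname{Im}z\ge 0\}$ and holomorphic in $\{\operatorname{Im}z>0\}$, with $A(k^2)=a(k)$ for all $k\in\mathbb R\cup i\mathbb R$. Moreover, as functions of $z=k^2\in\mathbb R$ (for any choice of the square root $k$ of $z$), $$a(k)-1,\quad kb(k),\quad k^{-1}b(k)\in H^1_z(\mathbb R).$$ (ii) If $u\in H^2(\mathbb R)\cap H^{1,1}(\mathbb R)$, then $kb(k),\ k^{-1}b(k)\in L^{2,1}_z(\mathbb R)$. (iii) The maps $u\mapsto a(k)-1,\ kb(k),\ k^{-1}b(k)$ from $H^{1,1}(\mathbb R)$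 to $H^1_z(\mathbb R)$, and $u\mapsto kb(k),\ k^{-1}b(k)$ from $H^2(\mathbb R)\cap H^{1,1}(\mathbb R)$ to $L^{2,1}_z(\mathbb R)$, are Lipschitz continuous on bounded sets: for every $B$ there is a constant $C(B)$, depending only on $B$, such that, for all $u,\tilde u$ in the ball of radius $B$ of $H^{1,1}(\mathbb R)$, resp. of $H^2(\mathbb R)\cap H^{1,1}(\mathbb R)$, the distance of the images of $u$ and $\tilde u$ under each of these maps is at most $C(B)\|u-\tilde u\|_{H^{1,1}}$, resp. $C(B)\|u-\tilde u\|_{H^2\cap H^{1,1}}$. -/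

import Mathlib

open MeasureTheory Set
open scoped ENNReal NNReal ContDiff

noncomputable section

namespace NLSGI

/-! ### Function spaces on the real line -/

/-- `g` is the weak derivative of `f` on `ℝ`: both are locally integrable and
`∫ φ' f = - ∫ φ g` for every smooth compactly supported test function `φ`. -/
structure IsWeakDeriv (f g : ℝ → ℂ) : Prop where
  locallyIntegrable : LocallyIntegrable f volume
  locallyIntegrable_deriv : LocallyIntegrable g volume
  integral_eq : ∀ φ : ℝ → ℝ, ContDiff ℝ ∞ φ → HasCompactSupport φ →
    ∫ x, ((deriv φ x : ℝ) : ℂ) * f x = - ∫ x, (φ x : ℂ) * g x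

/-- The norm of `L²(ℝ)`, with values in `[0, ∞]`. -/
def normL2 (f : ℝ → ℂ) : ℝ≥0∞ := eLpNorm f 2 volume

/-- The norm of `L^{2,1}(ℝ)`: the `L²` norm of `(1 + x²)^{1/2} f(x)`. -/
def normL21 (f : ℝ → ℂ) : ℝ≥0∞ := normL2 (fun x => (Real.sqrt (1 + x ^ 2) : ℂ) * f x)

/-- The norm `(‖f‖² + ‖f'‖²)^{1/2}` of `H¹(ℝ)`; it is `∞` if `f` has no weak derivative.
(The weak derivative is unique almost everywhere, so that the infimum is a dummy.) -/
def normH1 (f : ℝ → ℂ) : ℝ≥0∞ :=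
  ⨅ (g : ℝ → ℂ) (_ : IsWeakDeriv f g), (normL2 f ^ 2 + normL2 g ^ 2) ^ (1 / 2 : ℝ)

/-- The norm `(‖f‖² + ‖f'‖² + ‖f''‖²)^{1/2}` of `H²(ℝ)`; it is `∞` if `f` has no
weak derivatives up to order two. -/
def normH2 (f : ℝ → ℂ) : ℝ≥0∞ :=
  ⨅ (g : ℝ → ℂ) (h : ℝ → ℂ) (_ : IsWeakDeriv f g) (_ : IsWeakDeriv g h),
    (normL2 f ^ 2 + normL2 g ^ 2 + normL2 h ^ 2) ^ (1 / 2 : ℝ)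

/-- The norm `(‖f‖² + ‖f'‖²)^{1/2}`, with norms in `L^{2,1}`, of `H^{1,1}(ℝ)`; it is `∞` if
`f` has no weak derivative. -/
def normH11 (f : ℝ → ℂ) : ℝ≥0∞ :=
  ⨅ (g : ℝ → ℂ) (_ : IsWeakDeriv f g), (normL21 f ^ 2 + normL21 g ^ 2) ^ (1 / 2 : ℝ)

/-- `f ∈ L^{2,1}(ℝ)`. -/
def MemL21 (f : ℝ → ℂ) : Prop := AEStronglyMeasurable f volume ∧ normL21 f < ⊤

/-- `f ∈ H¹(ℝ)`. -/
def MemH1 (f : ℝ → ℂ) : Prop := normH1 f < ⊤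

/-- `f ∈ H²(ℝ)`. -/
def MemH2 (f : ℝ → ℂ) : Prop := normH2 f < ⊤

/-- `f ∈ H^{1,1}(ℝ)`, that is, `f` and its weak derivative lie in `L^{2,1}(ℝ)`. -/
def MemH11 (f : ℝ → ℂ) : Prop := normH11 f < ⊤

/-! ### Jost functions -/

/-- `∫_{-∞}^x f(y) dy`. -/
def intMinus (f : ℝ → ℂ) (x : ℝ) : ℂ := ∫ y in Iic x, f y

/-- `∫_{+∞}^x f(y) dy`. -/
def intPlus (f : ℝ → ℂ) (x : ℝ) : ℂ := - ∫ y in Ioi x, f y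

/-- First row of `Q(y; k) v`, where `Q = [[(i/2)|u|², k u], [-k ū, -(i/2)|u|²]]`. -/
def Qfst (u : ℝ → ℂ) (k : ℂ) (y : ℝ) (v : ℂ × ℂ) : ℂ :=
  Complex.I / 2 * (‖u y‖ : ℂ) ^ 2 * v.1 + k * u y * v.2

/-- Second row of `Q(y; k) v`, where `Q = [[(i/2)|u|², k u], [-k ū, -(i/2)|u|²]]`. -/
def Qsnd (u : ℝ → ℂ) (k : ℂ) (y : ℝ) (v : ℂ × ℂ) : ℂ :=
  - k * (starRingEnd ℂ) (u y) * v.1 - Complex.I / 2 * (‖u y‖ : ℂ) ^ 2 * v.2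

/-- `φ` is a bounded continuous solution of the Volterra equation
`φ(x) = e₁ + ∫_{±∞}^x diag(1, e^{2i(k²+1)(x-y)}) Q(y; k) φ(y) dy`,
where `J` is `intMinus` or `intPlus`. -/
structure IsJost₁ (J : (ℝ → ℂ) → ℝ → ℂ) (u : ℝ → ℂ) (k : ℂ) (φ : ℝ → ℂ × ℂ) : Prop where
  continuous : Continuous φ
  bounded : ∃ M : ℝ, ∀ x, ‖φ x‖ ≤ M
  fst_eq : ∀ x, (φ x).1 = 1 + J (fun y => Qfst u k y (φ y)) x
  snd_eq : ∀ x, (φ x).2 =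
    J (fun y => Complex.exp (2 * Complex.I * (k ^ 2 + 1) * (x - y)) * Qsnd u k y (φ y)) x

/-- `φ` is a bounded continuous solution of the Volterra equation
`φ(x) = e₂ + ∫_{±∞}^x diag(e^{-2i(k²+1)(x-y)}, 1) Q(y; k) φ(y) dy`,
where `J` is `intMinus` or `intPlus`. -/
structure IsJost₂ (J : (ℝ → ℂ) → ℝ → ℂ) (u : ℝ → ℂ) (k : ℂ) (φ : ℝ → ℂ × ℂ) : Prop where
  continuous : Continuous φ
  bounded : ∃ M : ℝ, ∀ x, ‖φ x‖ ≤ M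
  fst_eq : ∀ x, (φ x).1 =
    J (fun y => Complex.exp (-2 * Complex.I * (k ^ 2 + 1) * (x - y)) * Qfst u k y (φ y)) x
  snd_eq : ∀ x, (φ x).2 = 1 + J (fun y => Qsnd u k y (φ y)) x

/-- The Jost function `φ₋(x; k)`, normalized to `e₁` at `-∞`. -/
def jost₁Minus (u : ℝ → ℂ) (k : ℂ) : ℝ → ℂ × ℂ := Classical.epsilon (IsJost₁ intMinus u k)

/-- The Jost function `φ₊(x; k)`, normalized to `e₁` at `+∞`. -/
def jost₁Plus (u : ℝ → ℂ) (k : ℂ) : ℝ → ℂ × ℂ := Classical.epsilon (IsJost₁ intPlus u k)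

/-- The Jost function `ϕ₊(x; k)`, normalized to `e₂` at `+∞`. -/
def jost₂Plus (u : ℝ → ℂ) (k : ℂ) : ℝ → ℂ × ℂ := Classical.epsilon (IsJost₂ intPlus u k)

/-! ### Scattering data -/

/-- The determinant of the `2 × 2` matrix with columns `v`, `w`. -/
def det₂ (v w : ℂ × ℂ) : ℂ := v.1 * w.2 - v.2 * w.1

/-- The scattering coefficient `a(k) = det[φ₋(0; k), ϕ₊(0; k)]`. -/
def a (u : ℝ → ℂ) (k : ℂ) : ℂ := det₂ (jost₁Minus u k 0) (jost₂Plus u k 0)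

/-- The scattering coefficient `b(k) = det[φ₊(0; k), φ₋(0; k)]`. -/
def b (u : ℝ → ℂ) (k : ℂ) : ℂ := det₂ (jost₁Plus u k 0) (jost₁Minus u k 0)

/-- `κ` chooses, for every real `z`, a square root `k = κ(z) ∈ ℝ ∪ iℝ`, so that
`z ↦ F (κ z)` is the function `F(k)` read as a function of `z = k²`. -/
def IsSqrt (κ : ℝ → ℂ) : Prop := ∀ z : ℝ, κ z ^ 2 = (z : ℂ)

/-- The scattering data are well defined at `k`: the Jost functions exist and are unique, and
`φ₋(x; k) = a(k) φ₊(x; k) + b(k) e^{2i(k²+1)x} ϕ₊(x; k)` for all `x`. -/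
structure ScatteringWellDefined (u : ℝ → ℂ) (k : ℂ) : Prop where
  existsUnique_minus₁ : ∃! φ, IsJost₁ intMinus u k φ
  existsUnique_plus₁ : ∃! φ, IsJost₁ intPlus u k φ
  existsUnique_plus₂ : ∃! φ, IsJost₂ intPlus u k φ
  relation : ∀ x : ℝ, jost₁Minus u k x = a u k • jost₁Plus u k x +
    (b u k * Complex.exp (2 * Complex.I * (k ^ 2 + 1) * x)) • jost₂Plus u k x

end NLSGI

end

namespace NLSGI

/-! ### Gronwall's inequality for a finite measure without atoms -/

section Gronwall

variable {μ : Measure ℝ}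

/-! The difficulty is the factor `k`, hence growth in `z = k²`, in the Volterra equations. Writing
`φ₋ = (α, k w)` and `θ = 2i(z+1)`, the pair `(α, w)` depends on `z` only, but `α' = (i/2)|u|²α + z u
w` still contains `z`. Adjoin `β = θ w - ū α`. Since `z w = (β + ū α)/(2i) - w`, the triple `(α, β,
w)` solves a linear system whose only `z`-dependent part is the diagonal phase `(0, θ, θ)`. Its
coefficients are polynomials in `u`, `ū`, `ū'` and lie in `L^{2,1}`, and its initial vector is `(1,
0, 0)` (`laxMatrix`, `IsPot.laxSol_eq`).

For such systems (`IsAKNS`) the forcing produced by the initial vector is an oscillatory integral,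
so Plancherel bounds its `L²` norm in `z` by the `L²` norm of the source on `(-∞, x]`, which is
`O((1+x²)^{-1/2})` for `x ≤ 0`. Minkowski and Gronwall carry this over to the solution
(`IsAKNS.l2norm_sub_le`). A shift `z → z + h` is a gauge change of the coefficients and costs a
factor `|h||y|`; the weight, or the decay just obtained, absorbs `|y|` (`IsAKNS.l2norm_shift_le`).
An `L²` function with Lipschitz translates has a weak derivative in `L²`, which gives `H¹` bounds at
`x = 0` (`IsAKNS.exists_bound`). Lipschitz dependence on the potential needs no new estimate: a
solution together with a rescaled difference of two solutions solves a system of the same kind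
(`volterraSol_blockMatrix`).

The reflection `U(x) = -conj u(-x)` expresses the functions normalized at `+∞` through the triple of
`U`, so that only `x ≤ 0` has to be studied. Then `a`, `b/k` and `θ b/k` are quadratic expressions
in the two triples at `x = 0`, in which every product `z w` or `θ w` has been traded for bounded
quantities (`aCoef`, `betaCoef`, `sigmaCoef`). This yields the `H¹` statements by algebra, and the
analytic continuation of `a`, since the triples are holomorphic in the upper half-plane and
continuous up to the real axis. The scattering relation is Cramer's rule, using conserved quantities
of the differential equations.

For the weight in `z` one more factor `θ` is needed: `θ² b/k` is expressed through `β'` at the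
origin. The function `β'` solves an equation with phase `θ` and coefficients in `L²` only, and the
same two tools, Plancherel and decay in `x`, bound its value at `0` (`unifLip_accel`). -/

lemma measurable_measure_Iic (μ : Measure ℝ) : Measurable fun x => μ (Iic x) :=
  Monotone.measurable fun _ _ h => measure_mono (Iic_subset_Iic.2 h)

/-- `∫_{y ≤ x} F(y)ⁿ dμ = F(x)ⁿ⁺¹ / (n + 1)` for the distribution function `F` of `μ`. -/
lemma lintegral_Iic_pow_measure_Iic [SFinite μ] [NullSingletonClass μ] (n : ℕ) (x : ℝ) :
    ((n : ℝ≥0∞) + 1) * ∫⁻ y in Iic x, μ (Iic y) ^ n ∂μ = μ (Iic x) ^ (n + 1) := by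
  induction n generalizing x with
  | zero => simp
  | succ n ih =>
    have hm : Measurable fun x => μ (Iic x) := measurable_measure_Iic μ
    -- For `t ≤ x` the mass `F(x)` splits as `F(t) + μ(t, x]`. By Tonelli over `t < y ≤ x` the
    -- second part becomes an integral to which the induction hypothesis applies.
    have hsplit : μ (Iic x) * ∫⁻ t in Iic x, μ (Iic t) ^ n ∂μ =
        ∫⁻ t in Iic x, μ (Iic t) ^ (n + 1) ∂μ
          + ∫⁻ t in Iic x, μ (Iic t) ^ n * μ (Ioc t x) ∂μ := by
      rw [← lintegral_const_mul _ (hm.pow_const n), ← lintegral_add_left (hm.pow_const _)]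
      refine setLIntegral_congr_fun measurableSet_Iic fun t ht => ?_
      have : μ (Iic x) = μ (Iic t) + μ (Ioc t x) := by
        rw [← measure_union (Set.Iic_disjoint_Ioc le_rfl) measurableSet_Ioc,
          Iic_union_Ioc_eq_Iic ht]
      simp only [this]
      ring
    have hswap : ∫⁻ t in Iic x, μ (Iic t) ^ n * μ (Ioc t x) ∂μ =
        ∫⁻ y in Iic x, ∫⁻ t in Iic y, μ (Iic t) ^ n ∂μ ∂μ := by
      have h1 : ∀ t, μ (Iic t) ^ n * μ (Ioc t x) =
          ∫⁻ y in Iic x, (Ioi t).indicator (fun _ => μ (Iic t) ^ n) y ∂μ := by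
        intro t
        rw [lintegral_indicator measurableSet_Ioi, setLIntegral_const,
          Measure.restrict_apply measurableSet_Ioi, Ioi_inter_Iic]
      simp_rw [h1]
      have hms : MeasurableSet {p : ℝ × ℝ | p.1 < p.2} :=
        measurableSet_lt measurable_fst measurable_snd
      have e : ∀ p : ℝ × ℝ, (Ioi p.1).indicator (fun _ => μ (Iic p.1) ^ n) p.2 =
          {p : ℝ × ℝ | p.1 < p.2}.indicator (fun p => μ (Iic p.1) ^ n) p := by
        intro p; simp [indicator]
      rw [lintegral_lintegral_swap]
      · refine setLIntegral_congr_fun measurableSet_Iic fun y hy => ?_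
        have h2 : ∀ t, (Ioi t).indicator (fun _ => μ (Iic t) ^ n) y =
            (Iio y).indicator (fun t => μ (Iic t) ^ n) t := by
          intro t; simp [indicator]
        simp_rw [h2]
        rw [lintegral_indicator measurableSet_Iio, Measure.restrict_restrict measurableSet_Iio,
          show Iio y ∩ Iic x = Iio y from inter_eq_left.2 fun t (ht : t < y) => ht.le.trans hy]
        -- The absence of atoms enters here: the diagonal `t = y` is negligible.
        exact setLIntegral_congr Iio_ae_eq_Iic
      · refine Measurable.aemeasurable ?_
        have := ((hm.comp measurable_fst).pow_const n : Measurable fun p : ℝ × ℝ => μ (Iic p.1) ^ n)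
        have h3 : Measurable ({p : ℝ × ℝ | p.1 < p.2}.indicator fun p => μ (Iic p.1) ^ n) :=
          this.indicator hms
        rw [← funext e] at h3
        exact h3
    have h0 : ((n : ℝ≥0∞) + 1) ≠ 0 := by simp
    have ht : ((n : ℝ≥0∞) + 1) ≠ ⊤ := by finiteness
    calc ((n + 1 : ℕ) + 1 : ℝ≥0∞) * ∫⁻ y in Iic x, μ (Iic y) ^ (n + 1) ∂μ
        = (n + 1) * ∫⁻ y in Iic x, μ (Iic y) ^ (n + 1) ∂μ
          + ∫⁻ y in Iic x, μ (Iic y) ^ (n + 1) ∂μ := by push_cast; ring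
      _ = (n + 1) * ∫⁻ y in Iic x, μ (Iic y) ^ (n + 1) ∂μ
          + ∫⁻ y in Iic x, (n + 1) * ∫⁻ t in Iic y, μ (Iic t) ^ n ∂μ ∂μ := by simp_rw [ih]
      _ = (n + 1) * (∫⁻ y in Iic x, μ (Iic y) ^ (n + 1) ∂μ
          + ∫⁻ y in Iic x, ∫⁻ t in Iic y, μ (Iic t) ^ n ∂μ ∂μ) := by
          rw [lintegral_const_mul' _ _ ht, mul_add]
      _ = (n + 1) * (μ (Iic x) * ∫⁻ t in Iic x, μ (Iic t) ^ n ∂μ) := by rw [hsplit, hswap]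
      _ = μ (Iic x) * μ (Iic x) ^ (n + 1) := by rw [← ih x]; ring
      _ = μ (Iic x) ^ (n + 1 + 1) := by ring

lemma lintegral_Iic_pow_div_factorial [SFinite μ] [NullSingletonClass μ] (n : ℕ) (x : ℝ) :
    ∫⁻ y in Iic x, μ (Iic y) ^ n / (n.factorial : ℝ≥0∞) ∂μ =
      μ (Iic x) ^ (n + 1) / ((n + 1).factorial : ℝ≥0∞) := by
  have hn : ((n : ℝ≥0∞) + 1) ≠ 0 := by simp
  have hnt : ((n : ℝ≥0∞) + 1) ≠ ⊤ := by finiteness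
  have h := lintegral_Iic_pow_measure_Iic (μ := μ) n x
  simp_rw [div_eq_mul_inv]
  rw [lintegral_mul_const _ ((measurable_measure_Iic μ).pow_const n), ← h, Nat.factorial_succ]
  push_cast
  rw [ENNReal.mul_inv (Or.inl hn) (Or.inl hnt), mul_mul_mul_comm, ENNReal.mul_inv_cancel hn hnt,
    one_mul]

/-- Iterated form of Gronwall's inequality. -/
lemma gronwall_iterate [IsFiniteMeasure μ] [NullSingletonClass μ] {N : ℝ → ℝ≥0∞} {h M : ℝ≥0∞} {x₀ : ℝ}
    (hM : ∀ x ≤ x₀, N x ≤ M) (hN : ∀ x ≤ x₀, N x ≤ h + ∫⁻ y in Iic x, N y ∂μ) (n : ℕ) :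
    ∀ x ≤ x₀, N x ≤ ∑ k ∈ Finset.range n, h * (μ (Iic x) ^ k / (k.factorial : ℝ≥0∞))
      + M * (μ (Iic x) ^ n / (n.factorial : ℝ≥0∞)) := by
  have hm : Measurable fun x => μ (Iic x) := measurable_measure_Iic μ
  induction n with
  | zero => simpa using hM
  | succ n ih =>
    intro x hx
    have hmk : ∀ (c : ℝ≥0∞) (k : ℕ), Measurable fun y => c * (μ (Iic y) ^ k / (k.factorial : ℝ≥0∞)) :=
      fun c k => ((hm.pow_const k).div_const _).const_mul c
    have hc : ∀ (c : ℝ≥0∞) (k : ℕ), ∫⁻ y in Iic x, c * (μ (Iic y) ^ k / (k.factorial : ℝ≥0∞)) ∂μ =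
        c * (μ (Iic x) ^ (k + 1) / ((k + 1).factorial : ℝ≥0∞)) := by
      intro c k
      rw [lintegral_const_mul _ ((hm.pow_const k).div_const _), lintegral_Iic_pow_div_factorial]
    calc N x ≤ h + ∫⁻ y in Iic x, N y ∂μ := hN x hx
      _ ≤ h + ∫⁻ y in Iic x, (∑ k ∈ Finset.range n, h * (μ (Iic y) ^ k / (k.factorial : ℝ≥0∞))
          + M * (μ (Iic y) ^ n / (n.factorial : ℝ≥0∞))) ∂μ := by
          refine add_le_add le_rfl ?_
          -- Only an upper bound is substituted under the integral, so `N` itself need not be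
          -- measurable.
          exact setLIntegral_mono' measurableSet_Iic fun y hy => ih y (le_trans hy hx)
      _ = _ := by
          rw [lintegral_add_right _ (hmk M n), lintegral_finsetSum _ fun k _ => hmk h k,
            Finset.sum_range_succ' _ n]
          simp only [hc]
          simp [add_comm, add_left_comm]

lemma ofReal_exp_eq_tsum {F : ℝ≥0∞} (hF : F ≠ ⊤) :
    ENNReal.ofReal (Real.exp F.toReal) = ∑' k : ℕ, F ^ k / (k.factorial : ℝ≥0∞) := by
  rw [Real.exp_eq_exp_ℝ, NormedSpace.exp_eq_tsum_div, ENNReal.ofReal_tsum_of_nonneg]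
  · congr 1 with k
    rw [ENNReal.ofReal_div_of_pos (by positivity), ENNReal.ofReal_pow ENNReal.toReal_nonneg,
      ENNReal.ofReal_toReal hF, ENNReal.ofReal_natCast]
  · intro n; positivity
  · exact Real.summable_pow_div_factorial _

/-- **Gronwall's inequality** for a bounded function on a half-line. -/
lemma gronwall [IsFiniteMeasure μ] [NullSingletonClass μ] {N : ℝ → ℝ≥0∞} {h M : ℝ≥0∞} {x₀ : ℝ} (hMt : M ≠ ⊤)
    (hM : ∀ x ≤ x₀, N x ≤ M) (hN : ∀ x ≤ x₀, N x ≤ h + ∫⁻ y in Iic x, N y ∂μ) :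
    N x₀ ≤ h * ENNReal.ofReal (Real.exp (μ (Iic x₀)).toReal) := by
  have hF : μ (Iic x₀) ≠ ⊤ := measure_ne_top _ _
  have hs : ∑' k : ℕ, μ (Iic x₀) ^ k / (k.factorial : ℝ≥0∞) ≠ ⊤ := by
    rw [← ofReal_exp_eq_tsum hF]; exact ENNReal.ofReal_ne_top
  -- The remainder `M Fⁿ / n!` is `M` times the general term of the exponential series, so it
  -- vanishes in the limit because `M` is finite.
  have h0 := ENNReal.tendsto_atTop_zero_of_tsum_ne_top hs
  have h1 : Filter.Tendsto (fun n => h * ENNReal.ofReal (Real.exp (μ (Iic x₀)).toReal)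
      + M * (μ (Iic x₀) ^ n / (n.factorial : ℝ≥0∞))) Filter.atTop
      (nhds (h * ENNReal.ofReal (Real.exp (μ (Iic x₀)).toReal) + M * 0)) :=
    (tendsto_const_nhds).add (ENNReal.Tendsto.const_mul h0 (Or.inr hMt))
  rw [mul_zero, add_zero] at h1
  refine ge_of_tendsto' h1 fun n => (gronwall_iterate hM hN n x₀ le_rfl).trans ?_
  gcongr
  rw [← Finset.mul_sum, ofReal_exp_eq_tsum hF]
  gcongr
  exact ENNReal.sum_le_tsum _

end Gronwall

end NLSGI

namespace NLSGI

/-! ### Linear Volterra equations on the line -/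

noncomputable section Volterra

variable {ι : Type*} [Fintype ι]

/-- A matrix of measurable integrable functions. -/
structure IntegrableMatrix (V : ι → ι → ℝ → ℂ) : Prop where
  measurable : ∀ i j, Measurable (V i j)
  integrable : ∀ i j, Integrable (V i j)

/-- The sum of the absolute values of the entries of a matrix function. -/
def entrySum (V : ι → ι → ℝ → ℂ) (y : ℝ) : ℝ≥0∞ := ∑ i, ∑ j, ‖V i j y‖ₑ

/-- The measure with density `entrySum V`. -/
def entryMeasure (V : ι → ι → ℝ → ℂ) : Measure ℝ := volume.withDensity (entrySum V)

/-- The total mass of the entries of a matrix function. -/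
def entryMass (V : ι → ι → ℝ → ℂ) : ℝ := (entryMeasure V univ).toReal

/-- The Volterra operator `X ↦ ∫_{-∞}^x diag(e^{θ dᵢ (x - y)}) V(y) X(y) dy`. -/
def volterraOp (d : ι → ℝ) (V : ι → ι → ℝ → ℂ) (θ : ℂ) (X : ℝ → ι → ℂ) (x : ℝ) (i : ι) : ℂ :=
  ∫ y in Iic x, Complex.exp (θ * d i * (x - y)) * ∑ j, V i j y * X y j

/-- `X` is a bounded continuous solution of the Volterra equation with initial vector `e`. -/
structure IsVolterraSol (d : ι → ℝ) (V : ι → ι → ℝ → ℂ) (e : ι → ℂ) (θ : ℂ) (X : ℝ → ι → ℂ) :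
    Prop where
  continuous : Continuous X
  bounded : ∃ M : ℝ, ∀ x, ‖X x‖ ≤ M
  eq : ∀ x i, X x i = e i + volterraOp d V θ X x i

/-- Picard iterates of the Volterra equation. -/
def volterraIter (d : ι → ℝ) (V : ι → ι → ℝ → ℂ) (e : ι → ℂ) (θ : ℂ) : ℕ → ℝ → ι → ℂ
  | 0 => fun _ => e
  | n + 1 => volterraOp d V θ (volterraIter d V e θ n)

/-- The solution of the Volterra equation, as a sum of Picard iterates. -/
def volterraSol (d : ι → ℝ) (V : ι → ι → ℝ → ℂ) (e : ι → ℂ) (θ : ℂ) (x : ℝ) (i : ι) : ℂ :=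
  ∑' n, volterraIter d V e θ n x i

variable {d : ι → ℝ} {V : ι → ι → ℝ → ℂ} {e : ι → ℂ} {θ : ℂ}

lemma pi_enorm_le {f : ι → ℂ} {c : ℝ≥0∞} (h : ∀ i, ‖f i‖ₑ ≤ c) : ‖f‖ₑ ≤ c := by
  induction c with
  | top => exact le_top
  | coe c =>
    simp only [enorm_le_coe] at h ⊢
    exact pi_nnnorm_le_iff.2 h

lemma enorm_apply_le_pi (f : ι → ℂ) (i : ι) : ‖f i‖ₑ ≤ ‖f‖ₑ := by
  simpa [enorm] using nnnorm_le_pi_nnnorm f i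

lemma IntegrableMatrix.measurable_entrySum (hV : IntegrableMatrix V) : Measurable (entrySum V) :=
  Finset.measurable_fun_sum _ fun i _ => Finset.measurable_fun_sum _ fun j _ => (hV.measurable i j).enorm

lemma IntegrableMatrix.lintegral_entrySum_ne_top (hV : IntegrableMatrix V) :
    ∫⁻ y, entrySum V y ≠ ⊤ := by
  unfold entrySum
  rw [lintegral_finsetSum _ fun i _ => Finset.measurable_fun_sum _ fun j _ => (hV.measurable i j).enorm]
  refine (ENNReal.sum_lt_top.2 fun i _ => ?_).ne
  rw [lintegral_finsetSum _ fun j _ => (hV.measurable i j).enorm]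
  exact ENNReal.sum_lt_top.2 fun j _ => (hV.integrable i j).2

lemma IntegrableMatrix.isFiniteMeasure (hV : IntegrableMatrix V) :
    IsFiniteMeasure (entryMeasure V) :=
  isFiniteMeasure_withDensity hV.lintegral_entrySum_ne_top

instance : NullSingletonClass (entryMeasure V) := by
  unfold entryMeasure; infer_instance

instance : SFinite (entryMeasure V) := by
  unfold entryMeasure; infer_instance

lemma enorm_sum_mul_le (V : ι → ι → ℝ → ℂ) (i : ι) (y : ℝ) (w : ι → ℂ) :
    ‖∑ j, V i j y * w j‖ₑ ≤ entrySum V y * ‖w‖ₑ := by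
  calc ‖∑ j, V i j y * w j‖ₑ ≤ ∑ j, ‖V i j y * w j‖ₑ := enorm_sum_le _ _
    _ ≤ ∑ j, ‖V i j y‖ₑ * ‖w‖ₑ := by
        gcongr with j
        rw [enorm_mul]
        gcongr
        exact enorm_apply_le_pi w j
    _ = (∑ j, ‖V i j y‖ₑ) * ‖w‖ₑ := by rw [Finset.sum_mul]
    _ ≤ _ := by
        gcongr
        exact Finset.single_le_sum (f := fun i => ∑ j, ‖V i j y‖ₑ) (fun _ _ => zero_le) (Finset.mem_univ i)

lemma norm_exp_le_one {θ : ℂ} {c t : ℝ} (hθ : θ.re ≤ 0) (hc : 0 ≤ c) (ht : 0 ≤ t) :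
    ‖Complex.exp (θ * c * t)‖ ≤ 1 := by
  rw [Complex.norm_exp]
  refine Real.exp_le_one_iff.2 ?_
  have : (θ * c * t).re = θ.re * (c * t) := by
    rw [mul_assoc, ← Complex.ofReal_mul, Complex.re_mul_ofReal]
  rw [this]
  exact mul_nonpos_of_nonpos_of_nonneg hθ (by positivity)

lemma enorm_exp_mul_le {θ : ℂ} {c x y : ℝ} (hθ : θ.re ≤ 0) (hc : 0 ≤ c) (hy : y ≤ x) (w : ℂ) :
    ‖Complex.exp (θ * c * (x - y)) * w‖ₑ ≤ ‖w‖ₑ := by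
  rw [enorm_mul]
  have h := norm_exp_le_one hθ hc (sub_nonneg.2 hy)
  push_cast at h
  calc _ ≤ 1 * ‖w‖ₑ := by
        gcongr
        rw [← ofReal_norm, ← ENNReal.ofReal_one]
        exact ENNReal.ofReal_le_ofReal h
    _ = _ := one_mul _

lemma lintegral_entryMeasure (hV : IntegrableMatrix V) {g : ℝ → ℝ≥0∞} (hg : Measurable g) (x : ℝ) :
    ∫⁻ y in Iic x, g y ∂entryMeasure V = ∫⁻ y in Iic x, entrySum V y * g y :=
  setLIntegral_withDensity_eq_setLIntegral_mul _ hV.measurable_entrySum hg measurableSet_Iic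

lemma enorm_volterraOp_le (hV : IntegrableMatrix V) (hθ : θ.re ≤ 0) (hd : ∀ i, 0 ≤ d i)
    {X : ℝ → ι → ℂ} (hX : Measurable X) (x : ℝ) :
    ‖volterraOp d V θ X x‖ₑ ≤ ∫⁻ y in Iic x, ‖X y‖ₑ ∂entryMeasure V := by
  refine pi_enorm_le fun i => ?_
  rw [lintegral_entryMeasure hV hX.enorm]
  refine (enorm_integral_le_lintegral_enorm _).trans ?_
  refine setLIntegral_mono' measurableSet_Iic fun y hy => ?_
  exact (enorm_exp_mul_le hθ (hd i) hy _).trans (enorm_sum_mul_le V i y _)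

/-- The integrand of the Volterra operator is integrable when `X` is bounded. -/
lemma integrable_sum_mul (hV : IntegrableMatrix V) {X : ℝ → ι → ℂ} (hX : Measurable X) {M : ℝ}
    (hM : ∀ x, ‖X x‖ ≤ M) (i : ι) : Integrable fun y => ∑ j, V i j y * X y j := by
  refine integrable_finsetSum _ fun j _ => ?_
  refine (hV.integrable i j).mul_bdd (c := M) ?_ ?_
  · exact ((measurable_pi_apply j).comp hX).aestronglyMeasurable
  · exact Filter.Eventually.of_forall fun y => (norm_le_pi_norm _ j).trans (hM y)

lemma integrableOn_exp_mul (hθ : θ.re ≤ 0) {c : ℝ} (hc : 0 ≤ c) {f : ℝ → ℂ}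
    (x : ℝ) (hf : IntegrableOn f (Iic x)) :
    IntegrableOn (fun y : ℝ => Complex.exp (θ * c * (x - y)) * f y) (Iic x) := by
  refine Integrable.mono hf ?_ ?_
  · refine AEStronglyMeasurable.mul ?_ hf.1
    exact (by fun_prop : Continuous fun y : ℝ => Complex.exp (θ * c * (x - y))).aestronglyMeasurable
  · refine (ae_restrict_mem measurableSet_Iic).mono fun y hy => ?_
    have := enorm_exp_mul_le hθ hc hy (f y)
    exact enorm_le_iff_norm_le.1 this

/-- The parameter space is left general because three are used: a point, the real line, and the
closed upper half-plane. Moving the endpoint into an indicator reduces continuity to dominated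
convergence. -/
lemma continuous_volterraOp {P : Type*} [TopologicalSpace P] [FirstCountableTopology P]
    (hV : IntegrableMatrix V) (hd : ∀ i, 0 ≤ d i) {ϑ : P → ℂ} (hϑ : Continuous ϑ)
    (hre : ∀ p, (ϑ p).re ≤ 0) {X : P → ℝ → ι → ℂ} (hX : Continuous fun q : P × ℝ => X q.1 q.2)
    {M : ℝ} (hM : ∀ p x, ‖X p x‖ ≤ M) :
    Continuous fun q : P × ℝ => volterraOp d V (ϑ q.1) (X q.1) q.2 := by
  refine continuous_pi fun i => continuous_iff_continuousAt.2 fun q₀ => ?_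
  have hXp : ∀ p, Measurable (X p) := fun p =>
    (hX.comp (by fun_prop : Continuous fun x : ℝ => (p, x))).measurable
  have key : ContinuousAt (fun q : P × ℝ => ∫ y, (Iic q.2).indicator
      (fun y : ℝ => Complex.exp (ϑ q.1 * d i * (q.2 - y)) * ∑ j, V i j y * X q.1 y j) y) q₀ := by
    refine continuousAt_of_dominated (bound := fun y => ∑ j, ‖V i j y‖ * M) ?_ ?_ ?_ ?_
    · refine Filter.Eventually.of_forall fun q => ?_
      refine AEStronglyMeasurable.indicator ?_ measurableSet_Iic
      refine AEStronglyMeasurable.mul ?_ (integrable_sum_mul hV (hXp q.1) (hM q.1) i).1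
      exact (by fun_prop : Continuous fun y : ℝ =>
        Complex.exp (ϑ q.1 * d i * (q.2 - y))).aestronglyMeasurable
    · refine Filter.Eventually.of_forall fun q => Filter.Eventually.of_forall fun y => ?_
      have h0 : ‖∑ j, V i j y * X q.1 y j‖ ≤ ∑ j, ‖V i j y‖ * M := by
        refine (norm_sum_le _ _).trans ?_
        gcongr with j
        rw [norm_mul]
        gcongr
        exact (norm_le_pi_norm _ j).trans (hM _ y)
      by_cases hy : y ∈ Iic q.2
      · rw [indicator_of_mem hy]
        exact (enorm_le_iff_norm_le.1 (enorm_exp_mul_le (hre q.1) (hd i) hy _)).trans h0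
      · rw [indicator_of_notMem hy, norm_zero]
        exact (norm_nonneg _).trans h0
    · exact integrable_finsetSum _ fun j _ => ((hV.integrable i j).norm.mul_const M)
    -- The indicator jumps only at the endpoint itself, a null set of `y`.
    · have : ∀ᵐ y : ℝ, y ≠ q₀.2 := by simp [ae_iff]
      filter_upwards [this] with y hy
      have hc : Continuous fun q : P × ℝ =>
          Complex.exp (ϑ q.1 * d i * (q.2 - y)) * ∑ j, V i j y * X q.1 y j := by
        have hXy : ∀ j, Continuous fun q : P × ℝ => X q.1 y j := fun j =>
          (continuous_apply j).comp (hX.comp (by fun_prop : Continuous fun q : P × ℝ => (q.1, y)))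
        have := hϑ.comp continuous_fst (X := P × ℝ) (Y := P)
        refine Continuous.mul ?_ (continuous_finsetSum _ fun j _ => (hXy j).const_mul _)
        fun_prop
      rcases lt_or_gt_of_ne hy with h | h
      · refine hc.continuousAt.congr ?_
        filter_upwards [(isOpen_lt continuous_const continuous_snd).mem_nhds h] with q hq
        rw [indicator_of_mem (show y ∈ Iic q.2 from le_of_lt hq)]
      · refine (continuousAt_const (y := (0 : ℂ))).congr ?_
        filter_upwards [(isOpen_lt continuous_snd continuous_const).mem_nhds h] with q hq
        rw [indicator_of_notMem (show y ∉ Iic q.2 from not_le.2 hq)]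
  refine key.congr (Filter.Eventually.of_forall fun q => ?_)
  simp only
  rw [integral_indicator measurableSet_Iic, volterraOp]

/-- Each Picard step integrates a power of the distribution function of `entryMeasure V`, which is
where the factorial comes from. Continuity is carried through the same induction because the bound
of the next step needs measurability. -/
lemma enorm_volterraIter_le_and_measurable (hV : IntegrableMatrix V) (hθ : θ.re ≤ 0)
    (hd : ∀ i, 0 ≤ d i) (n : ℕ) : Continuous (volterraIter d V e θ n) ∧
      ∀ x, ‖volterraIter d V e θ n x‖ₑ ≤
        ‖e‖ₑ * (entryMeasure V (Iic x) ^ n / (n.factorial : ℝ≥0∞)) := by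
  have := hV.isFiniteMeasure
  induction n with
  | zero => exact ⟨continuous_const, by simp [volterraIter]⟩
  | succ n ih =>
    have hm : Measurable fun x => entryMeasure V (Iic x) := measurable_measure_Iic _
    constructor
    · have hb : ∀ x, ‖volterraIter d V e θ n x‖ ≤
          (‖e‖ₑ * (entryMeasure V univ ^ n / (n.factorial : ℝ≥0∞))).toReal := by
        intro x
        rw [← toReal_enorm]
        refine ENNReal.toReal_mono ?_ ((ih.2 x).trans ?_)
        · refine ENNReal.mul_ne_top enorm_ne_top (ENNReal.div_ne_top (by finiteness) ?_)
          exact_mod_cast n.factorial_ne_zero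
        · gcongr
          exact subset_univ _
      have := continuous_volterraOp (P := Unit) (ϑ := fun _ => θ) hV hd continuous_const
        (fun _ => hθ) (X := fun _ => volterraIter d V e θ n) (ih.1.comp continuous_snd)
        (fun _ x => hb x)
      exact this.comp (by fun_prop : Continuous fun x : ℝ => ((), x))
    · intro x
      refine (enorm_volterraOp_le hV hθ hd ih.1.measurable x).trans ?_
      calc _ ≤ ∫⁻ y in Iic x, ‖e‖ₑ * (entryMeasure V (Iic y) ^ n / (n.factorial : ℝ≥0∞))
              ∂entryMeasure V := lintegral_mono fun y => ih.2 y
        _ = _ := by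
          rw [lintegral_const_mul _ ((hm.pow_const n).div_const _), lintegral_Iic_pow_div_factorial]

lemma norm_volterraIter_le (hV : IntegrableMatrix V) (hθ : θ.re ≤ 0) (hd : ∀ i, 0 ≤ d i)
    (n : ℕ) (x : ℝ) : ‖volterraIter d V e θ n x‖ ≤ ‖e‖ * (entryMass V ^ n / n.factorial) := by
  have := hV.isFiniteMeasure
  have h := ((enorm_volterraIter_le_and_measurable (e := e) hV hθ hd n).2 x).trans
    (show _ ≤ ‖e‖ₑ * (entryMeasure V univ ^ n / (n.factorial : ℝ≥0∞)) by
      gcongr; exact subset_univ _)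
  have h2 := ENNReal.toReal_mono (ENNReal.mul_ne_top enorm_ne_top
    (ENNReal.div_ne_top (by finiteness) (by exact_mod_cast n.factorial_ne_zero))) h
  simpa [entryMass] using h2

lemma continuous_volterraIter {P : Type*} [TopologicalSpace P] [FirstCountableTopology P]
    (hV : IntegrableMatrix V) (hd : ∀ i, 0 ≤ d i) {ϑ : P → ℂ} (hϑ : Continuous ϑ)
    (hre : ∀ p, (ϑ p).re ≤ 0) (n : ℕ) :
    Continuous fun q : P × ℝ => volterraIter d V e (ϑ q.1) n q.2 := by
  induction n with
  | zero => exact continuous_const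
  | succ n ih =>
    have h := continuous_volterraOp (X := fun p => volterraIter d V e (ϑ p) n) hV hd hϑ hre ih
      (M := ‖e‖ * (entryMass V ^ n / n.factorial))
      (fun p x => norm_volterraIter_le hV (hre p) hd n x)
    exact h

lemma summable_volterraIter_bound (c m : ℝ) :
    Summable fun n : ℕ => c * (m ^ n / n.factorial) :=
  (Real.summable_pow_div_factorial m).mul_left c

lemma continuous_volterraSol {P : Type*} [TopologicalSpace P] [FirstCountableTopology P]
    (hV : IntegrableMatrix V) (hd : ∀ i, 0 ≤ d i) {ϑ : P → ℂ} (hϑ : Continuous ϑ)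
    (hre : ∀ p, (ϑ p).re ≤ 0) :
    Continuous fun q : P × ℝ => volterraSol d V e (ϑ q.1) q.2 := by
  refine continuous_pi fun i => continuous_tsum (fun n => (continuous_apply i).comp
    (continuous_volterraIter hV hd hϑ hre n)) (summable_volterraIter_bound ‖e‖ (entryMass V)) ?_
  intro n q
  exact (norm_le_pi_norm (volterraIter d V e (ϑ q.1) n q.2) i).trans
    (norm_volterraIter_le hV (hre q.1) hd n q.2)

lemma summable_volterraIter (hV : IntegrableMatrix V) (hθ : θ.re ≤ 0) (hd : ∀ i, 0 ≤ d i)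
    (x : ℝ) (i : ι) : Summable fun n => volterraIter d V e θ n x i :=
  Summable.of_norm_bounded (summable_volterraIter_bound ‖e‖ (entryMass V)) fun n =>
    (norm_le_pi_norm _ i).trans (norm_volterraIter_le hV hθ hd n x)

lemma norm_volterraSol_le (hV : IntegrableMatrix V) (hθ : θ.re ≤ 0) (hd : ∀ i, 0 ≤ d i) (x : ℝ) :
    ‖volterraSol d V e θ x‖ ≤ ‖e‖ * Real.exp (entryMass V) := by
  refine (pi_norm_le_iff_of_nonneg (by positivity)).2 fun i => ?_
  have h : HasSum (fun n : ℕ => ‖e‖ * (entryMass V ^ n / n.factorial))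
      (‖e‖ * Real.exp (entryMass V)) := by
    rw [Real.exp_eq_exp_ℝ, NormedSpace.exp_eq_tsum_div]
    exact (Real.summable_pow_div_factorial _).hasSum.mul_left _
  exact tsum_of_norm_bounded h
    fun n => (norm_le_pi_norm _ i).trans (norm_volterraIter_le hV hθ hd n x)

lemma isVolterraSol_volterraSol (hV : IntegrableMatrix V) (hθ : θ.re ≤ 0) (hd : ∀ i, 0 ≤ d i) :
    IsVolterraSol d V e θ (volterraSol d V e θ) := by
  have hcont : Continuous (volterraSol d V e θ) :=
    (continuous_volterraSol (P := Unit) hV hd (ϑ := fun _ => θ) continuous_const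
      (fun _ => hθ)).comp (by fun_prop : Continuous fun x : ℝ => ((), x))
  refine ⟨hcont, ⟨_, norm_volterraSol_le hV hθ hd⟩, fun x i => ?_⟩
  have hsum := fun y j => summable_volterraIter (e := e) hV hθ hd y j
  have hn := fun n => (enorm_volterraIter_le_and_measurable (e := e) hV hθ hd n)
  have hint : ∀ n, IntegrableOn (fun y : ℝ => Complex.exp (θ * d i * (x - y)) *
      ∑ j, V i j y * volterraIter d V e θ n y j) (Iic x) := fun n =>
    integrableOn_exp_mul hθ (hd i) x (integrable_sum_mul hV (hn n).1.measurable
      (norm_volterraIter_le hV hθ hd n) i).integrableOn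
  have hI : ∀ n, ∫ y in Iic x, ‖Complex.exp (θ * d i * (x - y)) *
      ∑ j, V i j y * volterraIter d V e θ n y j‖ ≤
      (∫ y, ∑ j, ‖V i j y‖) * (‖e‖ * (entryMass V ^ n / n.factorial)) := by
    intro n
    rw [← integral_mul_const]
    have hi : Integrable fun y => (∑ j, ‖V i j y‖) * (‖e‖ * (entryMass V ^ n / n.factorial)) :=
      (integrable_finsetSum _ fun j _ => (hV.integrable i j).norm).mul_const _
    have h0 : ∀ y, 0 ≤ (∑ j, ‖V i j y‖) * (‖e‖ * (entryMass V ^ n / n.factorial)) := fun y => by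
      have : 0 ≤ entryMass V := ENNReal.toReal_nonneg
      positivity
    refine le_trans ?_ (setIntegral_le_integral (s := Iic x) hi (Filter.Eventually.of_forall h0))
    refine setIntegral_mono_on (hint n).norm hi.integrableOn measurableSet_Iic fun y hy => ?_
    refine (enorm_le_iff_norm_le.1 (enorm_exp_mul_le hθ (hd i) hy _)).trans ?_
    rw [Finset.sum_mul]
    refine (norm_sum_le _ _).trans ?_
    gcongr with j
    rw [norm_mul]
    gcongr
    exact (norm_le_pi_norm _ j).trans (norm_volterraIter_le hV hθ hd n y)
  -- The `L¹` norms of the terms are summable, so sum and integral may be exchanged.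
  have h := hasSum_integral_of_summable_integral_norm hint
    (Summable.of_nonneg_of_le (fun n => integral_nonneg fun _ => norm_nonneg _) hI
      (((summable_volterraIter_bound ‖e‖ (entryMass V))).mul_left _))
  have h2 : ∀ y : ℝ, ∑' n, Complex.exp (θ * d i * (x - y)) *
      ∑ j, V i j y * volterraIter d V e θ n y j =
      Complex.exp (θ * d i * (x - y)) * ∑ j, V i j y * volterraSol d V e θ y j := by
    intro y
    rw [tsum_mul_left, Summable.tsum_finsetSum fun j _ => (hsum y j).mul_left _]
    simp_rw [tsum_mul_left]
    rfl
  simp_rw [h2] at h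
  unfold volterraSol
  rw [(hsum x i).tsum_eq_zero_add]
  congr 1
  exact h.tsum_eq

/-- The difference of two bounded solutions satisfies Gronwall's inequality without forcing. Besides
uniqueness of the Jost functions, this is the means by which solutions of different systems are
identified with each other. -/
lemma IsVolterraSol.unique (hV : IntegrableMatrix V) (hθ : θ.re ≤ 0) (hd : ∀ i, 0 ≤ d i)
    {X Y : ℝ → ι → ℂ} (hX : IsVolterraSol d V e θ X) (hY : IsVolterraSol d V e θ Y) : X = Y := by
  have := hV.isFiniteMeasure
  obtain ⟨M, hM⟩ := hX.bounded
  obtain ⟨M', hM'⟩ := hY.bounded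
  have hm : Measurable fun y => X y - Y y := (hX.continuous.sub hY.continuous).measurable
  have hb : ∀ x, ‖X x - Y x‖ₑ ≤ ENNReal.ofReal (M + M') := fun x => by
    rw [← ofReal_norm]
    exact ENNReal.ofReal_le_ofReal ((norm_sub_le _ _).trans (add_le_add (hM x) (hM' x)))
  have hg : ∀ x, ‖X x - Y x‖ₑ ≤ 0 + ∫⁻ y in Iic x, ‖X y - Y y‖ₑ ∂entryMeasure V := by
    intro x
    rw [zero_add]
    refine le_trans (le_of_eq ?_) (enorm_volterraOp_le (d := d) (θ := θ) hV hθ hd hm x)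
    congr 1
    ext i
    have h1 := integrableOn_exp_mul hθ (hd i) x
      (integrable_sum_mul hV hX.continuous.measurable hM i).integrableOn
    have h2 := integrableOn_exp_mul hθ (hd i) x
      (integrable_sum_mul hV hY.continuous.measurable hM' i).integrableOn
    rw [Pi.sub_apply, hX.eq, hY.eq, add_sub_add_left_eq_sub]
    unfold volterraOp
    rw [← integral_sub h1 h2]
    congr 1 with y
    rw [← mul_sub, ← Finset.sum_sub_distrib]
    simp [mul_sub]
  ext1 x
  have := gronwall (x₀ := x) ENNReal.ofReal_ne_top (fun y _ => hb y) (fun y _ => hg y)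
  rw [zero_mul, nonpos_iff_eq_zero, enorm_eq_zero, sub_eq_zero] at this
  exact this

/-- A dominated integral of holomorphic functions is holomorphic. -/
lemma differentiableOn_integral_of_dominated {μ : Measure ℝ} {U : Set ℂ} (hU : IsOpen U)
    {f : ℂ → ℝ → ℂ} {g : ℝ → ℝ} (hf : ∀ z ∈ U, AEStronglyMeasurable (f z) μ)
    (hd : ∀ᵐ y ∂μ, DifferentiableOn ℂ (fun z => f z y) U)
    (hb : ∀ᵐ y ∂μ, ∀ z ∈ U, ‖f z y‖ ≤ g y) (hg : Integrable g μ) :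
    DifferentiableOn ℂ (fun z => ∫ y, f z y ∂μ) U := by
  intro z₀ hz₀
  obtain ⟨r, hr, hrU⟩ := Metric.isOpen_iff.1 hU z₀ hz₀
  have hr2 : 0 < r / 2 := by positivity
  have hball : ∀ z ∈ Metric.ball z₀ (r / 2), Metric.closedBall z (r / 4) ⊆ U := by
    intro z hz w hw
    refine hrU ?_
    rw [Metric.mem_ball] at hz ⊢
    rw [Metric.mem_closedBall] at hw
    linarith [dist_triangle w z z₀]
  have hmU : ∀ z ∈ Metric.ball z₀ (r / 2), z ∈ U := fun z hz =>
    hball z hz (Metric.mem_closedBall_self (by positivity))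
  -- The derivative is an almost everywhere limit of difference quotients along a sequence of real
  -- increments, hence measurable.
  have hdm : AEStronglyMeasurable (fun y => deriv (fun z => f z y) z₀) μ := by
    obtain ⟨c, hpos, hlt, ht⟩ : ∃ c : ℕ → ℝ, (∀ n, 0 < c n) ∧ (∀ n, c n < r) ∧
        Filter.Tendsto c Filter.atTop (nhds 0) := by
      obtain ⟨c, -, hc, hc0⟩ := exists_seq_strictAnti_tendsto' hr
      exact ⟨c, fun n => (hc n).1, fun n => (hc n).2, hc0⟩
    refine aestronglyMeasurable_of_tendsto_ae (u := Filter.atTop)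
      (f := fun n : ℕ => fun y => (c n : ℂ)⁻¹ * (f (z₀ + c n) y - f z₀ y)) ?_ ?_
    · intro n
      refine AEStronglyMeasurable.const_mul ((hf _ (hrU ?_)).sub (hf _ hz₀)) _
      rw [Metric.mem_ball, dist_eq_norm, add_sub_cancel_left, Complex.norm_real,
        Real.norm_of_nonneg (hpos n).le]
      exact hlt n
    · filter_upwards [hd] with y hy
      have hda := ((hy z₀ hz₀).differentiableAt (hU.mem_nhds hz₀)).hasDerivAt
      refine (hasDerivAt_iff_tendsto_slope_zero.1 hda).comp ?_
      refine tendsto_nhdsWithin_iff.2 ⟨?_, Filter.Eventually.of_forall fun n => ?_⟩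
      · exact_mod_cast (Complex.continuous_ofReal.tendsto 0).comp ht
      · simpa using (hpos n).ne'
  -- Cauchy's estimate on circles of radius `r / 4` turns the bound `g` for the integrand into a
  -- bound for its derivative.
  have hgi : Integrable (fun y => g y / (r / 4)) μ := hg.div_const _
  refine DifferentiableAt.differentiableWithinAt (HasDerivAt.differentiableAt
    (hasDerivAt_integral_of_dominated_loc_of_deriv_le (s := Metric.ball z₀ (r / 2))
    (F' := fun z y => deriv (fun z => f z y) z) (bound := fun y => g y / (r / 4))
    (Metric.ball_mem_nhds _ hr2) ?_ ?_ hdm ?_ hgi ?_).2)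
  · exact Filter.eventually_of_mem (hU.mem_nhds hz₀) hf
  · refine hg.mono' (hf z₀ hz₀) ?_
    filter_upwards [hb] with y hy using hy z₀ hz₀
  · filter_upwards [hd, hb] with y hy1 hy2 z hz
    refine Complex.norm_deriv_le_of_forall_mem_sphere_norm_le (by positivity) ?_ ?_
    · refine DifferentiableOn.diffContOnCl (hy1.mono ?_)
      rw [closure_ball _ (by positivity)]
      exact hball z hz
    · intro w hw
      exact hy2 w (hball z hz (Metric.sphere_subset_closedBall hw))
  · filter_upwards [hd] with y hy z hz
    exact ((hy z (hmU z hz)).differentiableAt (hU.mem_nhds (hmU z hz))).hasDerivAt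

lemma isOpen_re_neg : IsOpen {θ : ℂ | θ.re < 0} := isOpen_lt Complex.continuous_re continuous_const

lemma differentiableOn_volterraIter (hV : IntegrableMatrix V) (hd : ∀ i, 0 ≤ d i) (n : ℕ) (x : ℝ)
    (i : ι) : DifferentiableOn ℂ (fun θ => volterraIter d V e θ n x i) {θ | θ.re < 0} := by
  induction n generalizing x i with
  | zero => exact differentiableOn_const _
  | succ n ih =>
    refine differentiableOn_integral_of_dominated isOpen_re_neg
      (g := fun y => (∑ j, ‖V i j y‖) * (‖e‖ * (entryMass V ^ n / n.factorial))) ?_ ?_ ?_ ?_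
    · intro θ hθ
      exact (integrableOn_exp_mul (le_of_lt hθ) (hd i) x (integrable_sum_mul hV
        (enorm_volterraIter_le_and_measurable hV (le_of_lt hθ) hd n).1.measurable
        (norm_volterraIter_le hV (le_of_lt hθ) hd n) i).integrableOn).1
    · refine Filter.Eventually.of_forall fun y => ?_
      refine DifferentiableOn.mul ?_ ?_
      · exact (by fun_prop : Differentiable ℂ fun θ : ℂ =>
          Complex.exp (θ * d i * (x - y))).differentiableOn
      · exact DifferentiableOn.fun_sum fun j _ => (ih y j).const_mul _
    · refine (ae_restrict_mem measurableSet_Iic).mono fun y hy θ hθ => ?_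
      refine (enorm_le_iff_norm_le.1 (enorm_exp_mul_le (le_of_lt hθ) (hd i) hy _)).trans ?_
      rw [Finset.sum_mul]
      refine (norm_sum_le _ _).trans ?_
      gcongr with j
      rw [norm_mul]
      gcongr
      exact (norm_le_pi_norm _ j).trans (norm_volterraIter_le hV (le_of_lt hθ) hd n y)
    · exact ((integrable_finsetSum _ fun j _ => (hV.integrable i j).norm).mul_const _).integrableOn

lemma differentiableOn_volterraSol (hV : IntegrableMatrix V) (hd : ∀ i, 0 ≤ d i) (x : ℝ)
    (i : ι) : DifferentiableOn ℂ (fun θ => volterraSol d V e θ x i) {θ | θ.re < 0} :=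
  Complex.differentiableOn_tsum_of_summable_norm (summable_volterraIter_bound ‖e‖ (entryMass V))
    (fun n => differentiableOn_volterraIter hV hd n x i) isOpen_re_neg
    fun n _ hθ => (norm_le_pi_norm _ i).trans (norm_volterraIter_le hV (le_of_lt hθ) hd n x)

end Volterra

end NLSGI

namespace NLSGI

noncomputable section LTwo

/-! ### The `L²` norm of functions with values in `[0, ∞]` -/

/-- The `L²` norm of a function with values in `[0, ∞]`. -/
def l2norm {α : Type*} [MeasurableSpace α] (μ : Measure α) (f : α → ℝ≥0∞) : ℝ≥0∞ :=
  (∫⁻ z, f z ^ 2 ∂μ) ^ (1 / 2 : ℝ)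

variable {α β : Type*} [MeasurableSpace α] [MeasurableSpace β] {μ : Measure α} {ν : Measure β}

lemma eLpNorm_two_eq_l2norm {E : Type*} [NormedAddCommGroup E] (f : α → E) :
    eLpNorm f 2 μ = l2norm μ fun z => ‖f z‖ₑ := by
  rw [eLpNorm_eq_lintegral_rpow_enorm_toReal (by norm_num) (by norm_num), l2norm]
  simp

lemma l2norm_sq (f : α → ℝ≥0∞) : l2norm μ f ^ 2 = ∫⁻ z, f z ^ 2 ∂μ := by
  rw [l2norm, ← ENNReal.rpow_natCast, ← ENNReal.rpow_mul]
  norm_num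

lemma l2norm_mono_ae {f g : α → ℝ≥0∞} (h : ∀ᵐ z ∂μ, f z ≤ g z) : l2norm μ f ≤ l2norm μ g := by
  unfold l2norm
  gcongr 1
  refine lintegral_mono_ae ?_
  filter_upwards [h] with z hz
  gcongr

lemma l2norm_mono {f g : α → ℝ≥0∞} (h : ∀ z, f z ≤ g z) : l2norm μ f ≤ l2norm μ g :=
  l2norm_mono_ae (Filter.Eventually.of_forall h)

lemma l2norm_mono_measure {μ μ' : Measure α} (h : μ ≤ μ') (f : α → ℝ≥0∞) :
    l2norm μ f ≤ l2norm μ' f := by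
  unfold l2norm
  gcongr 1
  exact lintegral_mono' h le_rfl

lemma l2norm_add_le {f g : α → ℝ≥0∞} (hf : AEMeasurable f μ) (hg : AEMeasurable g μ) :
    l2norm μ (fun z => f z + g z) ≤ l2norm μ f + l2norm μ g := by
  have := ENNReal.lintegral_Lp_add_le hf hg (p := 2) (by norm_num)
  simpa [l2norm] using this

lemma l2norm_const_mul {f : α → ℝ≥0∞} (hf : AEMeasurable f μ) (c : ℝ≥0∞) :
    l2norm μ (fun z => c * f z) = c * l2norm μ f := by
  unfold l2norm
  simp_rw [mul_pow]
  rw [lintegral_const_mul'' _ (hf.pow_const 2), ENNReal.mul_rpow_of_nonneg _ _ (by norm_num),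
    ← ENNReal.rpow_natCast, ← ENNReal.rpow_mul]
  norm_num

lemma l2norm_sum_le {ι : Type*} (s : Finset ι) {f : ι → α → ℝ≥0∞} (hf : ∀ i, Measurable (f i)) :
    l2norm μ (fun z => ∑ i ∈ s, f i z) ≤ ∑ i ∈ s, l2norm μ (f i) := by
  classical
  induction s using Finset.induction_on with
  | empty => simp [l2norm]
  | insert i s hi ih =>
    simp_rw [Finset.sum_insert hi]
    refine (l2norm_add_le (hf i).aemeasurable
      (Finset.measurable_fun_sum _ fun j _ => hf j).aemeasurable).trans ?_
    gcongr

lemma lintegral_mul_le_l2norm {f g : α → ℝ≥0∞} (hf : AEMeasurable f μ) (hg : AEMeasurable g μ) :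
    ∫⁻ z, f z * g z ∂μ ≤ l2norm μ f * l2norm μ g := by
  have := ENNReal.lintegral_mul_le_Lp_mul_Lq μ Real.HolderConjugate.two_two hf hg
  simpa [l2norm] using this

/-- Minkowski's integral inequality in `L²`. -/
lemma l2norm_lintegral_le [SFinite μ] [SFinite ν] {f : α → β → ℝ≥0∞}
    (hf : Measurable (Function.uncurry f)) :
    l2norm μ (fun z => ∫⁻ y, f z y ∂ν) ≤ ∫⁻ y, l2norm μ (fun z => f z y) ∂ν := by
  have hfy : ∀ y, Measurable fun z => f z y := fun y => hf.comp measurable_prodMk_right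
  have hfz : ∀ z, Measurable (f z) := fun z => hf.comp measurable_prodMk_left
  -- The square is opened into a double integral over `(y, y')`, and Cauchy–Schwarz in `z` is
  -- applied for each pair.
  have h1 : ∫⁻ z, (∫⁻ y, f z y ∂ν) ^ 2 ∂μ ≤ (∫⁻ y, l2norm μ (fun z => f z y) ∂ν) ^ 2 := by
    have hN : Measurable fun y => l2norm μ (fun z => f z y) := by
      unfold l2norm
      exact ((hf.pow_const 2).lintegral_prod_left').pow_const _
    calc ∫⁻ z, (∫⁻ y, f z y ∂ν) ^ 2 ∂μ
        = ∫⁻ z, ∫⁻ y, ∫⁻ y', f z y * f z y' ∂ν ∂ν ∂μ := by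
          congr 1 with z
          rw [pow_two, ← lintegral_mul_const _ (hfz z)]
          congr 1 with y
          rw [lintegral_const_mul _ (hfz z)]
      _ = ∫⁻ y, ∫⁻ z, ∫⁻ y', f z y * f z y' ∂ν ∂μ ∂ν := by
          rw [lintegral_lintegral_swap]
          refine Measurable.aemeasurable ?_
          refine Measurable.lintegral_prod_right' (f := fun p : (α × β) × β =>
            f p.1.1 p.1.2 * f p.1.1 p.2) ?_
          exact (hf.comp measurable_fst).mul
            (hf.comp ((measurable_fst.comp measurable_fst).prodMk measurable_snd))
      _ = ∫⁻ y, ∫⁻ y', ∫⁻ z, f z y * f z y' ∂μ ∂ν ∂ν := by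
          congr 1 with y
          rw [lintegral_lintegral_swap]
          refine Measurable.aemeasurable ?_
          exact ((hfy y).comp measurable_fst).mul hf
      _ ≤ ∫⁻ y, ∫⁻ y', l2norm μ (fun z => f z y) * l2norm μ (fun z => f z y') ∂ν ∂ν := by
          gcongr with y y'
          exact lintegral_mul_le_l2norm (hfy y).aemeasurable (hfy y').aemeasurable
      _ = (∫⁻ y, l2norm μ (fun z => f z y) ∂ν) ^ 2 := by
          rw [pow_two, ← lintegral_mul_const _ hN]
          congr 1 with y
          rw [lintegral_const_mul _ hN]
  calc l2norm μ (fun z => ∫⁻ y, f z y ∂ν)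
      ≤ ((∫⁻ y, l2norm μ (fun z => f z y) ∂ν) ^ 2) ^ (1 / 2 : ℝ) := by
        unfold l2norm at h1 ⊢; gcongr 1
    _ = _ := by
        rw [← ENNReal.rpow_natCast, ← ENNReal.rpow_mul]; norm_num

/-- Bounds of the `L²` norms on compact intervals bound the `L²` norm. -/
lemma l2norm_le_of_Icc {f : ℝ → ℝ≥0∞} (hf : Measurable f) {c : ℝ≥0∞}
    (h : ∀ n : ℕ, l2norm (volume.restrict (Icc (-(n : ℝ)) n)) f ≤ c) : l2norm volume f ≤ c := by
  have hcov : AECover volume Filter.atTop fun n : ℕ => Icc (-(n : ℝ)) n :=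
    aecover_Icc (Filter.tendsto_neg_atTop_atBot.comp tendsto_natCast_atTop_atTop)
      tendsto_natCast_atTop_atTop
  have ht := hcov.lintegral_tendsto_of_countably_generated (hf.pow_const 2).aemeasurable
  have ht2 := (ENNReal.continuous_rpow_const (y := (1 / 2 : ℝ))).continuousAt.tendsto.comp ht
  exact le_of_tendsto' ht2 h

/-- Gronwall's inequality for `L²` norms with respect to a parameter. -/
lemma l2norm_gronwall {μ : Measure ℝ} [IsFiniteMeasure μ] [NullSingletonClass μ]
    {f S : ℝ → ℝ → ℝ≥0∞} {x₀ : ℝ} {M h : ℝ≥0∞} (hf : Measurable (Function.uncurry f))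
    (hMt : M ≠ ⊤) (hM : ∀ z, ∀ x ≤ x₀, f z x ≤ M) (hS : ∀ x, Measurable fun z => S z x)
    (hfS : ∀ z, ∀ x ≤ x₀, f z x ≤ S z x + ∫⁻ y in Iic x, f z y ∂μ)
    (hh : ∀ x ≤ x₀, l2norm volume (fun z => S z x) ≤ h) :
    l2norm volume (fun z => f z x₀) ≤ h * ENNReal.ofReal (Real.exp (μ (Iic x₀)).toReal) := by
  refine l2norm_le_of_Icc (hf.comp measurable_prodMk_right) fun n => ?_
  -- Gronwall needs an a priori finite bound, and a constant has finite `L²` norm only on bounded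
  -- sets of `z`. The resulting estimate does not involve `n`.
  set ν : Measure ℝ := volume.restrict (Icc (-(n : ℝ)) n) with hν
  have hfin : l2norm ν (fun _ => M) ≠ ⊤ := by
    unfold l2norm
    refine ENNReal.rpow_ne_top_of_nonneg (by norm_num) ?_
    rw [lintegral_const]
    refine ENNReal.mul_ne_top (by finiteness) ?_
    rw [hν, Measure.restrict_apply_univ, Real.volume_Icc]
    finiteness
  refine gronwall (N := fun x => l2norm ν (fun z => f z x)) hfin
    (fun x hx => l2norm_mono fun z => hM z x hx) fun x hx => ?_
  have hI : Measurable fun z => ∫⁻ y in Iic x, f z y ∂μ :=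
    Measurable.lintegral_prod_right' (f := Function.uncurry f) hf
  calc l2norm ν (fun z => f z x) ≤ l2norm ν (fun z => S z x + ∫⁻ y in Iic x, f z y ∂μ) :=
        l2norm_mono fun z => hfS z x hx
    _ ≤ l2norm ν (fun z => S z x) + l2norm ν (fun z => ∫⁻ y in Iic x, f z y ∂μ) :=
        l2norm_add_le (hS x).aemeasurable hI.aemeasurable
    _ ≤ h + ∫⁻ y in Iic x, l2norm ν (fun z => f z y) ∂μ := by
        gcongr
        · exact (l2norm_mono_measure Measure.restrict_le_self _).trans (hh x hx)
        · exact l2norm_lintegral_le hf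

end LTwo

/-! ### Plancherel's theorem for integrable square integrable functions -/

section Plancherel

open scoped FourierTransform SchwartzMap

/-- The `L²` transform of the class of `s` agrees almost everywhere with the Fourier integral:
paired with a test function, both give the pairing of `s` with the transform of that function. The
isometry property then passes to the integral. -/
lemma eLpNorm_fourier_eq {s : ℝ → ℂ} (h1 : Integrable s) (h2 : MemLp s 2) :
    eLpNorm (𝓕 s) 2 volume = eLpNorm s 2 volume := by
  set f : Lp ℂ 2 (volume : Measure ℝ) := h2.toLp s with hf
  set F : Lp ℂ 2 (volume : Measure ℝ) := 𝓕 f with hF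
  have hcont : Continuous (𝓕 s) :=
    VectorFourier.fourierIntegral_continuous Real.continuous_fourierChar
      (by exact continuous_inner) h1
  have hae : 𝓕 s =ᵐ[volume] F := by
    refine ae_eq_of_integral_contDiff_smul_eq hcont.locallyIntegrable
      ((Lp.memLp F).locallyIntegrable (by norm_num)) fun g hg hgs => ?_
    have hgc : HasCompactSupport fun x => (g x : ℂ) := hgs.comp_left Complex.ofReal_zero
    have hgd : ContDiff ℝ ∞ fun x => (g x : ℂ) := Complex.ofRealCLM.contDiff.comp hg
    set G : 𝓢(ℝ, ℂ) := hgc.toSchwartzMap hgd with hG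
    have e1 : (F : 𝓢'(ℝ, ℂ)) G = (f : 𝓢'(ℝ, ℂ)) (𝓕 G) := by
      rw [hF, ← Lp.fourier_toTemperedDistribution_eq]
      rfl
    rw [Lp.toTemperedDistribution_apply, Lp.toTemperedDistribution_apply] at e1
    have e2 : ∫ x, (𝓕 G) x • f x = ∫ x, (𝓕 G) x • s x := by
      refine integral_congr_ae ?_
      filter_upwards [h2.coeFn_toLp] with x hx
      rw [hf, hx]
    have e3 : ∫ x, (𝓕 (G : ℝ → ℂ)) x • s x = ∫ x, G x • 𝓕 s x := by
      have := VectorFourier.integral_fourierIntegral_smul_eq_flip (L := innerₗ ℝ) (μ := volume)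
        (ν := volume) (f := (G : ℝ → ℂ)) (g := s) Real.continuous_fourierChar
        (by exact continuous_inner) G.integrable h1
      rw [flip_innerₗ] at this
      exact this
    calc ∫ x, g x • 𝓕 s x = ∫ x, G x • 𝓕 s x := by
          congr 1
      _ = ∫ x, G x • F x := by rw [e1, e2]; exact e3.symm
      _ = ∫ x, g x • F x := by
          congr 1
  rw [eLpNorm_congr_ae hae, ← eLpNorm_congr_ae h2.coeFn_toLp]
  have := Lp.norm_fourier_eq f
  rw [Lp.norm_def, Lp.norm_def, ENNReal.toReal_eq_toReal_iff' (Lp.eLpNorm_ne_top _)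
    (Lp.eLpNorm_ne_top _)] at this
  exact this

lemma lintegral_comp_div_pi {g : ℝ → ℝ≥0∞} (hg : Measurable g) :
    ∫⁻ z, g (z / Real.pi) = ENNReal.ofReal Real.pi * ∫⁻ z, g z := by
  have hpi := Real.pi_pos
  have h := Real.map_volume_mul_right (inv_ne_zero hpi.ne')
  have : ∫⁻ z, g (z * Real.pi⁻¹) = ∫⁻ z, g z ∂(Measure.map (· * Real.pi⁻¹) volume) := by
    rw [lintegral_map hg (by fun_prop)]
  simp_rw [div_eq_mul_inv]
  rw [this, h, lintegral_smul_measure, inv_inv, abs_of_pos hpi, smul_eq_mul]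

/-- Plancherel's theorem for the phase `e^{2i(z+1)(x-y)}`. -/
lemma l2norm_integral_exp_mul_le {s : ℝ → ℂ} (h1 : Integrable s) (h2 : MemLp s 2) (x : ℝ) :
    l2norm volume (fun z : ℝ => ‖∫ y : ℝ, Complex.exp (2 * Complex.I * ((z : ℂ) + 1) * (x - y)) * s y‖ₑ)
      ≤ 2 * eLpNorm s 2 volume := by
  -- The modulation absorbs the `+1` in `z + 1`. What remains is the Fourier integral at frequency
  -- `z / π`, up to a unimodular factor depending on `x` and `z`.
  set s' : ℝ → ℂ := fun y => Complex.exp (-(2 * Complex.I * y)) * s y with hs'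
  have hne : ∀ y : ℝ, ‖Complex.exp (-(2 * Complex.I * y))‖ = 1 := fun y => by
    rw [show -(2 * Complex.I * y) = ((-(2 * y) : ℝ) : ℂ) * Complex.I by push_cast; ring,
      Complex.norm_exp_ofReal_mul_I]
  have hc : Continuous fun y : ℝ => Complex.exp (-(2 * Complex.I * y)) := by fun_prop
  have hsm : AEStronglyMeasurable s' volume := hc.aestronglyMeasurable.mul h1.1
  have hn : ∀ y, ‖s' y‖ = ‖s y‖ := fun y => by rw [hs']; simp [hne]
  have h1' : Integrable s' := h1.mono hsm (Filter.Eventually.of_forall fun y => (hn y).le)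
  have h2' : MemLp s' 2 := h2.mono hsm (Filter.Eventually.of_forall fun y => (hn y).le)
  have hF : ∀ z : ℝ, ‖∫ y : ℝ, Complex.exp (2 * Complex.I * ((z : ℂ) + 1) * (x - y)) * s y‖ₑ =
      ‖𝓕 s' (z / Real.pi)‖ₑ := by
    intro z
    have e1 : ∀ y : ℝ, Complex.exp (2 * Complex.I * ((z : ℂ) + 1) * (x - y)) * s y =
        Complex.exp (((2 * (z + 1) * x : ℝ) : ℂ) * Complex.I) *
          (Complex.exp (↑(-2 * Real.pi * y * (z / Real.pi)) * Complex.I) • s' y) := by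
      intro y
      rw [hs', smul_eq_mul, ← mul_assoc, ← mul_assoc, ← Complex.exp_add, ← Complex.exp_add]
      congr 2
      have : (-2 * Real.pi * y * (z / Real.pi)) = -2 * y * z := by
        field_simp
      rw [this]
      push_cast
      ring
    rw [Real.fourier_real_eq_integral_exp_smul]
    simp_rw [e1]
    rw [integral_const_mul, enorm_mul, ← ofReal_norm, Complex.norm_exp_ofReal_mul_I]
    simp
  simp_rw [hF]
  have hm : Measurable fun z => ‖𝓕 s' z‖ₑ ^ 2 := by
    have hcont : Continuous (𝓕 s') :=
      VectorFourier.fourierIntegral_continuous Real.continuous_fourierChar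
        (by exact continuous_inner) h1'
    exact hcont.measurable.enorm.pow_const 2
  have hs2 : eLpNorm s' 2 volume = eLpNorm s 2 volume :=
    eLpNorm_congr_norm_ae (Filter.Eventually.of_forall hn)
  rw [← hs2, ← eLpNorm_fourier_eq h1' h2', eLpNorm_two_eq_l2norm, l2norm,
    lintegral_comp_div_pi (g := fun z => ‖𝓕 s' z‖ₑ ^ 2) hm,
    ENNReal.mul_rpow_of_nonneg _ _ (by norm_num), ← l2norm]
  gcongr
  -- Rescaling the frequency by `π` costs `√π`, and `√π ≤ 2`.
  calc (ENNReal.ofReal Real.pi) ^ (1 / 2 : ℝ) ≤ (ENNReal.ofReal 4) ^ (1 / 2 : ℝ) := by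
        gcongr; exact Real.pi_le_four
    _ = ((2 : ℝ≥0∞) ^ (2 : ℕ)) ^ (1 / 2 : ℝ) := by norm_num
    _ = 2 := by rw [← ENNReal.rpow_natCast, ← ENNReal.rpow_mul]; norm_num

end Plancherel

end NLSGI

namespace NLSGI

set_option linter.unusedSectionVars false

/-! ### Volterra systems with phases `0` and `1`: bounds in the spectral variable. -/

noncomputable section AKNS

/-- The exponent `2i(z + 1)`. -/
def theta (z : ℂ) : ℂ := 2 * Complex.I * (z + 1)

lemma theta_re (z : ℂ) : (theta z).re = -(2 * z.im) := by
  simp [theta]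

lemma theta_ofReal_re (z : ℝ) : (theta z).re ≤ 0 := by simp [theta_re]

lemma continuous_theta : Continuous theta := by unfold theta; fun_prop

/-- A continuous bounded square integrable function whose translates differ from it in `L²` by
at most a multiple of the translation. -/
structure IsH1Bound (f : ℝ → ℂ) (K : ℝ) : Prop where
  continuous : Continuous f
  bounded : ∀ z, ‖f z‖ ≤ K
  l2 : eLpNorm f 2 volume ≤ ENNReal.ofReal K
  shift : ∀ h : ℝ, eLpNorm (fun z => f (z + h) - f z) 2 volume ≤ ENNReal.ofReal (K * |h|)

/-- The weight `(1 + x²)^{1/2}`. -/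
def wt (x : ℝ) : ℝ := Real.sqrt (1 + x ^ 2)

lemma wt_pos (x : ℝ) : 0 < wt x := Real.sqrt_pos.2 (by positivity)

lemma one_le_wt (x : ℝ) : 1 ≤ wt x := Real.one_le_sqrt.2 (by nlinarith [sq_nonneg x])

lemma abs_le_wt (x : ℝ) : |x| ≤ wt x := by
  rw [← Real.sqrt_sq_eq_abs]
  exact Real.sqrt_le_sqrt (by linarith)

lemma wt_anti {x y : ℝ} (hx : x ≤ 0) (hy : y ≤ x) : wt x ≤ wt y :=
  Real.sqrt_le_sqrt (by nlinarith)

lemma continuous_wt : Continuous wt := by unfold wt; fun_prop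

lemma wt_zero : wt 0 = 1 := by simp [wt]

variable {ι : Type*} [Fintype ι] {d : ι → ℝ} {V W : ι → ι → ℝ → ℂ} {e : ι → ℂ} {θ : ℂ}

/-- The quantitative hypotheses on the coefficients of a Volterra equation: the phases are `0`
or `1`, the coefficients are integrable, and the inhomogeneity `V e` lives in the components of
phase `1`, where it lies in `L^{2,1}`. -/
structure IsAKNS (d : ι → ℝ) (V : ι → ι → ℝ → ℂ) (e : ι → ℂ) (M : ℝ) : Prop where
  matrix : IntegrableMatrix V
  phase : ∀ i, d i = 0 ∨ d i = 1
  init : ∀ j, e j = 0 ∨ d j = 0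
  init_le : ‖e‖ ≤ 1
  source_zero : ∀ i, d i = 0 → ∀ y, ∑ j, V i j y * e j = 0
  mass : ∫⁻ y, entrySum V y ≤ ENNReal.ofReal M
  source : ∀ i, normL21 (fun y => ∑ j, V i j y * e j) ≤ ENNReal.ofReal M

lemma phase_nonneg (h : ∀ i, d i = 0 ∨ d i = 1) (i : ι) : 0 ≤ d i := by
  rcases h i with h | h <;> simp [h]

lemma volterraOp_sub (hV : IntegrableMatrix V) (hθ : θ.re ≤ 0) (hd : ∀ i, 0 ≤ d i)
    {X Y : ℝ → ι → ℂ} (hX : Measurable X) (hY : Measurable Y) {A B : ℝ} (hA : ∀ x, ‖X x‖ ≤ A)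
    (hB : ∀ x, ‖Y x‖ ≤ B) (x : ℝ) :
    volterraOp d V θ (fun y => X y - Y y) x = volterraOp d V θ X x - volterraOp d V θ Y x := by
  ext i
  rw [Pi.sub_apply]
  unfold volterraOp
  rw [← integral_sub
    (integrableOn_exp_mul hθ (hd i) x (integrable_sum_mul hV hX hA i).integrableOn)
    (integrableOn_exp_mul hθ (hd i) x (integrable_sum_mul hV hY hB i).integrableOn)]
  congr 1 with y
  rw [← mul_sub, ← Finset.sum_sub_distrib]
  simp [mul_sub]

lemma IntegrableMatrix.sub (hV : IntegrableMatrix V) (hW : IntegrableMatrix W) :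
    IntegrableMatrix (V - W) :=
  ⟨fun i j => (hV.measurable i j).sub (hW.measurable i j),
    fun i j => (hV.integrable i j).sub (hW.integrable i j)⟩

lemma volterraOp_matrix_sub (hV : IntegrableMatrix V) (hW : IntegrableMatrix W) (hθ : θ.re ≤ 0)
    (hd : ∀ i, 0 ≤ d i) {X : ℝ → ι → ℂ} (hX : Measurable X) {A : ℝ} (hA : ∀ x, ‖X x‖ ≤ A)
    (x : ℝ) : volterraOp d (V - W) θ X x = volterraOp d V θ X x - volterraOp d W θ X x := by
  ext i
  rw [Pi.sub_apply]
  unfold volterraOp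
  rw [← integral_sub
    (integrableOn_exp_mul hθ (hd i) x (integrable_sum_mul hV hX hA i).integrableOn)
    (integrableOn_exp_mul hθ (hd i) x (integrable_sum_mul hW hX hA i).integrableOn)]
  congr 1 with y
  rw [← mul_sub, ← Finset.sum_sub_distrib]
  simp [sub_mul]

lemma measurable_volterraOp_const (hV : IntegrableMatrix V) (hd : ∀ i, 0 ≤ d i) (e : ι → ℂ)
    (x : ℝ) : Continuous fun z : ℝ => volterraOp d V (theta z) (fun _ => e) x :=
  (continuous_volterraOp (P := ℝ) (ϑ := fun z => theta z) (X := fun _ _ => e) (M := ‖e‖) hV hd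
    (continuous_theta.comp Complex.continuous_ofReal) theta_ofReal_re continuous_const
    fun _ _ => le_rfl).comp (by fun_prop : Continuous fun z : ℝ => (z, x))

/-- The `L²` norm in `z` of an oscillatory integral over a half-line. -/
lemma l2norm_integral_Iic_exp_mul_le {s : ℝ → ℂ} (hs : Integrable s) (x : ℝ) :
    l2norm volume (fun z : ℝ => ‖∫ y : ℝ in Iic x, Complex.exp (theta z * (x - y)) * s y‖ₑ)
      ≤ 2 * eLpNorm ((Iic x).indicator s) 2 volume := by
  rcases eq_or_ne (eLpNorm ((Iic x).indicator s) 2 volume) ⊤ with h | h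
  · rw [h]; simp
  have hi : Integrable ((Iic x).indicator s) := hs.indicator measurableSet_Iic
  refine le_of_eq_of_le ?_ (l2norm_integral_exp_mul_le hi ⟨hi.1, h.lt_top⟩ x)
  congr 1 with z
  rw [← integral_indicator measurableSet_Iic]
  congr 2 with y
  by_cases hy : y ∈ Iic x
  · simp [indicator_of_mem hy, theta]
  · simp [indicator_of_notMem hy]

/-- Rows of phase `0` contribute nothing by `h0`; rows of phase `1` are oscillatory integrals of
functions independent of `z`, to which Plancherel applies. This controls the forcing in both
Gronwall arguments below, with `W` the matrix itself or the increment of its gauge transform. -/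
lemma l2norm_volterraOp_const_le (hW : IntegrableMatrix W) (hd : ∀ i, d i = 0 ∨ d i = 1)
    (h0 : ∀ i, d i = 0 → ∀ y, ∑ j, W i j y * e j = 0) {c : ℝ≥0∞} {x : ℝ}
    (hc : ∀ i, eLpNorm ((Iic x).indicator fun y => ∑ j, W i j y * e j) 2 volume ≤ c) :
    l2norm volume (fun z : ℝ => ‖volterraOp d W (theta z) (fun _ => e) x‖ₑ) ≤
      Fintype.card ι * (2 * c) := by
  have hcont := measurable_volterraOp_const hW (phase_nonneg hd) e x
  calc _ ≤ l2norm volume (fun z : ℝ => ∑ i, ‖volterraOp d W (theta z) (fun _ => e) x i‖ₑ) := by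
        refine l2norm_mono fun z => pi_enorm_le fun i => ?_
        exact Finset.single_le_sum (f := fun i => ‖volterraOp d W (theta z) (fun _ => e) x i‖ₑ)
          (fun _ _ => zero_le) (Finset.mem_univ i)
    _ ≤ ∑ i, l2norm volume (fun z : ℝ => ‖volterraOp d W (theta z) (fun _ => e) x i‖ₑ) :=
        l2norm_sum_le _ fun i => ((continuous_apply i).comp hcont).measurable.enorm
    _ ≤ ∑ _i : ι, 2 * c := by
        gcongr with i
        rcases hd i with hi | hi
        · simp [volterraOp, h0 i hi, l2norm]
        · refine le_trans (le_of_eq ?_) ((l2norm_integral_Iic_exp_mul_le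
            (integrable_sum_mul hW (X := fun _ => e) measurable_const (fun _ => le_rfl) i) x).trans
              (mul_le_mul_right (hc i) 2))
          simp [volterraOp, hi]
    _ = _ := by simp

/-- To the left of `x ≤ 0` the weight is at least `wt x`, so the `L^{2,1}` norm yields decay in `x`.
For positive `x` this fails, which is why solutions are studied on the left half-line only. -/
lemma eLpNorm_indicator_Iic_le {s : ℝ → ℂ} {M : ℝ} (hs : normL21 s ≤ ENNReal.ofReal M)
    {x : ℝ} (hx : x ≤ 0) :
    eLpNorm ((Iic x).indicator s) 2 volume ≤ ENNReal.ofReal (M / wt x) := by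
  have h1 : eLpNorm ((Iic x).indicator s) 2 volume ≤
      ENNReal.ofReal (wt x)⁻¹ * eLpNorm (fun y => (wt y : ℂ) * s y) 2 volume := by
    refine eLpNorm_le_mul_eLpNorm_of_ae_le_mul (Filter.Eventually.of_forall fun y => ?_) 2
    by_cases hy : y ∈ Iic x
    · rw [indicator_of_mem hy, norm_mul, Complex.norm_real, Real.norm_of_nonneg (wt_pos y).le,
        ← mul_assoc]
      refine le_mul_of_one_le_left (norm_nonneg _) ?_
      rw [inv_mul_eq_div, one_le_div (wt_pos x)]
      exact wt_anti hx hy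
    · rw [indicator_of_notMem hy, norm_zero]
      have := wt_pos x
      positivity
  refine h1.trans ?_
  rw [div_eq_inv_mul, ENNReal.ofReal_mul (by have := wt_pos x; positivity)]
  gcongr
  exact hs

lemma entryMeasure_Iic_toReal_le {M : ℝ} (hM : 0 ≤ M)
    (h : ∫⁻ y, entrySum V y ≤ ENNReal.ofReal M) (x : ℝ) :
    (entryMeasure V (Iic x)).toReal ≤ M := by
  refine ENNReal.toReal_le_of_le_ofReal hM (le_trans ?_ h)
  rw [entryMeasure, withDensity_apply _ measurableSet_Iic]
  exact setLIntegral_le_lintegral _ _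

lemma entryMass_le {M : ℝ} (hM : 0 ≤ M) (h : ∫⁻ y, entrySum V y ≤ ENNReal.ofReal M) :
    entryMass V ≤ M := by
  refine ENNReal.toReal_le_of_le_ofReal hM (le_trans ?_ h)
  rw [entryMeasure, withDensity_apply _ MeasurableSet.univ, Measure.restrict_univ]

lemma continuous_uncurry_volterraSol (hV : IntegrableMatrix V) (hd : ∀ i, 0 ≤ d i) :
    Continuous fun q : ℝ × ℝ => volterraSol d V e (theta q.1) q.2 :=
  continuous_volterraSol (P := ℝ) (ϑ := fun z => theta z) hV hd
    (continuous_theta.comp Complex.continuous_ofReal) theta_ofReal_re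

/-- The solution minus its initial vector is `O((1 + x²)^{-1/2})` in `L²` as a function
of `z`. -/
lemma IsAKNS.l2norm_sub_le {M : ℝ} (hM : 0 ≤ M) (h : IsAKNS d V e M) {x : ℝ} (hx : x ≤ 0) :
    l2norm volume (fun z : ℝ => ‖volterraSol d V e (theta z) x - e‖ₑ) ≤
      ENNReal.ofReal (Fintype.card ι * (2 * M) * Real.exp M / wt x) := by
  have hd := phase_nonneg h.phase
  have := h.matrix.isFiniteMeasure
  have hb : ∀ (z x : ℝ), ‖volterraSol d V e (theta z) x‖ ≤ ‖e‖ * Real.exp (entryMass V) :=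
    fun z x => norm_volterraSol_le h.matrix (theta_ofReal_re z) hd x
  have hc := continuous_uncurry_volterraSol (e := e) h.matrix hd
  have hcz : ∀ z : ℝ, Continuous (volterraSol d V e (theta z)) := fun z =>
    hc.comp (by fun_prop : Continuous fun x : ℝ => (z, x))
  have key := l2norm_gronwall (μ := entryMeasure V) (x₀ := x)
    (f := fun z x => ‖volterraSol d V e (theta z) x - e‖ₑ)
    (S := fun z x => ‖volterraOp d V (theta z) (fun _ => e) x‖ₑ)
    (M := ENNReal.ofReal (‖e‖ * Real.exp (entryMass V) + ‖e‖))
    (h := Fintype.card ι * (2 * ENNReal.ofReal (M / wt x)))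
    (hc.sub continuous_const).measurable.enorm ENNReal.ofReal_ne_top ?_ ?_ ?_ ?_
  · refine key.trans ?_
    have h1 : ENNReal.ofReal (Real.exp (entryMeasure V (Iic x)).toReal) ≤
        ENNReal.ofReal (Real.exp M) := by
      gcongr
      exact entryMeasure_Iic_toReal_le hM h.mass x
    refine (mul_le_mul_right h1 _).trans (le_of_eq ?_)
    have := wt_pos x
    rw [← ENNReal.ofReal_natCast, show (2 : ℝ≥0∞) = ENNReal.ofReal 2 by norm_num,
      ← ENNReal.ofReal_mul (by positivity), ← ENNReal.ofReal_mul (by positivity),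
      ← ENNReal.ofReal_mul (by positivity)]
    congr 1
    ring
  · intro z y _
    rw [← ofReal_norm]
    exact ENNReal.ofReal_le_ofReal ((norm_sub_le _ _).trans (by gcongr; exact hb z y))
  · exact fun y => (measurable_volterraOp_const h.matrix hd e y).measurable.enorm
  · intro z y _
    have hsol := isVolterraSol_volterraSol (e := e) h.matrix (theta_ofReal_re z) hd
    -- The difference `X - e` solves the same equation, with the constant vector replaced by the
    -- forcing that `e` produces.
    have e1 : volterraSol d V e (theta z) y - e = volterraOp d V (theta z) (fun _ => e) y +
        volterraOp d V (theta z) (fun t => volterraSol d V e (theta z) t - e) y := by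
      rw [volterraOp_sub h.matrix (theta_ofReal_re z) hd (hcz z).measurable measurable_const
        (hb z) (fun _ => le_rfl)]
      ext i
      simp only [Pi.sub_apply, Pi.add_apply, hsol.eq y i]
      ring
    rw [e1]
    refine (enorm_add_le _ _).trans ?_
    gcongr
    exact enorm_volterraOp_le h.matrix (theta_ofReal_re z) hd ((hcz z).sub continuous_const).measurable y
  -- The forcing at `y ≤ x` is `O(1 / wt y)`, hence `O(1 / wt x)` uniformly on the half-line.
  -- Gronwall on `(-∞, x]` therefore keeps the decay.
  · intro y hy
    refine l2norm_volterraOp_const_le h.matrix h.phase h.source_zero fun i => ?_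
    refine (eLpNorm_indicator_Iic_le (h.source i) (hy.trans hx)).trans ?_
    refine ENNReal.ofReal_le_ofReal ?_
    have := wt_pos x
    gcongr
    exact wt_anti hx hy

/-- The gauge transformation of the coefficients that corresponds to the translation of `z`
by `h`. -/
def gauge (d : ι → ℝ) (V : ι → ι → ℝ → ℂ) (h : ℝ) (i j : ι) (y : ℝ) : ℂ :=
  Complex.exp (Complex.I * ((-2 * h * (d i - d j) * y : ℝ) : ℂ)) * V i j y

lemma enorm_gauge (h : ℝ) (i j : ι) (y : ℝ) : ‖gauge d V h i j y‖ₑ = ‖V i j y‖ₑ := by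
  rw [gauge, enorm_mul, ← ofReal_norm, Complex.norm_exp_I_mul_ofReal]
  simp

lemma IntegrableMatrix.gauge (hV : IntegrableMatrix V) (h : ℝ) :
    IntegrableMatrix (gauge d V h) := by
  have hm : ∀ i j, Measurable (NLSGI.gauge d V h i j) := fun i j => by
    refine Measurable.mul ?_ (hV.measurable i j)
    exact (by fun_prop : Continuous fun y : ℝ =>
      Complex.exp (Complex.I * ((-2 * h * (d i - d j) * y : ℝ) : ℂ))).measurable
  refine ⟨hm, fun i j => (hV.integrable i j).mono (hm i j).aestronglyMeasurable ?_⟩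
  exact Filter.Eventually.of_forall fun y => enorm_le_iff_norm_le.1 (enorm_gauge h i j y).le

lemma entryMeasure_gauge (h : ℝ) : entryMeasure (gauge d V h) = entryMeasure V := by
  unfold entryMeasure entrySum
  simp_rw [enorm_gauge]

lemma norm_exp_phase_sub_one_le (hd : ∀ i, d i = 0 ∨ d i = 1) (h : ℝ) (i j : ι) (y : ℝ) :
    ‖Complex.exp (Complex.I * ((-2 * h * (d i - d j) * y : ℝ) : ℂ)) - 1‖ ≤ 2 * |h| * |y| := by
  refine (Real.norm_exp_I_mul_ofReal_sub_one_le).trans ?_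
  rw [Real.norm_eq_abs, abs_mul, abs_mul, abs_mul, abs_neg, abs_two]
  have : |d i - d j| ≤ 1 := by
    rcases hd i with hi | hi <;> rcases hd j with hj | hj <;> simp [hi, hj]
  calc 2 * |h| * |d i - d j| * |y| ≤ 2 * |h| * 1 * |y| := by gcongr
    _ = _ := by ring

/-- A unimodular factor of phase `O(h y)` differs from `1` by `O(|h||y|)`. The loss of one power of
`|y|` is what the weights have to compensate. -/
lemma entrySum_gauge_sub_le (hd : ∀ i, d i = 0 ∨ d i = 1) (h y : ℝ) :
    entrySum (gauge d V h - V) y ≤ ENNReal.ofReal (2 * |h| * |y|) * entrySum V y := by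
  unfold entrySum
  rw [Finset.mul_sum]
  gcongr with i
  rw [Finset.mul_sum]
  gcongr with j
  have : (gauge d V h - V) i j y =
      (Complex.exp (Complex.I * ((-2 * h * (d i - d j) * y : ℝ) : ℂ)) - 1) * V i j y := by
    simp only [gauge, Pi.sub_apply]; ring
  rw [this, enorm_mul]
  gcongr
  rw [← ofReal_norm]
  exact ENNReal.ofReal_le_ofReal (norm_exp_phase_sub_one_le hd h i j y)

/-- As `e` lives in the components of phase `0`, the gauge factor on the source depends on the row
only and leaves the sum. Rows whose source vanishes therefore keep this property. -/
lemma sum_gauge_sub_mul (he : ∀ j, e j = 0 ∨ d j = 0) (h : ℝ) (i : ι) (y : ℝ) :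
    ∑ j, (gauge d V h - V) i j y * e j =
      (Complex.exp (Complex.I * ((-2 * h * d i * y : ℝ) : ℂ)) - 1) * ∑ j, V i j y * e j := by
  rw [Finset.mul_sum]
  refine Finset.sum_congr rfl fun j _ => ?_
  rcases he j with hj | hj
  · simp [hj]
  · simp only [gauge, Pi.sub_apply, hj, sub_zero]; ring

/-- The solution at `z + h`, after a gauge transformation, solves the equation at `z` with
transformed coefficients. -/
lemma gauge_volterraOp (hd0 : ∀ i, d i = 0 ∨ d i = 1) (he : ∀ j, e j = 0 ∨ d j = 0)
    (hV : IntegrableMatrix V) (z h x : ℝ) (i : ι) :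
    Complex.exp (Complex.I * ((-2 * h * d i * x : ℝ) : ℂ)) *
        volterraSol d V e (theta ((z + h : ℝ) : ℂ)) x i =
      e i + volterraOp d (gauge d V h) (theta z) (fun y j =>
        Complex.exp (Complex.I * ((-2 * h * d j * y : ℝ) : ℂ)) *
          volterraSol d V e (theta ((z + h : ℝ) : ℂ)) y j) x i := by
  rw [(isVolterraSol_volterraSol (e := e) hV (theta_ofReal_re (z + h)) (phase_nonneg hd0)).eq x i,
    mul_add]
  congr 1
  · rcases he i with hi | hi <;> simp [hi]
  · unfold volterraOp
    rw [← integral_const_mul]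
    congr 1 with y
    rw [← mul_assoc, ← Complex.exp_add, Finset.mul_sum, Finset.mul_sum]
    refine Finset.sum_congr rfl fun j _ => ?_
    -- Here `θ(z + h) = θ(z) + 2ih`, and `-2h dᵢ x + 2h dᵢ (x - y) = -2h dᵢ y`: the dependence on
    -- `x` disappears, and the remainder is shared between matrix and solution.
    have e3 : Complex.exp (Complex.I * ((-2 * h * d i * x : ℝ) : ℂ) +
        theta ((z + h : ℝ) : ℂ) * d i * (x - y)) =
        Complex.exp (theta z * d i * (x - y)) *
          (Complex.exp (Complex.I * ((-2 * h * (d i - d j) * y : ℝ) : ℂ)) *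
            Complex.exp (Complex.I * ((-2 * h * d j * y : ℝ) : ℂ))) := by
      rw [← Complex.exp_add, ← Complex.exp_add]
      congr 1
      simp only [theta]
      push_cast
      ring
    rw [e3]
    simp only [gauge]
    ring

/-- The solution at `x = 0` is Lipschitz continuous in `z` for the `L²` norm. -/
lemma IsAKNS.l2norm_shift_le {M : ℝ} (hM : 0 ≤ M) (h : IsAKNS d V e M) (t : ℝ) :
    l2norm volume (fun z : ℝ => ‖volterraSol d V e (theta ((z + t : ℝ) : ℂ)) 0 -
      volterraSol d V e (theta z) 0‖ₑ) ≤
      ENNReal.ofReal ((Fintype.card ι * (2 * (2 * M)) +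
        2 * (Fintype.card ι * (2 * M) * Real.exp M) * M) * Real.exp M * |t|) := by
  have hd := phase_nonneg h.phase
  have hfin := h.matrix.isFiniteMeasure
  set C : ℝ := Fintype.card ι * (2 * M) * Real.exp M with hC
  have hC0 : 0 ≤ C := by positivity
  set X : ℝ → ℝ → ι → ℂ := fun z => volterraSol d V e (theta z) with hX
  -- `Y` is the gauged solution at `z + t`. It solves the equation at `z` with matrix `gauge d V t`,
  -- so both solutions can be compared at the same `z`.
  set Y : ℝ → ℝ → ι → ℂ := fun z x i =>
    Complex.exp (Complex.I * ((-2 * t * d i * x : ℝ) : ℂ)) * X (z + t) x i with hY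
  have hb : ∀ (z x : ℝ), ‖X z x‖ ≤ ‖e‖ * Real.exp (entryMass V) :=
    fun z x => norm_volterraSol_le h.matrix (theta_ofReal_re z) hd x
  have hYn : ∀ (z x : ℝ), ‖Y z x‖ ≤ ‖e‖ * Real.exp (entryMass V) := fun z x => by
    refine (pi_norm_le_iff_of_nonneg (by positivity)).2 fun i => ?_
    rw [hY, norm_mul, Complex.norm_exp_I_mul_ofReal, one_mul]
    exact (norm_le_pi_norm _ i).trans (hb _ _)
  have hXc : Continuous fun q : ℝ × ℝ => X q.1 q.2 := continuous_uncurry_volterraSol h.matrix hd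
  have hYc : Continuous fun q : ℝ × ℝ => Y q.1 q.2 := by
    refine continuous_pi fun i => Continuous.mul (by fun_prop) ?_
    exact (continuous_apply i).comp
      (hXc.comp (by fun_prop : Continuous fun q : ℝ × ℝ => (q.1 + t, q.2)))
  have hXm : ∀ z, Measurable (X z) := fun z =>
    (hXc.comp (by fun_prop : Continuous fun x : ℝ => (z, x))).measurable
  have hYm : ∀ z, Measurable (Y z) := fun z =>
    (hYc.comp (by fun_prop : Continuous fun x : ℝ => (z, x))).measurable
  have hG : IntegrableMatrix (gauge d V t) := h.matrix.gauge t
  have hD : IntegrableMatrix (gauge d V t - V) := hG.sub h.matrix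
  have hDfin := hD.isFiniteMeasure
  have hI : ∀ x, Measurable fun z => ∫⁻ y in Iic x, ‖X z y - e‖ₑ ∂entryMeasure (gauge d V t - V) :=
    fun x => Measurable.lintegral_prod_right' (f := fun q : ℝ × ℝ => ‖X q.1 q.2 - e‖ₑ)
      (hXc.sub continuous_const).measurable.enorm
  have key := l2norm_gronwall (μ := entryMeasure V) (x₀ := 0)
    (f := fun z x => ‖Y z x - X z x‖ₑ)
    (S := fun z x => ‖volterraOp d (gauge d V t - V) (theta z) (fun _ => e) x‖ₑ +
      ∫⁻ y in Iic x, ‖X z y - e‖ₑ ∂entryMeasure (gauge d V t - V))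
    (M := ENNReal.ofReal (‖e‖ * Real.exp (entryMass V) + ‖e‖ * Real.exp (entryMass V)))
    (h := Fintype.card ι * (2 * ENNReal.ofReal (2 * M * |t|)) +
      ENNReal.ofReal (2 * C * M * |t|))
    (hYc.sub hXc).measurable.enorm ENNReal.ofReal_ne_top ?_ ?_ ?_ ?_
  · have h1 : ENNReal.ofReal (Real.exp (entryMeasure V (Iic 0)).toReal) ≤
        ENNReal.ofReal (Real.exp M) := by
      gcongr
      exact entryMeasure_Iic_toReal_le hM h.mass 0
    refine le_trans (le_of_eq ?_) ((key.trans (mul_le_mul_right h1 _)).trans (le_of_eq ?_))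
    -- At `x = 0` the gauge factors equal `1`, so `Y - X` is the plain increment in `z`.
    · congr 1 with z
      congr 1
      ext i
      simp [hY, hX]
    · rw [← ENNReal.ofReal_natCast, show (2 : ℝ≥0∞) = ENNReal.ofReal 2 by norm_num,
        ← ENNReal.ofReal_mul (by positivity), ← ENNReal.ofReal_mul (by positivity),
        ← ENNReal.ofReal_add (by positivity) (by positivity), ← ENNReal.ofReal_mul (by positivity)]
      congr 1
      ring
  · intro z y _
    rw [← ofReal_norm]
    exact ENNReal.ofReal_le_ofReal ((norm_sub_le _ _).trans (by gcongr; exacts [hYn z y, hb z y]))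
  · exact fun y => (measurable_volterraOp_const hD hd e y).measurable.enorm.add (hI y)
  · intro z y _
    have hre := theta_ofReal_re z
    -- Splitting `X = e + (X - e)` under the matrix increment separates two forcing terms. The last
    -- term is the Gronwall term, and gauging does not change the measure `entryMeasure V`.
    have e1 : Y z y - X z y = volterraOp d (gauge d V t - V) (theta z) (fun _ => e) y +
        volterraOp d (gauge d V t - V) (theta z) (fun s => X z s - e) y +
        volterraOp d (gauge d V t) (theta z) (fun s => Y z s - X z s) y := by
      rw [volterraOp_sub hD hre hd (hXm z) measurable_const (hb z) (fun _ => le_rfl),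
        volterraOp_sub hG hre hd (hYm z) (hXm z) (hYn z) (hb z),
        volterraOp_matrix_sub hG h.matrix hre hd (hXm z) (hb z)]
      ext i
      have e2 := gauge_volterraOp h.phase h.init h.matrix z t y i
      have e3 := (isVolterraSol_volterraSol (e := e) h.matrix hre hd).eq y i
      have e2' : Y z y i = e i + volterraOp d (gauge d V t) (theta z) (Y z) y i := e2
      have e3' : X z y i = e i + volterraOp d V (theta z) (X z) y i := e3
      simp only [Pi.sub_apply, Pi.add_apply]
      rw [e2', e3']
      ring
    rw [e1]
    refine (enorm_add_le _ _).trans (add_le_add ((enorm_add_le _ _).trans (add_le_add le_rfl ?_)) ?_)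
    · exact enorm_volterraOp_le hD hre hd ((hXm z).sub measurable_const) y
    · rw [← entryMeasure_gauge (d := d) t]
      exact enorm_volterraOp_le hG hre hd ((hYm z).sub (hXm z)) y
  · intro x hx
    refine (l2norm_add_le (measurable_volterraOp_const hD hd e x).measurable.enorm.aemeasurable
      (hI x).aemeasurable).trans (add_le_add ?_ ?_)
    · refine l2norm_volterraOp_const_le hD h.phase (fun i hi y => ?_) fun i => ?_
      · rw [sum_gauge_sub_mul h.init, h.source_zero i hi, mul_zero]
      -- In the source the factor `|y|` is absorbed by the weight of `L^{2,1}`.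
      · have h2 : eLpNorm ((Iic x).indicator fun y => ∑ j, (gauge d V t - V) i j y * e j) 2 volume ≤
            ENNReal.ofReal (2 * |t|) *
              eLpNorm (fun y => (wt y : ℂ) * ∑ j, V i j y * e j) 2 volume := by
          refine eLpNorm_le_mul_eLpNorm_of_ae_le_mul (Filter.Eventually.of_forall fun y => ?_) 2
          refine (norm_indicator_le_norm_self _ _).trans ?_
          rw [sum_gauge_sub_mul h.init, norm_mul, norm_mul, Complex.norm_real,
            Real.norm_of_nonneg (wt_pos y).le, ← mul_assoc]
          gcongr
          have : ‖Complex.exp (Complex.I * ((-2 * t * d i * y : ℝ) : ℂ)) - 1‖ ≤ 2 * |t| * |y| := by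
            refine (Real.norm_exp_I_mul_ofReal_sub_one_le).trans ?_
            rw [Real.norm_eq_abs, abs_mul, abs_mul, abs_mul, abs_neg, abs_two]
            rcases h.phase i with hi | hi <;> simp [hi]; positivity
          refine this.trans ?_
          gcongr
          exact abs_le_wt y
        refine h2.trans ((mul_le_mul_right (h.source i) _).trans (le_of_eq ?_))
        rw [← ENNReal.ofReal_mul (by positivity)]
        congr 1; ring
    · have hXs : Measurable (Function.uncurry fun z y => ‖X z y - e‖ₑ) :=
        (hXc.sub continuous_const).measurable.enorm
      refine (l2norm_lintegral_le hXs).trans ?_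
      have hN : Measurable fun y => l2norm volume (fun z => ‖X z y - e‖ₑ) := by
        unfold l2norm
        exact ((hXs.pow_const 2).lintegral_prod_left').pow_const _
      rw [lintegral_entryMeasure hD hN]
      -- In the second forcing term `|y|` is absorbed by the decay `C / wt y` of `X - e` in `L²`, so
      -- integrability of the matrix entries is enough.
      calc ∫⁻ y in Iic x, entrySum (gauge d V t - V) y * l2norm volume (fun z => ‖X z y - e‖ₑ)
          ≤ ∫⁻ y in Iic x, ENNReal.ofReal (2 * C * |t|) * entrySum V y := by
            refine setLIntegral_mono' measurableSet_Iic fun y hy => ?_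
            have hy0 : y ≤ 0 := le_trans hy hx
            calc _ ≤ ENNReal.ofReal (2 * |t| * |y|) * entrySum V y *
                    ENNReal.ofReal (C / wt y) := by
                  gcongr
                  · exact entrySum_gauge_sub_le h.phase t y
                  · exact h.l2norm_sub_le hM hy0
              _ = ENNReal.ofReal (2 * |t| * |y|) * ENNReal.ofReal (C / wt y) * entrySum V y := by
                  ring
              _ ≤ _ := by
                  gcongr
                  rw [← ENNReal.ofReal_mul (by positivity)]
                  refine ENNReal.ofReal_le_ofReal ?_
                  have hw := wt_pos y
                  rw [mul_div_assoc', div_le_iff₀ hw]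
                  have := mul_le_mul_of_nonneg_left (abs_le_wt y)
                    (show 0 ≤ 2 * |t| * C by positivity)
                  linarith
        _ = ENNReal.ofReal (2 * C * |t|) * ∫⁻ y in Iic x, entrySum V y :=
            lintegral_const_mul _ h.matrix.measurable_entrySum
        _ ≤ ENNReal.ofReal (2 * C * |t|) * ENNReal.ofReal M := by
            gcongr
            exact (setLIntegral_le_lintegral _ _).trans h.mass
        _ = _ := by
            rw [← ENNReal.ofReal_mul (by positivity)]
            congr 1; ring

/-- The solution at `x = 0` satisfies `H¹` bounds in `z`. -/
theorem IsAKNS.exists_bound (ι : Type*) [Fintype ι] (M : ℝ) : ∃ K : ℝ, 0 ≤ K ∧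
    ∀ (d : ι → ℝ) (V : ι → ι → ℝ → ℂ) (e : ι → ℂ), IsAKNS d V e M →
      (∀ i, IsH1Bound (fun z : ℝ => volterraSol d V e (theta z) 0 i - e i) K) ∧
      ∀ x ≤ 0, l2norm volume (fun z : ℝ => ‖volterraSol d V e (theta z) x - e‖ₑ) ≤
        ENNReal.ofReal (K / wt x) := by
  wlog hM : 0 ≤ M generalizing M
  · obtain ⟨K, hK, h⟩ := this 0 le_rfl
    refine ⟨K, hK, fun d V e hV => h d V e ?_⟩
    have : ENNReal.ofReal M ≤ ENNReal.ofReal 0 := ENNReal.ofReal_le_ofReal (not_le.1 hM).le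
    exact { hV with mass := hV.mass.trans this, source := fun i => (hV.source i).trans this }
  set K₁ : ℝ := Fintype.card ι * (2 * M) * Real.exp M with hK₁
  set K₂ : ℝ := (Fintype.card ι * (2 * (2 * M)) + 2 * K₁ * M) * Real.exp M with hK₂
  have h1 : 0 ≤ K₁ := by positivity
  have h2 : 0 ≤ K₂ := by positivity
  have h3 := Real.exp_pos M
  -- `K₁` serves the `L²` norm and its decay, `K₂` the translates, and `exp M + 1` the supremum.
  refine ⟨K₁ + K₂ + (Real.exp M + 1), by positivity, fun d V e h => ⟨fun i => ⟨?_, ?_, ?_, ?_⟩, ?_⟩⟩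
  · exact ((continuous_apply i).comp ((continuous_uncurry_volterraSol h.matrix
      (phase_nonneg h.phase)).comp (by fun_prop : Continuous fun z : ℝ => (z, (0 : ℝ))))).sub
      continuous_const
  · intro z
    have hb := norm_volterraSol_le (e := e) h.matrix (theta_ofReal_re z) (phase_nonneg h.phase) 0
    have hm := Real.exp_le_exp.2 (entryMass_le hM h.mass)
    calc _ ≤ ‖volterraSol d V e (theta z) 0‖ + ‖e‖ :=
          (norm_sub_le _ _).trans (add_le_add (norm_le_pi_norm _ i) (norm_le_pi_norm _ i))
      _ ≤ 1 * Real.exp M + 1 := by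
          refine add_le_add (hb.trans ?_) h.init_le
          gcongr
          exact h.init_le
      _ ≤ _ := by linarith
  · rw [eLpNorm_two_eq_l2norm]
    refine (l2norm_mono (f := fun z : ℝ => ‖volterraSol d V e (theta z) 0 i - e i‖ₑ)
      fun z => enorm_apply_le_pi (volterraSol d V e (theta z) 0 - e) i).trans ?_
    refine (h.l2norm_sub_le hM le_rfl).trans (ENNReal.ofReal_le_ofReal ?_)
    rw [wt_zero, div_one]
    linarith
  · intro t
    rw [eLpNorm_two_eq_l2norm]
    refine le_trans (l2norm_mono fun z => ?_) ((h.l2norm_shift_le hM t).trans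
      (ENNReal.ofReal_le_ofReal ?_))
    · rw [sub_sub_sub_cancel_right]
      exact enorm_apply_le_pi (volterraSol d V e (theta ((z + t : ℝ) : ℂ)) 0 -
        volterraSol d V e (theta z) 0) i
    · gcongr
      linarith
  · intro x hx
    refine (h.l2norm_sub_le hM hx).trans (ENNReal.ofReal_le_ofReal ?_)
    have := wt_pos x
    gcongr
    linarith

end AKNS

end NLSGI

namespace NLSGI

/-! ### From Lipschitz translates to `H¹`. -/

noncomputable section HOne

namespace IsH1Bound

variable {f g : ℝ → ℂ} {K L : ℝ}

lemma nonneg (hf : IsH1Bound f K) : 0 ≤ K := (norm_nonneg _).trans (hf.bounded 0)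

lemma aesm (hf : IsH1Bound f K) : AEStronglyMeasurable f volume := hf.continuous.aestronglyMeasurable

lemma aesm_shift (hf : IsH1Bound f K) (h : ℝ) :
    AEStronglyMeasurable (fun z => f (z + h) - f z) volume :=
  ((hf.continuous.comp (by fun_prop : Continuous fun z : ℝ => z + h)).sub
    hf.continuous).aestronglyMeasurable

lemma mono (hf : IsH1Bound f K) (h : K ≤ L) : IsH1Bound f L :=
  ⟨hf.continuous, fun z => (hf.bounded z).trans h, hf.l2.trans (ENNReal.ofReal_le_ofReal h),
    fun t => (hf.shift t).trans (ENNReal.ofReal_le_ofReal (by gcongr))⟩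

lemma add (hf : IsH1Bound f K) (hg : IsH1Bound g L) : IsH1Bound (fun z => f z + g z) (K + L) := by
  have h1 := hf.nonneg
  have h2 := hg.nonneg
  refine ⟨hf.continuous.add hg.continuous, fun z => (norm_add_le _ _).trans
    (add_le_add (hf.bounded z) (hg.bounded z)), ?_, fun t => ?_⟩
  · rw [ENNReal.ofReal_add h1 h2]
    exact (eLpNorm_add_le hf.aesm hg.aesm (by norm_num)).trans (add_le_add hf.l2 hg.l2)
  · rw [add_mul, ENNReal.ofReal_add (by positivity) (by positivity)]
    refine le_trans (le_of_eq ?_) ((eLpNorm_add_le (hf.aesm_shift t) (hg.aesm_shift t)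
      (by norm_num)).trans (add_le_add (hf.shift t) (hg.shift t)))
    congr 1 with z
    simp only [Pi.add_apply]
    ring

lemma const_mul (hf : IsH1Bound f K) (c : ℂ) : IsH1Bound (fun z => c * f z) (‖c‖ * K) := by
  refine ⟨hf.continuous.const_mul c, fun z => ?_, ?_, fun t => ?_⟩
  · rw [norm_mul]; gcongr; exact hf.bounded z
  · rw [ENNReal.ofReal_mul (norm_nonneg c)]
    refine (eLpNorm_le_mul_eLpNorm_of_ae_le_mul (Filter.Eventually.of_forall fun z => ?_) 2).trans
      (mul_le_mul_right hf.l2 _)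
    rw [norm_mul]
  · rw [mul_assoc, ENNReal.ofReal_mul (norm_nonneg c)]
    refine (eLpNorm_le_mul_eLpNorm_of_ae_le_mul (Filter.Eventually.of_forall fun z => ?_) 2).trans
      (mul_le_mul_right (hf.shift t) _)
    rw [← mul_sub, norm_mul]

/-- The supremum belongs to `IsH1Bound` so that products stay in the class directly. The increment
of `f g` is `f(z+t)` times that of `g` plus `g(z)` times that of `f`, whence the factor `2`. -/
lemma mul (hf : IsH1Bound f K) (hg : IsH1Bound g L) :
    IsH1Bound (fun z => f z * g z) (2 * (K * L)) := by
  have h1 := hf.nonneg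
  have h2 := hg.nonneg
  have h3 : 0 ≤ K * L := by positivity
  refine ⟨hf.continuous.mul hg.continuous, fun z => ?_, ?_, fun t => ?_⟩
  · rw [norm_mul]
    exact (mul_le_mul (hf.bounded z) (hg.bounded z) (norm_nonneg _) h1).trans (by linarith)
  · refine (eLpNorm_le_mul_eLpNorm_of_ae_le_mul (f := fun z => f z * g z) (g := g) (c := K)
      (Filter.Eventually.of_forall fun z => ?_) 2).trans ((mul_le_mul_right hg.l2 _).trans ?_)
    · rw [norm_mul]; gcongr; exact hf.bounded z
    · rw [← ENNReal.ofReal_mul h1]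
      exact ENNReal.ofReal_le_ofReal (by linarith)
  · have e : (fun z => f (z + t) * g (z + t) - f z * g z) = (fun z => f (z + t) * (g (z + t) - g z))
        + fun z => g z * (f (z + t) - f z) := by
      ext z; simp only [Pi.add_apply]; ring
    have hc : Continuous fun z => f (z + t) :=
      hf.continuous.comp (by fun_prop : Continuous fun z : ℝ => z + t)
    rw [e, show 2 * (K * L) * |t| = K * (L * |t|) + L * (K * |t|) by ring,
      ENNReal.ofReal_add (by positivity) (by positivity), ENNReal.ofReal_mul (q := L * |t|) h1,
      ENNReal.ofReal_mul (q := K * |t|) h2]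
    refine (eLpNorm_add_le (hc.aestronglyMeasurable.mul (hg.aesm_shift t))
      (hg.aesm.mul (hf.aesm_shift t)) (by norm_num)).trans (add_le_add ?_ ?_)
    · refine (eLpNorm_le_mul_eLpNorm_of_ae_le_mul (Filter.Eventually.of_forall fun z => ?_) 2).trans
        (mul_le_mul_right (hg.shift t) _)
      rw [Pi.mul_apply, norm_mul]; gcongr; exact hf.bounded _
    · refine (eLpNorm_le_mul_eLpNorm_of_ae_le_mul (Filter.Eventually.of_forall fun z => ?_) 2).trans
        (mul_le_mul_right (hf.shift t) _)
      rw [Pi.mul_apply, norm_mul]; gcongr; exact hg.bounded _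

lemma conj (hf : IsH1Bound f K) : IsH1Bound (fun z => (starRingEnd ℂ) (f z)) K := by
  refine ⟨Complex.continuous_conj.comp hf.continuous, fun z => by simpa using hf.bounded z, ?_,
    fun t => ?_⟩
  · exact le_trans (le_of_eq (eLpNorm_congr_norm_ae (Filter.Eventually.of_forall fun z => by
      simp))) hf.l2
  · exact le_trans (le_of_eq (eLpNorm_congr_norm_ae (Filter.Eventually.of_forall fun z => by
      rw [← map_sub, RCLike.norm_conj]))) (hf.shift t)

lemma memLp_shift (hf : IsH1Bound f K) (t : ℝ) : MemLp (fun z => f (z + t) - f z) 2 :=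
  ⟨hf.aesm_shift t, (hf.shift t).trans_lt ENNReal.ofReal_lt_top⟩

/-- Derivative of the integral of a continuous function against the translates of a test
function. -/
lemma _root_.NLSGI.hasDerivAt_integral_mul_comp_sub (hf : Continuous f) {φ : ℝ → ℝ}
    (hφ : ContDiff ℝ ∞ φ) (hs : HasCompactSupport φ) :
    HasDerivAt (fun t : ℝ => ∫ z, f z * (φ (z - t) : ℂ)) (- ∫ z, f z * ((deriv φ z : ℝ) : ℂ)) 0 := by
  set ψ : ℝ → ℂ := fun y => (φ (-y) : ℂ) with hψ
  have hψd : ContDiff ℝ 1 ψ :=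
    (Complex.ofRealCLM.contDiff.comp (hφ.comp contDiff_neg)).of_le (by norm_cast)
  have hψs : HasCompactSupport ψ := by
    have : HasCompactSupport fun y => φ (-y) := hs.comp_homeomorph (Homeomorph.neg ℝ)
    exact this.comp_left Complex.ofReal_zero
  have key : HasDerivAt (fun t => ∫ z, f z * ψ (t - z)) (∫ z, f z * deriv ψ (0 - z)) 0 :=
    hψs.hasDerivAt_convolution_right (ContinuousLinearMap.mul ℝ ℂ)
      (hf.locallyIntegrable (μ := volume)) hψd 0
  have hder : ∀ y, deriv ψ y = -((deriv φ (-y) : ℝ) : ℂ) := by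
    intro y
    have h1 : HasDerivAt φ (deriv φ (-y)) (-y) :=
      ((hφ.differentiable (by norm_num)) _).hasDerivAt
    have h2 : HasDerivAt (fun y => φ (-y)) (deriv φ (-y) * -1) y := h1.comp y (hasDerivAt_neg y)
    have h3 := h2.ofReal_comp.deriv
    rw [hψ, h3]
    push_cast; ring
  have e1 : (∫ t, f t * deriv ψ (0 - t)) = - ∫ z, f z * ((deriv φ z : ℝ) : ℂ) := by
    rw [← integral_neg]
    congr 1 with t
    rw [hder]
    simp
  rw [e1] at key
  convert key using 4 with t z
  simp [hψ]

/-- A function satisfying `H¹` bounds has a weak derivative in `L²`. -/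
lemma exists_isWeakDeriv (hf : IsH1Bound f K) :
    ∃ g : ℝ → ℂ, IsWeakDeriv f g ∧ eLpNorm g 2 volume ≤ ENNReal.ofReal K := by
  have hK := hf.nonneg
  obtain ⟨c, -, hpos, hlim⟩ := exists_seq_strictAnti_tendsto (0 : ℝ)
  -- Difference quotients with steps `c n ↓ 0`; the bound on translates keeps them in the ball of
  -- radius `K` of `L²`.
  set q : ℕ → Lp ℂ 2 (volume : Measure ℝ) := fun n =>
    ((hf.memLp_shift (c n)).const_smul ((c n : ℂ)⁻¹)).toLp _ with hq
  have hqn : ∀ n, ‖q n‖ ≤ K := by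
    intro n
    rw [hq, Lp.norm_toLp]
    refine ENNReal.toReal_le_of_le_ofReal hK ?_
    rw [eLpNorm_const_smul]
    have h1 := hf.shift (c n)
    rw [abs_of_pos (hpos n)] at h1
    refine (mul_le_mul_right h1 _).trans (le_of_eq ?_)
    rw [← ofReal_norm, ← ENNReal.ofReal_mul (norm_nonneg _), norm_inv, Complex.norm_real,
      Real.norm_of_nonneg (hpos n).le]
    congr 1
    have := (hpos n).ne'
    field_simp
  set Ψ : ℕ → WeakDual ℂ (Lp ℂ 2 (volume : Measure ℝ)) := fun n =>
    StrongDual.toWeakDual (InnerProductSpace.toDual ℂ _ (q n)) with hΨ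
  have hcpt := WeakDual.isCompact_closedBall (𝕜 := ℂ) (E := Lp ℂ 2 (volume : Measure ℝ)) 0 K
  -- Banach–Alaoglu along a nonprincipal ultrafilter gives a weak limit without extracting a
  -- subsequence. By Riesz it is a function `G` of norm at most `K`.
  obtain ⟨ℓ, hℓ, hℓlim⟩ := hcpt.ultrafilter_le_nhds ((Filter.hyperfilter ℕ).map Ψ) (by
    rw [Ultrafilter.coe_map, Filter.le_principal_iff]
    refine Filter.mem_map.2 (Filter.univ_mem' fun n => ?_)
    simpa [hΨ] using hqn n)
  set G : Lp ℂ 2 (volume : Measure ℝ) :=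
    (InnerProductSpace.toDual ℂ _).symm (WeakDual.toStrongDual ℓ) with hG
  have hGn : ‖G‖ ≤ K := by
    rw [hG, LinearIsometryEquiv.norm_map]
    simpa using hℓ
  have hGi : ∀ φ : Lp ℂ 2 (volume : Measure ℝ), Filter.Tendsto (fun n => inner ℂ (q n) φ)
      (Filter.hyperfilter ℕ : Filter ℕ) (nhds (inner ℂ G φ)) := by
    intro φ
    have h1 := ((WeakDual.eval_continuous φ).tendsto ℓ).mono_left hℓlim
    rw [Ultrafilter.coe_map, Filter.tendsto_map'_iff] at h1
    have h2 : inner ℂ G φ = ℓ φ := by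
      rw [hG, InnerProductSpace.toDual_symm_apply]; rfl
    rw [h2]
    exact h1
  refine ⟨G, ⟨hf.continuous.locallyIntegrable, (Lp.memLp G).locallyIntegrable (by norm_num),
    fun φ hφ hs => ?_⟩, ?_⟩
  swap
  · rw [Lp.norm_def] at hGn
    exact (ENNReal.le_ofReal_iff_toReal_le (Lp.eLpNorm_ne_top G) hK).2 hGn
  have hφc : Continuous fun x => (φ x : ℂ) := Complex.continuous_ofReal.comp hφ.continuous
  have hφs : HasCompactSupport fun x => (φ x : ℂ) := hs.comp_left Complex.ofReal_zero
  have hφL : MemLp (fun x => (φ x : ℂ)) 2 := hφc.memLp_of_hasCompactSupport hφs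
  have hin : ∀ (v : Lp ℂ 2 (volume : Measure ℝ)), inner ℂ v (hφL.toLp _) =
      (starRingEnd ℂ) (∫ x, (φ x : ℂ) * v x) := by
    intro v
    rw [L2.inner_def, ← integral_conj]
    refine integral_congr_ae ?_
    filter_upwards [hφL.coeFn_toLp] with x hx
    rw [hx]
    simp
  have hA := hGi (hφL.toLp _)
  simp_rw [hin] at hA
  have hA' := (Complex.continuous_conj.tendsto _).comp hA
  simp only [Function.comp_def, Complex.conj_conj] at hA'
  -- The translation is moved from `f` to the test function, where the limit is an ordinary
  -- derivative.
  have hqi : ∀ n, ∫ x, (φ x : ℂ) * q n x =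
      (c n : ℂ)⁻¹ * ((∫ z, f z * (φ (z - c n) : ℂ)) - ∫ z, f z * (φ z : ℂ)) := by
    intro n
    have e1 : ∫ x, (φ x : ℂ) * q n x =
        ∫ x, (c n : ℂ)⁻¹ * (f (x + c n) * (φ x : ℂ) - f x * (φ x : ℂ)) := by
      refine integral_congr_ae ?_
      filter_upwards [((hf.memLp_shift (c n)).const_smul ((c n : ℂ)⁻¹)).coeFn_toLp] with x hx
      rw [hq, hx]
      simp only [Pi.smul_apply, smul_eq_mul]
      ring
    have hi : ∀ (u : ℝ → ℂ), Continuous u → Integrable fun x => u x * (φ x : ℂ) := fun u hu =>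
      (hu.mul hφc).integrable_of_hasCompactSupport hφs.mul_left
    rw [e1, integral_const_mul, integral_sub (hi (fun x => f (x + c n)) (hf.continuous.comp
      (by fun_prop : Continuous fun z : ℝ => z + c n))) (hi _ hf.continuous)]
    congr 2
    have := integral_add_right_eq_self (μ := volume) (fun z => f z * (φ (z - c n) : ℂ)) (c n)
    simpa using this
  have hB : Filter.Tendsto (fun n => ∫ x, (φ x : ℂ) * q n x) Filter.atTop
      (nhds (- ∫ z, f z * ((deriv φ z : ℝ) : ℂ))) := by
    have hd := hasDerivAt_iff_tendsto_slope_zero.1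
      (hasDerivAt_integral_mul_comp_sub hf.continuous hφ hs)
    have hc : Filter.Tendsto c Filter.atTop (nhdsWithin 0 {0}ᶜ) :=
      tendsto_nhdsWithin_iff.2 ⟨hlim, Filter.Eventually.of_forall fun n => (hpos n).ne'⟩
    refine (hd.comp hc).congr fun n => ?_
    rw [hqi]
    simp [Complex.real_smul]
  have hu := tendsto_nhds_unique hA' (hB.mono_left Nat.hyperfilter_le_atTop)
  rw [hu, neg_neg]
  congr 1 with z
  ring

lemma normH1_le (hf : IsH1Bound f K) : normH1 f ≤ ENNReal.ofReal (2 * K) := by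
  obtain ⟨g, hg, hgn⟩ := hf.exists_isWeakDeriv
  have hK := hf.nonneg
  refine (iInf₂_le g hg).trans ?_
  calc (normL2 f ^ 2 + normL2 g ^ 2) ^ (1 / 2 : ℝ)
      ≤ (ENNReal.ofReal K ^ 2 + ENNReal.ofReal K ^ 2) ^ (1 / 2 : ℝ) := by
        gcongr
        exacts [hf.l2, hgn]
    _ ≤ ((ENNReal.ofReal (2 * K)) ^ (2 : ℕ)) ^ (1 / 2 : ℝ) := by
        gcongr
        rw [← ENNReal.ofReal_pow hK, ← ENNReal.ofReal_add (by positivity) (by positivity),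
          ← ENNReal.ofReal_pow (by positivity)]
        exact ENNReal.ofReal_le_ofReal (by nlinarith)
    _ = _ := by rw [← ENNReal.rpow_natCast, ← ENNReal.rpow_mul]; norm_num

end IsH1Bound

lemma IsWeakDeriv.congr_ae {f f' g g' : ℝ → ℂ} (h : IsWeakDeriv f g) (hf : f =ᵐ[volume] f')
    (hg : g =ᵐ[volume] g') : IsWeakDeriv f' g' := by
  refine ⟨h.1.congr hf, h.2.congr hg, fun φ h1 h2 => ?_⟩
  have e1 : ∫ x, ((deriv φ x : ℝ) : ℂ) * f' x = ∫ x, ((deriv φ x : ℝ) : ℂ) * f x := by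
    refine integral_congr_ae ?_
    filter_upwards [hf] with x hx
    rw [hx]
  have e2 : ∫ x, (φ x : ℂ) * g' x = ∫ x, (φ x : ℂ) * g x := by
    refine integral_congr_ae ?_
    filter_upwards [hg] with x hx
    rw [hx]
  rw [e1, e2]
  exact h.3 φ h1 h2

/-- Needed because the formula for `k⁻¹ b(k)` holds away from `z = 0` only. -/
lemma normH1_congr_ae {f f' : ℝ → ℂ} (hf : f =ᵐ[volume] f') : normH1 f = normH1 f' := by
  have hn : normL2 f = normL2 f' := eLpNorm_congr_ae hf
  unfold normH1
  rw [hn]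
  congr 1 with g
  refine iInf_congr_Prop ⟨fun h => h.congr_ae hf (ae_eq_refl g),
    fun h => h.congr_ae hf.symm (ae_eq_refl g)⟩ fun _ => rfl

end HOne

end NLSGI

namespace NLSGI

noncomputable section Primitives

/-! ### Primitives of locally integrable functions -/

/-- `f` is a primitive of the locally integrable function `f'`. -/
structure IsPrim (f f' : ℝ → ℂ) : Prop where
  locallyIntegrable : LocallyIntegrable f' volume
  eq : ∀ x y, f y - f x = ∫ t in x..y, f' t

namespace IsPrim

variable {f f' g g' : ℝ → ℂ}

lemma intervalIntegrable (hf : IsPrim f f') (x y : ℝ) : IntervalIntegrable f' volume x y :=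
  (hf.locallyIntegrable.integrableOn_isCompact isCompact_uIcc).intervalIntegrable

lemma continuous (hf : IsPrim f f') : Continuous f := by
  have : f = fun y => f 0 + ∫ t in (0 : ℝ)..y, f' t := by
    ext y; rw [← hf.eq 0 y]; ring
  rw [this]
  exact continuous_const.add
    (intervalIntegral.continuous_primitive (fun a b => hf.intervalIntegrable a b) 0)

lemma const (c : ℂ) : IsPrim (fun _ => c) (fun _ => 0) :=
  ⟨continuous_const.locallyIntegrable, fun x y => by simp⟩

lemma add (hf : IsPrim f f') (hg : IsPrim g g') :
    IsPrim (fun x => f x + g x) (fun x => f' x + g' x) :=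
  ⟨hf.1.add hg.1, fun x y => by
    rw [intervalIntegral.integral_add (hf.intervalIntegrable x y) (hg.intervalIntegrable x y),
      ← hf.eq, ← hg.eq]
    ring⟩

lemma const_mul (hf : IsPrim f f') (c : ℂ) : IsPrim (fun x => c * f x) (fun x => c * f' x) :=
  ⟨hf.1.smul c, fun x y => by
    rw [intervalIntegral.integral_const_mul, ← hf.eq, mul_sub]⟩

lemma sub (hf : IsPrim f f') (hg : IsPrim g g') :
    IsPrim (fun x => f x - g x) (fun x => f' x - g' x) := by
  have := hf.add (hg.const_mul (-1))
  simpa [sub_eq_add_neg] using this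

lemma congr_deriv (hf : IsPrim f f') (h : ∀ x, f' x = g' x) : IsPrim f g' := by
  have : f' = g' := funext h
  exact this ▸ hf

lemma congr_deriv_ae (hf : IsPrim f f') (h : f' =ᵐ[volume] g') : IsPrim f g' :=
  ⟨hf.1.congr h, fun x y => by
    rw [hf.eq x y]
    exact intervalIntegral.integral_congr_ae (h.mono fun t ht _ => ht)⟩

lemma conj (hf : IsPrim f f') :
    IsPrim (fun x => (starRingEnd ℂ) (f x)) (fun x => (starRingEnd ℂ) (f' x)) := by
  refine ⟨?_, fun x y => ?_⟩
  · intro x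
    obtain ⟨s, hs, hi⟩ := hf.1 x
    refine ⟨s, hs, ?_⟩
    exact (Complex.conjCLE.toContinuousLinearMap).integrable_comp hi
  · rw [← map_sub, hf.eq, intervalIntegral.intervalIntegral_eq_integral_uIoc,
      intervalIntegral.intervalIntegral_eq_integral_uIoc, integral_conj, Complex.real_smul,
      Complex.real_smul, map_mul, Complex.conj_ofReal]

lemma comp_neg (hf : IsPrim f f') : IsPrim (fun x => f (-x)) (fun x => -f' (-x)) := by
  refine ⟨?_, fun x y => ?_⟩
  · rw [locallyIntegrable_iff]
    intro k hk
    have h1 := (locallyIntegrable_iff.1 hf.1) (-k) hk.neg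
    have := ((Measure.measurePreserving_neg (volume : Measure ℝ)).integrableOn_comp_preimage
      (MeasurableEquiv.neg ℝ).measurableEmbedding (f := f') (s := -k)).2 h1
    have h2 : (Neg.neg ⁻¹' (-k) : Set ℝ) = k := by ext; simp
    rw [h2] at this
    exact this.neg
  · rw [intervalIntegral.integral_neg, intervalIntegral.integral_comp_neg, hf.eq,
      intervalIntegral.integral_symm]

lemma of_hasDerivAt (h : ∀ x, HasDerivAt f (f' x) x) (hc : Continuous f') : IsPrim f f' :=
  ⟨hc.locallyIntegrable, fun x y =>
    (intervalIntegral.integral_eq_sub_of_hasDerivAt (fun t _ => h t)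
      (hc.intervalIntegrable x y)).symm⟩

lemma exp (c : ℂ) : IsPrim (fun x => Complex.exp (c * x)) (fun x => c * Complex.exp (c * x)) := by
  refine of_hasDerivAt (fun x => ?_) (by fun_prop)
  have h1 : HasDerivAt (fun x : ℝ => c * (x : ℂ)) c x := by
    simpa using (Complex.ofRealCLM.hasDerivAt (x := x)).const_mul c
  simpa [mul_comm] using h1.cexp

lemma eq_of_deriv_zero (hf : IsPrim f f') (h : ∀ x, f' x = 0) (x y : ℝ) : f x = f y := by
  have := hf.eq y x
  simp only [h, intervalIntegral.integral_zero] at this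
  exact sub_eq_zero.1 this

lemma integral_Iic {q : ℝ → ℂ} (hq : ∀ x, IntegrableOn q (Iic x)) :
    IsPrim (fun x => ∫ y in Iic x, q y) q := by
  refine ⟨?_, fun x y => intervalIntegral.integral_Iic_sub_Iic (hq x) (hq y)⟩
  rw [locallyIntegrable_iff]
  intro k hk
  obtain ⟨M, hM⟩ := hk.bddAbove
  exact (hq M).mono_set fun x hx => hM hx

/-- Integration by parts by Fubini: the integral of `f'(t) g'(s)` over a square is the product of
the increments, and cutting the square along its diagonal gives the two terms on the left. -/
lemma mul_aux (hf : IsPrim f f') (hg : IsPrim g g') {x y : ℝ} (hxy : x ≤ y) :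
    (∫ t in x..y, f' t * (g t - g x)) + ∫ t in x..y, (f t - f x) * g' t =
      (f y - f x) * (g y - g x) := by
  set μ : Measure ℝ := volume.restrict (Ioc x y) with hμ
  have hfi : Integrable f' μ := (intervalIntegrable_iff_integrableOn_Ioc_of_le hxy).1
    (hf.intervalIntegrable x y)
  have hgi : Integrable g' μ := (intervalIntegrable_iff_integrableOn_Ioc_of_le hxy).1
    (hg.intervalIntegrable x y)
  have hF : Integrable (fun p : ℝ × ℝ => f' p.1 * g' p.2) (μ.prod μ) := hfi.mul_prod hgi
  have hms : MeasurableSet {p : ℝ × ℝ | p.2 ≤ p.1} := measurableSet_le measurable_snd measurable_fst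
  have hA : Integrable (Function.uncurry fun t s =>
      {p : ℝ × ℝ | p.2 ≤ p.1}.indicator (fun p => f' p.1 * g' p.2) (t, s)) (μ.prod μ) :=
    hF.indicator hms
  have hB : Integrable (Function.uncurry fun t s =>
      {p : ℝ × ℝ | p.2 ≤ p.1}ᶜ.indicator (fun p => f' p.1 * g' p.2) (t, s)) (μ.prod μ) :=
    hF.indicator hms.compl
  have hsum : (∫ t, ∫ s, f' t * g' s ∂μ ∂μ) =
      (∫ t, ∫ s, {p : ℝ × ℝ | p.2 ≤ p.1}.indicator (fun p => f' p.1 * g' p.2) (t, s) ∂μ ∂μ) +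
      ∫ t, ∫ s, {p : ℝ × ℝ | p.2 ≤ p.1}ᶜ.indicator (fun p => f' p.1 * g' p.2) (t, s) ∂μ ∂μ := by
    rw [integral_integral hA, integral_integral hB, integral_integral hF]
    refine Eq.trans ?_ (integral_add hA hB)
    congr 1 with p
    exact (congrFun (indicator_self_add_compl {p : ℝ × ℝ | p.2 ≤ p.1}
      (fun p : ℝ × ℝ => f' p.1 * g' p.2)) p).symm
  have e1 : (∫ t, ∫ s, f' t * g' s ∂μ ∂μ) = (f y - f x) * (g y - g x) := by
    simp_rw [integral_const_mul, integral_mul_const]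
    rw [hf.eq, hg.eq, intervalIntegral.integral_of_le hxy, intervalIntegral.integral_of_le hxy]
  have e2 : (∫ t, ∫ s, {p : ℝ × ℝ | p.2 ≤ p.1}.indicator (fun p => f' p.1 * g' p.2) (t, s) ∂μ ∂μ)
      = ∫ t in x..y, f' t * (g t - g x) := by
    rw [intervalIntegral.integral_of_le hxy]
    refine setIntegral_congr_fun measurableSet_Ioc fun t ht => ?_
    have h1 : ∀ s, {p : ℝ × ℝ | p.2 ≤ p.1}.indicator (fun p => f' p.1 * g' p.2) (t, s) =
        (Iic t).indicator (fun s => f' t * g' s) s := fun s => by simp [indicator]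
    simp_rw [h1]
    rw [integral_indicator measurableSet_Iic, hμ, Measure.restrict_restrict measurableSet_Iic,
      show Iic t ∩ Ioc x y = Ioc x t by ext s; simp; grind [ht.2], integral_const_mul, hg.eq,
      intervalIntegral.integral_of_le ht.1.le]
  have e3 : (∫ t, ∫ s, {p : ℝ × ℝ | p.2 ≤ p.1}ᶜ.indicator (fun p => f' p.1 * g' p.2) (t, s) ∂μ ∂μ)
      = ∫ t in x..y, (f t - f x) * g' t := by
    rw [integral_integral_swap hB, intervalIntegral.integral_of_le hxy]
    refine setIntegral_congr_fun measurableSet_Ioc fun s hs => ?_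
    have h1 : ∀ t, {p : ℝ × ℝ | p.2 ≤ p.1}ᶜ.indicator (fun p => f' p.1 * g' p.2) (t, s) =
        (Iio s).indicator (fun t => f' t * g' s) t := fun t => by simp [indicator]
    simp_rw [h1]
    rw [integral_indicator measurableSet_Iio, hμ, Measure.restrict_restrict measurableSet_Iio,
      show Iio s ∩ Ioc x y = Ioo x s by ext t; simp; grind [hs.2], integral_mul_const, hf.eq,
      intervalIntegral.integral_of_le hs.1.le, integral_Ioc_eq_integral_Ioo]
  rw [← e1, hsum, e2, e3]

lemma mul (hf : IsPrim f f') (hg : IsPrim g g') :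
    IsPrim (fun x => f x * g x) (fun x => f' x * g x + f x * g' x) := by
  have hloc : LocallyIntegrable (fun x => f' x * g x + f x * g' x) volume := by
    refine LocallyIntegrable.add ?_ ?_
    · simpa [mul_comm] using hf.1.smul_continuous hg.continuous
    · simpa using hg.1.continuous_smul hf.continuous
  have key : ∀ x y, x ≤ y → f y * g y - f x * g x = ∫ t in x..y, f' t * g t + f t * g' t := by
    intro x y hxy
    have h := hf.mul_aux hg hxy
    have i1 : IntervalIntegrable (fun t => f' t * (g t - g x)) volume x y :=
      (hf.intervalIntegrable x y).mul_continuousOn (hg.continuous.sub continuous_const).continuousOn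
    have i2 : IntervalIntegrable (fun t => (f t - f x) * g' t) volume x y :=
      (hg.intervalIntegrable x y).continuousOn_mul (hf.continuous.sub continuous_const).continuousOn
    have i3 := (hf.intervalIntegrable x y).mul_const (g x)
    have i4 := (hg.intervalIntegrable x y).const_mul (f x)
    have e : (∫ t in x..y, f' t * g t + f t * g' t) =
        (∫ t in x..y, f' t * (g t - g x)) + (∫ t in x..y, (f t - f x) * g' t) +
        ((∫ t in x..y, f' t * g x) + ∫ t in x..y, f x * g' t) := by
      rw [← intervalIntegral.integral_add i1 i2, ← intervalIntegral.integral_add i3 i4,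
        ← intervalIntegral.integral_add (i1.add i2) (i3.add i4)]
      congr 1 with t
      ring
    rw [e, h, intervalIntegral.integral_mul_const, intervalIntegral.integral_const_mul,
      ← hf.eq, ← hg.eq]
    ring
  refine ⟨hloc, fun x y => ?_⟩
  rcases le_total x y with h | h
  · exact key x y h
  · rw [intervalIntegral.integral_symm, ← key y x h]; ring

end IsPrim

/-! ### Weak derivatives and primitives -/

/-- The product rule for `φ f` is integrated over an interval that contains the support of `φ`, so
the boundary terms vanish. -/
lemma IsPrim.isWeakDeriv {f g : ℝ → ℂ} (h : IsPrim f g) : IsWeakDeriv f g := by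
  refine ⟨h.continuous.locallyIntegrable, h.1, fun φ hφ hs => ?_⟩
  have hd : IsPrim (fun x => (φ x : ℂ)) (fun x => ((deriv φ x : ℝ) : ℂ)) :=
    IsPrim.of_hasDerivAt (fun x => ((hφ.differentiable (by norm_num)) x).hasDerivAt.ofReal_comp)
      (Complex.continuous_ofReal.comp (hφ.continuous_deriv (by norm_num)))
  have hp := hd.mul h
  obtain ⟨R, hR⟩ := hs.isCompact.isBounded.subset_closedBall (0 : ℝ)
  have hR' : ∀ x, x ∉ Ioc (-|R| - 1) (|R| + 1) → φ x = 0 ∧ deriv φ x = 0 := by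
    intro x hx
    have hx' : x ∉ tsupport φ := fun hmem => hx (by
      have := hR hmem
      rw [Metric.mem_closedBall, dist_zero_right, Real.norm_eq_abs] at this
      have h2 := abs_le.1 (this.trans (le_abs_self R))
      exact ⟨by linarith, by linarith⟩)
    exact ⟨image_eq_zero_of_notMem_tsupport hx',
      image_eq_zero_of_notMem_tsupport fun hc => hx' (tsupport_deriv_subset hc)⟩
  have hle : -|R| - 1 ≤ |R| + 1 := by linarith [abs_nonneg R]
  -- The right end is `|R| + 2` because `|R| + 1` still belongs to the half-open interval outside of
  -- which `φ` is known to vanish.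
  have e0 := hp.eq (-|R| - 1) (|R| + 2)
  have e1 := hp.eq (|R| + 1) (|R| + 2)
  have z1 : φ (-|R| - 1) = 0 := (hR' _ (by simp)).1
  have z2 : φ (|R| + 2) = 0 := (hR' _ (by simp)).1
  have hle2 : -|R| - 1 ≤ |R| + 2 := by linarith
  have hsub : Ioc (-|R| - 1) (|R| + 1) ⊆ Ioc (-|R| - 1) (|R| + 2) :=
    Ioc_subset_Ioc_right (by linarith)
  have i1 : Integrable fun x => ((deriv φ x : ℝ) : ℂ) * f x := by
    refine Continuous.integrable_of_hasCompactSupport ?_ ?_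
    · exact (Complex.continuous_ofReal.comp (hφ.continuous_deriv (by norm_num))).mul h.continuous
    · exact (hs.deriv.comp_left Complex.ofReal_zero).mul_right
  have i2 : Integrable fun x => (φ x : ℂ) * g x := by
    have := h.1.integrable_smul_left_of_hasCompactSupport (g := fun x => (φ x : ℂ))
      (Complex.continuous_ofReal.comp hφ.continuous) (hs.comp_left Complex.ofReal_zero)
    simpa using this
  rw [z1, z2, intervalIntegral.integral_of_le hle2, setIntegral_eq_integral_of_forall_compl_eq_zero
    (fun x hx => by
      have := hR' x fun hc => hx (hsub hc)
      simp [this]), integral_add i1 i2] at e0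
  simp only [Complex.ofReal_zero, zero_mul, sub_self] at e0
  exact eq_neg_of_add_eq_zero_left e0.symm

lemma IsWeakDeriv.sub {f f' g g' : ℝ → ℂ} (h : IsWeakDeriv f f') (h' : IsWeakDeriv g g') :
    IsWeakDeriv (f - g) (f' - g') := by
  refine ⟨h.1.sub h'.1, h.2.sub h'.2, fun φ hφ hs => ?_⟩
  have i : ∀ (ψ : ℝ → ℝ) (w : ℝ → ℂ), Continuous ψ → HasCompactSupport ψ →
      LocallyIntegrable w volume → Integrable fun x => (ψ x : ℂ) * w x := by
    intro ψ w h1 h2 h3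
    have := h3.integrable_smul_left_of_hasCompactSupport (g := fun x => (ψ x : ℂ))
      (Complex.continuous_ofReal.comp h1) (h2.comp_left Complex.ofReal_zero)
    simpa using this
  have hc := hφ.continuous
  have hd : Continuous (deriv φ) := hφ.continuous_deriv (by norm_num)
  simp only [Pi.sub_apply, mul_sub]
  rw [integral_sub (i _ _ hd hs.deriv h.1) (i _ _ hd hs.deriv h'.1),
    integral_sub (i _ _ hc hs h.2) (i _ _ hc hs h'.2), h.3 φ hφ hs, h'.3 φ hφ hs]
  ring

lemma IsWeakDeriv.ae_unique {f g g' : ℝ → ℂ} (h : IsWeakDeriv f g) (h' : IsWeakDeriv f g') :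
    g =ᵐ[volume] g' := by
  refine ae_eq_of_integral_contDiff_smul_eq h.2 h'.2 fun φ hφ hs => ?_
  have h1 := h.3 φ hφ hs
  rw [h'.3 φ hφ hs, neg_inj] at h1
  simpa [Complex.real_smul] using h1.symm

/-- A function whose weak derivative vanishes is constant almost everywhere. -/
lemma IsWeakDeriv.ae_eq_const {f : ℝ → ℂ} (h : IsWeakDeriv f 0) :
    ∃ c : ℂ, f =ᵐ[volume] fun _ => c := by
  let ρ : ContDiffBump (0 : ℝ) := ⟨1, 2, by norm_num, by norm_num⟩
  set r : ℝ → ℝ := ρ.normed volume with hr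
  have hrd : ContDiff ℝ ∞ r := ρ.contDiff_normed
  have hrs : HasCompactSupport r := ρ.hasCompactSupport_normed
  have hr1 : ∫ x, r x = 1 := ρ.integral_normed
  refine ⟨∫ x, r x • f x, ae_eq_of_integral_contDiff_smul_eq h.1
    continuous_const.locallyIntegrable fun ψ hψ hs => ?_⟩
  set m : ℝ := ∫ x, ψ x with hm
  -- Subtracting `m` times a bump of integral one makes the mean vanish, so `η` is the derivative of
  -- a test function and `f` annihilates it. Thus `∫ ψ f = m ∫ r f`, and the constant is `∫ r f`.
  set η : ℝ → ℝ := fun x => ψ x - m * r x with hη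
  have hηd : ContDiff ℝ ∞ η := hψ.sub (contDiff_const.mul hrd)
  have hηs : HasCompactSupport η := hs.sub (hrs.mul_left)
  have hη0 : ∫ x, η x = 0 := by
    rw [hη, integral_sub (hψ.continuous.integrable_of_hasCompactSupport hs)
      ((hrd.continuous.integrable_of_hasCompactSupport hrs).const_mul m), integral_const_mul, hr1]
    simp [hm]
  obtain ⟨R, hR⟩ := hηs.isCompact.isBounded.subset_closedBall (0 : ℝ)
  have hR' : ∀ x, x ∉ Icc (-|R|) |R| → η x = 0 := by
    intro x hx
    refine image_eq_zero_of_notMem_tsupport fun hmem => hx ?_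
    have := hR hmem
    rw [Metric.mem_closedBall, dist_zero_right, Real.norm_eq_abs] at this
    exact abs_le.1 (this.trans (le_abs_self R))
  set φ : ℝ → ℝ := fun x => ∫ t in (-|R| - 1)..x, η t with hφ
  have hφd : ∀ x, HasDerivAt φ (η x) x := fun x =>
    intervalIntegral.integral_hasDerivAt_right (hηd.continuous.intervalIntegrable _ _)
      (hηd.continuous.stronglyMeasurableAtFilter _ _) hηd.continuous.continuousAt
  have hφ' : deriv φ = η := funext fun x => (hφd x).deriv
  have hφc : ContDiff ℝ ∞ φ := contDiff_infty_iff_deriv.2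
    ⟨fun x => (hφd x).differentiableAt, hφ' ▸ hηd⟩
  have hφs : HasCompactSupport φ := by
    refine HasCompactSupport.intro (isCompact_Icc (a := -|R|) (b := |R|)) fun x hx => ?_
    rcases lt_or_ge x (-|R|) with h1 | h1
    · rw [hφ]
      refine (intervalIntegral.integral_congr (g := fun _ => 0) fun t ht => ?_).trans (by simp)
      refine hR' t fun hc => ?_
      have := hc.1
      rcases le_total (-|R| - 1) x with h2 | h2
      · rw [uIcc_of_le h2] at ht; linarith [ht.2]
      · rw [uIcc_of_ge h2] at ht; linarith [ht.2]
    · have h2 : |R| < x := by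
        by_contra hc
        exact hx ⟨h1, not_lt.1 hc⟩
      rw [hφ]
      simp only
      rw [intervalIntegral.integral_of_le (by linarith),
        setIntegral_eq_integral_of_forall_compl_eq_zero (fun t ht => hR' t fun hc => ht
          (mem_Ioc.2 ⟨by linarith [hc.1], by linarith [hc.2]⟩)), hη0]
  have key := h.3 φ hφc hφs
  simp only [Pi.zero_apply, mul_zero, integral_zero, neg_zero, hφ'] at key
  have i : ∀ (χ : ℝ → ℝ), Continuous χ → HasCompactSupport χ →
      Integrable fun x => (χ x : ℂ) * f x := by
    intro χ h1 h2
    have := h.1.integrable_smul_left_of_hasCompactSupport (g := fun x => (χ x : ℂ))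
      (Complex.continuous_ofReal.comp h1) (h2.comp_left Complex.ofReal_zero)
    simpa using this
  have e1 : (∫ x, (η x : ℂ) * f x) = (∫ x, (ψ x : ℂ) * f x) - m * ∫ x, (r x : ℂ) * f x := by
    rw [← integral_const_mul, ← integral_sub (i _ hψ.continuous hs)
      ((i _ hrd.continuous hrs).const_mul _)]
    congr 1 with x
    rw [hη]; push_cast; ring
  rw [e1, sub_eq_zero] at key
  simp only [Complex.real_smul] at key ⊢
  rw [key, integral_mul_const, integral_complex_ofReal]

/-- A function with a weak derivative has a representative that is a primitive of it. -/
lemma IsWeakDeriv.exists_isPrim {f g : ℝ → ℂ} (h : IsWeakDeriv f g) :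
    ∃ F : ℝ → ℂ, f =ᵐ[volume] F ∧ IsPrim F g := by
  have hF : IsPrim (fun x => ∫ t in (0 : ℝ)..x, g t) g :=
    ⟨h.2, fun x y => intervalIntegral.integral_interval_sub_left
      (h.2.integrableOn_isCompact isCompact_uIcc).intervalIntegrable
      (h.2.integrableOn_isCompact isCompact_uIcc).intervalIntegrable⟩
  have h0 := h.sub hF.isWeakDeriv
  rw [sub_self] at h0
  obtain ⟨c, hc⟩ := h0.ae_eq_const
  refine ⟨fun x => (∫ t in (0 : ℝ)..x, g t) + c, ?_, ?_⟩
  · filter_upwards [hc] with x hx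
    rw [← hx, Pi.sub_apply]; ring
  · simpa using hF.add (IsPrim.const c)

lemma normL21_congr_ae {f g : ℝ → ℂ} (h : f =ᵐ[volume] g) : normL21 f = normL21 g := by
  refine eLpNorm_congr_ae ?_
  filter_upwards [h] with x hx
  rw [hx]

/-- Weak derivatives are unique almost everywhere, so all terms of the infimum coincide. -/
lemma IsWeakDeriv.normH11_eq {f g : ℝ → ℂ} (h : IsWeakDeriv f g) :
    normH11 f = (normL21 f ^ 2 + normL21 g ^ 2) ^ (1 / 2 : ℝ) := by
  refine le_antisymm (iInf₂_le g h) (le_iInf₂ fun g' h' => ?_)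
  rw [normL21_congr_ae (h.ae_unique h')]

lemma IsWeakDeriv.normH2_eq {f g k : ℝ → ℂ} (h : IsWeakDeriv f g) (h' : IsWeakDeriv g k) :
    normH2 f = (normL2 f ^ 2 + normL2 g ^ 2 + normL2 k ^ 2) ^ (1 / 2 : ℝ) := by
  refine le_antisymm (iInf₂_le_of_le g k (iInf₂_le h h')) (le_iInf₂ fun g₁ k₁ =>
    le_iInf₂ fun h₁ h₁' => ?_)
  have e1 := h.ae_unique h₁
  have e2 := h'.ae_unique (h₁'.congr_ae e1.symm (ae_eq_refl _))
  have n1 : normL2 g = normL2 g₁ := eLpNorm_congr_ae e1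
  have n2 : normL2 k = normL2 k₁ := eLpNorm_congr_ae e2
  rw [n1, n2]

end Primitives

end NLSGI

namespace NLSGI

noncomputable section Potentials

/-! ### Pairs of functions and their distance -/

/-- `P` holds for `f` and `g` with constant `K`, and for `f - g` with constant `K δ`. -/
def Pair (P : (ℝ → ℂ) → ℝ → Prop) (f g : ℝ → ℂ) (K δ : ℝ) : Prop :=
  P f K ∧ P g K ∧ P (fun x => f x - g x) (K * δ)

variable {P P' R : (ℝ → ℂ) → ℝ → Prop}

lemma Pair.mono (hP : ∀ f K L, P f K → K ≤ L → P f L) {f g : ℝ → ℂ} {K L δ : ℝ} (hδ : 0 ≤ δ)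
    (h : Pair P f g K δ) (hKL : K ≤ L) : Pair P f g L δ :=
  ⟨hP _ _ _ h.1 hKL, hP _ _ _ h.2.1 hKL, hP _ _ _ h.2.2 (by gcongr)⟩

lemma Pair.add (hP : ∀ f g K L, P f K → P g L → P (fun x => f x + g x) (K + L))
    {f g f' g' : ℝ → ℂ} {K L δ : ℝ} (h : Pair P f g K δ) (h' : Pair P f' g' L δ) :
    Pair P (fun x => f x + f' x) (fun x => g x + g' x) (K + L) δ := by
  refine ⟨hP _ _ _ _ h.1 h'.1, hP _ _ _ _ h.2.1 h'.2.1, ?_⟩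
  have := hP _ _ _ _ h.2.2 h'.2.2
  rw [← add_mul] at this
  refine (congrArg (fun F => P F ((K + L) * δ)) (funext fun x => ?_)).mp this
  ring

lemma Pair.const_mul (hP : ∀ f K (c : ℂ), P f K → P (fun x => c * f x) (‖c‖ * K))
    {f g : ℝ → ℂ} {K δ : ℝ} (h : Pair P f g K δ) (c : ℂ) :
    Pair P (fun x => c * f x) (fun x => c * g x) (‖c‖ * K) δ := by
  refine ⟨hP _ _ c h.1, hP _ _ c h.2.1, ?_⟩
  have := hP _ _ c h.2.2
  rw [← mul_assoc] at this
  refine (congrArg (fun F => P F (‖c‖ * K * δ)) (funext fun x => ?_)).mp this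
  ring

lemma Pair.conj (hP : ∀ f K, P f K → P (fun x => (starRingEnd ℂ) (f x)) K)
    {f g : ℝ → ℂ} {K δ : ℝ} (h : Pair P f g K δ) :
    Pair P (fun x => (starRingEnd ℂ) (f x)) (fun x => (starRingEnd ℂ) (g x)) K δ := by
  refine ⟨hP _ _ h.1, hP _ _ h.2.1, ?_⟩
  have := hP _ _ h.2.2
  simpa only [map_sub] using this

/-- The difference is `(f - g) f' + g (f' - g')`, each term costing `2 K L δ`. Three classes are
allowed because supremum bounds are multiplied with `L²` type bounds. -/
lemma Pair.mul (hm : ∀ f g K L, P f K → P' g L → R (fun x => f x * g x) (2 * (K * L)))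
    (ha : ∀ f g K L, R f K → R g L → R (fun x => f x + g x) (K + L))
    (hmono : ∀ f K L, R f K → K ≤ L → R f L)
    {f g f' g' : ℝ → ℂ} {K L δ : ℝ} (hK : 0 ≤ K) (hL : 0 ≤ L)
    (h : Pair P f g K δ) (h' : Pair P' f' g' L δ) :
    Pair R (fun x => f x * f' x) (fun x => g x * g' x) (4 * (K * L)) δ := by
  have hKL : 2 * (K * L) ≤ 4 * (K * L) := by nlinarith [mul_nonneg hK hL]
  refine ⟨hmono _ _ _ (hm _ _ _ _ h.1 h'.1) hKL, hmono _ _ _ (hm _ _ _ _ h.2.1 h'.2.1) hKL, ?_⟩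
  have := ha _ _ _ _ (hm _ _ _ _ h.2.2 h'.1) (hm _ _ _ _ h.2.1 h'.2.2)
  rw [show 2 * (K * δ * L) + 2 * (K * (L * δ)) = 4 * (K * L) * δ by ring] at this
  refine (congrArg (fun F => R F (4 * (K * L) * δ)) (funext fun x => ?_)).mp this
  ring

/-- The function is measurable, with `L^{2,1}` norm at most `K`. -/
structure IsL21Bound (f : ℝ → ℂ) (K : ℝ) : Prop where
  nonneg : 0 ≤ K
  measurable : Measurable f
  le : normL21 f ≤ ENNReal.ofReal K

/-- The function is measurable, with `L²` norm at most `K`. -/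
structure IsL2Bound (f : ℝ → ℂ) (K : ℝ) : Prop where
  nonneg : 0 ≤ K
  measurable : Measurable f
  le : normL2 f ≤ ENNReal.ofReal K

/-- The function is measurable and bounded by `K`. -/
structure IsSupBound (f : ℝ → ℂ) (K : ℝ) : Prop where
  measurable : Measurable f
  le : ∀ x, ‖f x‖ ≤ K

lemma IsSupBound.nonneg {f : ℝ → ℂ} {K : ℝ} (h : IsSupBound f K) : 0 ≤ K :=
  (norm_nonneg _).trans (h.le 0)

lemma IsL2Bound.mono (f : ℝ → ℂ) (K L : ℝ) (h : IsL2Bound f K) (hKL : K ≤ L) : IsL2Bound f L :=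
  ⟨h.nonneg.trans hKL, h.measurable, h.le.trans (ENNReal.ofReal_le_ofReal hKL)⟩

lemma IsL2Bound.add (f g : ℝ → ℂ) (K L : ℝ) (h : IsL2Bound f K) (h' : IsL2Bound g L) :
    IsL2Bound (fun x => f x + g x) (K + L) := by
  refine ⟨add_nonneg h.nonneg h'.nonneg, h.measurable.add h'.measurable, ?_⟩
  rw [ENNReal.ofReal_add h.nonneg h'.nonneg]
  exact (eLpNorm_add_le h.measurable.aestronglyMeasurable h'.measurable.aestronglyMeasurable
    (by norm_num)).trans (add_le_add h.le h'.le)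

lemma IsL2Bound.const_mul (f : ℝ → ℂ) (K : ℝ) (c : ℂ) (h : IsL2Bound f K) :
    IsL2Bound (fun x => c * f x) (‖c‖ * K) := by
  refine ⟨mul_nonneg (norm_nonneg _) h.nonneg, h.measurable.const_mul c, ?_⟩
  rw [ENNReal.ofReal_mul (norm_nonneg c)]
  refine (eLpNorm_le_mul_eLpNorm_of_ae_le_mul (Filter.Eventually.of_forall fun z => ?_) 2).trans
    (mul_le_mul_right h.le _)
  rw [norm_mul]

lemma IsL2Bound.conj (f : ℝ → ℂ) (K : ℝ) (h : IsL2Bound f K) :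
    IsL2Bound (fun x => (starRingEnd ℂ) (f x)) K :=
  ⟨h.nonneg, Complex.continuous_conj.measurable.comp h.measurable,
    le_trans (le_of_eq (eLpNorm_congr_norm_ae (Filter.Eventually.of_forall fun z => by simp))) h.le⟩

lemma IsL2Bound.sup_mul (f g : ℝ → ℂ) (K L : ℝ) (h : IsSupBound f K) (h' : IsL2Bound g L) :
    IsL2Bound (fun x => f x * g x) (2 * (K * L)) := by
  have hK := h.nonneg
  have hL := h'.nonneg
  refine ⟨by positivity, h.measurable.mul h'.measurable, ?_⟩
  refine (eLpNorm_le_mul_eLpNorm_of_ae_le_mul (f := fun x => f x * g x) (g := g) (c := K)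
    (Filter.Eventually.of_forall fun z => ?_) 2).trans ((mul_le_mul_right h'.le _).trans ?_)
  · rw [norm_mul]; gcongr; exact h.le z
  · rw [← ENNReal.ofReal_mul hK]
    exact ENNReal.ofReal_le_ofReal (by nlinarith [mul_nonneg hK hL])

lemma isL21Bound_iff {f : ℝ → ℂ} {K : ℝ} :
    IsL21Bound f K ↔ IsL2Bound (fun x => (wt x : ℂ) * f x) K := by
  have hw : Measurable fun x => (wt x : ℂ) := (Complex.continuous_ofReal.comp continuous_wt).measurable
  refine ⟨fun h => ⟨h.1, hw.mul h.2, h.3⟩, fun h => ⟨h.1, ?_, h.3⟩⟩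
  have : f = fun x => (wt x : ℂ)⁻¹ * ((wt x : ℂ) * f x) := by
    ext x
    have : (wt x : ℂ) ≠ 0 := by exact_mod_cast (wt_pos x).ne'
    field_simp
  rw [this]
  exact hw.inv.mul h.2

lemma IsL21Bound.mono (f : ℝ → ℂ) (K L : ℝ) (h : IsL21Bound f K) (hKL : K ≤ L) : IsL21Bound f L :=
  ⟨h.nonneg.trans hKL, h.measurable, h.le.trans (ENNReal.ofReal_le_ofReal hKL)⟩

lemma IsL21Bound.add (f g : ℝ → ℂ) (K L : ℝ) (h : IsL21Bound f K) (h' : IsL21Bound g L) :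
    IsL21Bound (fun x => f x + g x) (K + L) := by
  rw [isL21Bound_iff] at *
  simpa only [mul_add] using IsL2Bound.add _ _ _ _ h h'

lemma IsL21Bound.const_mul (f : ℝ → ℂ) (K : ℝ) (c : ℂ) (h : IsL21Bound f K) :
    IsL21Bound (fun x => c * f x) (‖c‖ * K) := by
  rw [isL21Bound_iff] at *
  simpa only [mul_left_comm] using IsL2Bound.const_mul _ _ c h

lemma IsL21Bound.conj (f : ℝ → ℂ) (K : ℝ) (h : IsL21Bound f K) :
    IsL21Bound (fun x => (starRingEnd ℂ) (f x)) K := by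
  rw [isL21Bound_iff] at *
  simpa only [map_mul, Complex.conj_ofReal] using IsL2Bound.conj _ _ h

lemma IsL21Bound.sup_mul (f g : ℝ → ℂ) (K L : ℝ) (h : IsSupBound f K) (h' : IsL21Bound g L) :
    IsL21Bound (fun x => f x * g x) (2 * (K * L)) := by
  rw [isL21Bound_iff] at *
  simpa only [mul_left_comm] using IsL2Bound.sup_mul _ _ _ _ h h'

lemma IsL21Bound.isL2Bound {f : ℝ → ℂ} {K : ℝ} (h : IsL21Bound f K) : IsL2Bound f K := by
  refine ⟨h.1, h.2, le_trans (eLpNorm_mono fun x => ?_) h.3⟩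
  rw [norm_mul, Complex.norm_real, Real.norm_of_nonneg (Real.sqrt_nonneg _)]
  exact le_mul_of_one_le_left (norm_nonneg _) (one_le_wt x)

lemma IsSupBound.conj (f : ℝ → ℂ) (K : ℝ) (h : IsSupBound f K) :
    IsSupBound (fun x => (starRingEnd ℂ) (f x)) K :=
  ⟨Complex.continuous_conj.measurable.comp h.1, fun x => by simpa using h.2 x⟩

lemma Pair.isL2Bound {f g : ℝ → ℂ} {K δ : ℝ} (h : Pair IsL21Bound f g K δ) :
    Pair IsL2Bound f g K δ := ⟨h.1.isL2Bound, h.2.1.isL2Bound, h.2.2.isL2Bound⟩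

lemma l2norm_wt_inv_le : l2norm volume (fun x => ENNReal.ofReal (wt x)⁻¹) ≤ 2 := by
  have h1 : ∫⁻ x, ENNReal.ofReal (wt x)⁻¹ ^ 2 = ENNReal.ofReal Real.pi := by
    rw [← integral_univ_inv_one_add_sq, ofReal_integral_eq_lintegral_ofReal
      integrable_inv_one_add_sq (Filter.Eventually.of_forall fun x => by positivity)]
    congr 1 with x
    rw [← ENNReal.ofReal_pow (by have := wt_pos x; positivity), inv_pow, wt,
      Real.sq_sqrt (by positivity)]
  rw [l2norm, h1]
  calc (ENNReal.ofReal Real.pi) ^ (1 / 2 : ℝ) ≤ (ENNReal.ofReal 4) ^ (1 / 2 : ℝ) := by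
        gcongr; exact Real.pi_le_four
    _ = ((2 : ℝ≥0∞) ^ (2 : ℕ)) ^ (1 / 2 : ℝ) := by norm_num
    _ = 2 := by rw [← ENNReal.rpow_natCast, ← ENNReal.rpow_mul]; norm_num

/-- The weight `(1 + x²)^{-1/2}` pairs with `L²`. -/
lemma IsL2Bound.lintegral_mul_wt_inv_le {f : ℝ → ℂ} {K : ℝ} (h : IsL2Bound f K) :
    ∫⁻ x, ‖f x‖ₑ * ENNReal.ofReal (wt x)⁻¹ ≤ ENNReal.ofReal (2 * K) := by
  have hw : Measurable fun x => ENNReal.ofReal (wt x)⁻¹ :=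
    (continuous_wt.measurable.inv).ennreal_ofReal
  refine (lintegral_mul_le_l2norm h.measurable.enorm.aemeasurable hw.aemeasurable).trans ?_
  rw [mul_comm 2 K, ENNReal.ofReal_mul h.nonneg, show ENNReal.ofReal 2 = 2 by norm_num]
  exact mul_le_mul' (by rw [← eLpNorm_two_eq_l2norm]; exact h.le) l2norm_wt_inv_le

/-- Cauchy–Schwarz against `(1 + x²)^{-1/2}`, whose `L²` norm is `√π ≤ 2`. This makes the
coefficients of the Volterra systems integrable. -/
lemma IsL21Bound.lintegral_le {f : ℝ → ℂ} {K : ℝ} (h : IsL21Bound f K) :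
    ∫⁻ x, ‖f x‖ₑ ≤ ENNReal.ofReal (2 * K) := by
  refine le_trans (le_of_eq ?_) (isL21Bound_iff.1 h).lintegral_mul_wt_inv_le
  congr 1 with x
  have hw := wt_pos x
  have e : ‖(wt x : ℂ)‖ₑ = ENNReal.ofReal (wt x) := by
    rw [← ofReal_norm, Complex.norm_real, Real.norm_of_nonneg hw.le]
  rw [enorm_mul, mul_right_comm, e, ← ENNReal.ofReal_mul hw.le, mul_inv_cancel₀ hw.ne']
  simp

lemma IsL21Bound.integrable {f : ℝ → ℂ} {K : ℝ} (h : IsL21Bound f K) : Integrable f :=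
  ⟨h.measurable.aestronglyMeasurable, h.lintegral_le.trans_lt ENNReal.ofReal_lt_top⟩

/-! ### Potentials -/

/-- `u` is a primitive of `d`, and both have `L^{2,1}` norm at most `K`. -/
structure IsPot (u d : ℝ → ℂ) (K : ℝ) : Prop where
  prim : IsPrim u d
  fst : IsL21Bound u K
  snd : IsL21Bound d K

/-- A primitive is bounded by local averages. -/
lemma IsPrim.enorm_le_lintegral {f f' : ℝ → ℂ} (h : IsPrim f f') (hf' : Measurable f') (x : ℝ) :
    ‖f x‖ₑ ≤ ∫⁻ y in Ioc (x - 1) x, (‖f y‖ₑ + ‖f' y‖ₑ) := by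
  have hle : ∀ y ∈ Ioc (x - 1) x, ‖f x‖ₑ ≤ ‖f y‖ₑ + ∫⁻ t in Ioc (x - 1) x, ‖f' t‖ₑ := by
    intro y hy
    have e : f x = f y + ∫ t in y..x, f' t := by rw [← h.eq]; ring
    rw [e]
    refine (enorm_add_le _ _).trans ?_
    gcongr
    rw [intervalIntegral.integral_of_le hy.2]
    refine (enorm_integral_le_lintegral_enorm _).trans (lintegral_mono_set ?_)
    exact Ioc_subset_Ioc_left hy.1.le
  calc ‖f x‖ₑ = ∫⁻ _ in Ioc (x - 1) x, ‖f x‖ₑ := by simp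
    _ ≤ ∫⁻ y in Ioc (x - 1) x, (‖f y‖ₑ + ∫⁻ t in Ioc (x - 1) x, ‖f' t‖ₑ) :=
        setLIntegral_mono' measurableSet_Ioc hle
    _ = _ := by
        rw [lintegral_add_right _ measurable_const, lintegral_add_right _ hf'.enorm]
        simp

lemma tendsto_lintegral_Iic_atBot {f : ℝ → ℝ≥0∞} (hf : ∫⁻ x, f x ≠ ⊤) :
    Filter.Tendsto (fun x => ∫⁻ y in Iic x, f y) Filter.atBot (nhds 0) := by
  have hfin : IsFiniteMeasure (volume.withDensity f) := isFiniteMeasure_withDensity hf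
  have h := tendsto_measure_iInter_atBot (μ := volume.withDensity f) (s := fun x : ℝ => Iic x)
    (fun x => measurableSet_Iic.nullMeasurableSet) monotone_Iic ⟨0, measure_ne_top _ _⟩
  have he : (⋂ x : ℝ, Iic x) = ∅ := by
    ext y
    simp only [mem_iInter, mem_Iic, mem_empty_iff_false, iff_false, not_forall, not_le]
    exact exists_lt y
  rw [he, measure_empty] at h
  refine h.congr fun x => ?_
  rw [Function.comp_apply, withDensity_apply _ measurableSet_Iic]

/-- A primitive in `L²` of a function in `L²` tends to zero at `-∞`. -/
lemma IsPrim.tendsto_atBot {f f' : ℝ → ℂ} (h : IsPrim f f') {K L : ℝ} (hf : IsL2Bound f K)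
    (hf' : IsL2Bound f' L) : Filter.Tendsto f Filter.atBot (nhds 0) := by
  have key : ∀ (g : ℝ → ℂ) (M : ℝ), IsL2Bound g M →
      Filter.Tendsto (fun x => (∫⁻ y in Iic x, ‖g y‖ₑ ^ 2) ^ (1 / 2 : ℝ)) Filter.atBot (nhds 0) := by
    intro g M hg
    have h1 := tendsto_lintegral_Iic_atBot (f := fun y => ‖g y‖ₑ ^ 2) (by
      rw [← l2norm_sq, ← eLpNorm_two_eq_l2norm]
      exact ENNReal.pow_ne_top (hg.le.trans_lt ENNReal.ofReal_lt_top).ne)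
    have h2 := ((ENNReal.continuous_rpow_const (y := (1 / 2 : ℝ))).tendsto 0).comp h1
    rwa [ENNReal.zero_rpow_of_pos (by norm_num)] at h2
  have hb : ∀ (g : ℝ → ℂ) (M : ℝ), IsL2Bound g M → ∀ x, ∫⁻ y in Ioc (x - 1) x, ‖g y‖ₑ ≤
      (∫⁻ y in Iic x, ‖g y‖ₑ ^ 2) ^ (1 / 2 : ℝ) := by
    intro g M hg x
    have := lintegral_mul_le_l2norm (μ := volume.restrict (Ioc (x - 1) x))
      hg.measurable.enorm.aemeasurable (aemeasurable_const (b := 1))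
    simp only [mul_one] at this
    refine this.trans ?_
    have e1 : l2norm (volume.restrict (Ioc (x - 1) x)) (fun _ => 1) = 1 := by simp [l2norm]
    rw [e1, mul_one]
    exact l2norm_mono_measure (Measure.restrict_mono Ioc_subset_Iic_self le_rfl) _
  rw [tendsto_zero_iff_enorm_tendsto_zero]
  have h0 := (key f K hf).add (key f' L hf')
  rw [add_zero] at h0
  refine tendsto_of_tendsto_of_tendsto_of_le_of_le tendsto_const_nhds h0 (fun x => zero_le) fun x => ?_
  refine (h.enorm_le_lintegral hf'.measurable x).trans ?_
  rw [lintegral_add_left hf.measurable.enorm]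
  exact add_le_add (hb f K hf x) (hb f' L hf' x)

lemma IsPot.tendsto_atBot {u d : ℝ → ℂ} {K : ℝ} (h : IsPot u d K) :
    Filter.Tendsto u Filter.atBot (nhds 0) :=
  h.prim.tendsto_atBot h.fst.isL2Bound h.snd.isL2Bound

/-- The local average bound is at most the sum of the `L¹` norms of `u` and its derivative, each at
most `2 K`. -/
lemma IsPot.isSupBound {u d : ℝ → ℂ} {K : ℝ} (h : IsPot u d K) : IsSupBound u (4 * K) := by
  refine ⟨h.fst.measurable, fun x => ?_⟩
  have hK := h.fst.nonneg
  have h1 : ‖u x‖ₑ ≤ ENNReal.ofReal (4 * K) := by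
    refine (h.prim.enorm_le_lintegral h.snd.measurable x).trans ?_
    refine (setLIntegral_le_lintegral _ _).trans ?_
    rw [lintegral_add_left h.fst.measurable.enorm, show 4 * K = 2 * K + 2 * K by ring,
      ENNReal.ofReal_add (by positivity) (by positivity)]
    exact add_le_add h.fst.lintegral_le h.snd.lintegral_le
  rw [← ofReal_norm] at h1
  exact (ENNReal.ofReal_le_ofReal_iff (by positivity)).1 h1

/-- The reflection `U(x) = -conj u(-x)`, which exchanges the two ends of the line. -/
def reflection (u : ℝ → ℂ) (x : ℝ) : ℂ := -(starRingEnd ℂ) (u (-x))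

/-- The derivative of the reflection of a function with derivative `d`. -/
def reflectDeriv (d : ℝ → ℂ) (x : ℝ) : ℂ := (starRingEnd ℂ) (d (-x))

lemma IsL21Bound.comp_neg {f : ℝ → ℂ} {K : ℝ} (h : IsL21Bound f K) :
    IsL21Bound (fun x => f (-x)) K := by
  refine ⟨h.1, h.2.comp measurable_neg, le_trans (le_of_eq ?_) h.3⟩
  have := eLpNorm_comp_measurePreserving (p := 2) (f := Neg.neg)
    (g := fun x => (Real.sqrt (1 + x ^ 2) : ℂ) * f x)
    (μ := (volume : Measure ℝ)) (ν := (volume : Measure ℝ)) (by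
      have hw : Measurable fun x => (wt x : ℂ) :=
        (Complex.continuous_ofReal.comp continuous_wt).measurable
      exact (hw.mul h.2).aestronglyMeasurable) (Measure.measurePreserving_neg volume)
  rw [normL21, normL21, normL2, normL2, ← this]
  congr 1 with x
  simp

lemma IsPot.reflect {u d : ℝ → ℂ} {K : ℝ} (h : IsPot u d K) :
    IsPot (reflection u) (reflectDeriv d) K := by
  refine ⟨?_, ?_, IsL21Bound.conj _ _ h.snd.comp_neg⟩
  · have := (h.prim.comp_neg.conj).const_mul (-1)
    refine (congrArg₂ IsPrim ?_ ?_).mp this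
    · ext x; simp [reflection]
    · ext x; simp [reflectDeriv]
  · have := IsL21Bound.const_mul _ _ (-1) (IsL21Bound.conj _ _ h.fst.comp_neg)
    rw [norm_neg, norm_one, one_mul] at this
    refine (congrArg (fun F => IsL21Bound F K) (funext fun x => ?_)).mp this
    simp [reflection]

/-- Two potentials of size at most `B` and distance at most `δ`. -/
structure IsPotPair (u d v e : ℝ → ℂ) (B δ : ℝ) : Prop where
  left : IsPot u d B
  right : IsPot v e B
  sub : IsPot (fun x => u x - v x) (fun x => d x - e x) δ

lemma IsPotPair.reflect {u d v e : ℝ → ℂ} {B δ : ℝ} (h : IsPotPair u d v e B δ) :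
    IsPotPair (reflection u) (reflectDeriv d) (reflection v) (reflectDeriv e) B δ := by
  refine ⟨h.left.reflect, h.right.reflect, ?_⟩
  refine (congrArg₂ (fun f g => IsPot f g δ) ?_ ?_).mp h.sub.reflect
  · ext x; simp [reflection]; ring
  · ext x; simp [reflectDeriv]

lemma IsPotPair.nonneg {u d v e : ℝ → ℂ} {B δ : ℝ} (h : IsPotPair u d v e B δ) : 0 ≤ B ∧ 0 ≤ δ :=
  ⟨h.left.fst.nonneg, h.sub.fst.nonneg⟩

section PairBounds

variable {u d v e : ℝ → ℂ} {B δ : ℝ}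

/-- `Pair` wants one constant `K` with `K δ` for the difference. As `B ≥ 0`, the choice `B + 1`
dominates both `B` and `1`. -/
lemma IsPotPair.l21_fst (h : IsPotPair u d v e B δ) : Pair IsL21Bound u v (B + 1) δ := by
  obtain ⟨hB, hδ⟩ := h.nonneg
  exact ⟨IsL21Bound.mono _ _ _ h.left.fst (by linarith), IsL21Bound.mono _ _ _ h.right.fst
    (by linarith), IsL21Bound.mono _ _ _ h.sub.fst (by nlinarith)⟩

lemma IsPotPair.l21_snd (h : IsPotPair u d v e B δ) : Pair IsL21Bound d e (B + 1) δ := by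
  obtain ⟨hB, hδ⟩ := h.nonneg
  exact ⟨IsL21Bound.mono _ _ _ h.left.snd (by linarith), IsL21Bound.mono _ _ _ h.right.snd
    (by linarith), IsL21Bound.mono _ _ _ h.sub.snd (by nlinarith)⟩

lemma IsPotPair.sup (h : IsPotPair u d v e B δ) : Pair IsSupBound u v (4 * (B + 1)) δ := by
  obtain ⟨hB, hδ⟩ := h.nonneg
  have h1 := h.left.isSupBound
  have h2 := h.right.isSupBound
  have h3 := h.sub.isSupBound
  exact ⟨⟨h1.1, fun x => (h1.2 x).trans (by linarith)⟩, ⟨h2.1, fun x => (h2.2 x).trans (by linarith)⟩,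
    ⟨h3.1, fun x => (h3.2 x).trans (by nlinarith)⟩⟩

end PairBounds

end Potentials

end NLSGI

namespace NLSGI

/-! ### Lipschitz dependence on the coefficients by doubling the system. -/

noncomputable section Blocks

lemma IsL21Bound.zero : IsL21Bound (fun _ => 0) 0 :=
  ⟨le_rfl, measurable_const, by simp [normL21, normL2]⟩

lemma IsL21Bound.sum {ι : Type*} (s : Finset ι) {f : ι → ℝ → ℂ} {L : ℝ} (h : ∀ i, IsL21Bound (f i) L) :
    IsL21Bound (fun x => ∑ i ∈ s, f i x) (s.card * L) := by
  classical
  induction s using Finset.induction_on with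
  | empty => simpa using IsL21Bound.zero
  | insert a s ha ih =>
    have := IsL21Bound.add _ _ _ _ (h a) ih
    refine (congrArg₂ IsL21Bound (funext fun x => ?_) ?_).mp this
    · rw [Finset.sum_insert ha]
    · rw [Finset.card_insert_of_notMem ha]; push_cast; ring

variable {ι : Type*} [Fintype ι]

/-- In the constant, the first summand collects the `L¹` norms of all entries, at most `2 L` each,
and the second the `L^{2,1}` norm of a row of the source. -/
lemma isAKNS_of_isL21Bound {d : ι → ℝ} {V : ι → ι → ℝ → ℂ} {e : ι → ℂ} {L : ℝ}
    (hV : ∀ i j, IsL21Bound (V i j) L) (hL : 0 ≤ L) (hd : ∀ i, d i = 0 ∨ d i = 1)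
    (he : ∀ j, e j = 0 ∨ d j = 0) (he1 : ‖e‖ ≤ 1)
    (h0 : ∀ i, d i = 0 → ∀ y, ∑ j, V i j y * e j = 0) :
    IsAKNS d V e (Fintype.card ι * (Fintype.card ι * (2 * L)) + Fintype.card ι * L) := by
  refine ⟨⟨fun i j => (hV i j).measurable, fun i j => (hV i j).integrable⟩, hd, he, he1, h0, ?_, ?_⟩
  · refine le_trans ?_ (ENNReal.ofReal_le_ofReal (le_add_of_nonneg_right (by positivity)))
    unfold entrySum
    rw [lintegral_finsetSum _ fun i _ => Finset.measurable_fun_sum _ fun j _ =>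
      (hV i j).measurable.enorm]
    calc _ ≤ ∑ i : ι, ∑ j : ι, ENNReal.ofReal (2 * L) := by
          refine Finset.sum_le_sum fun i _ => ?_
          rw [lintegral_finsetSum _ fun j _ => (hV i j).measurable.enorm]
          exact Finset.sum_le_sum fun j _ => (hV i j).lintegral_le
      _ = _ := by
          simp [ENNReal.ofReal_mul, ENNReal.ofReal_natCast]
  · intro i
    have h1 : ∀ j, IsL21Bound (fun y => V i j y * e j) L := fun j => by
      have := IsL21Bound.const_mul _ _ (e j) (hV i j)
      simp only [mul_comm (e j)] at this
      refine IsL21Bound.mono _ _ _ this ?_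
      exact mul_le_of_le_one_left hL ((norm_le_pi_norm e j).trans he1)
    refine (IsL21Bound.sum Finset.univ h1).le.trans (ENNReal.ofReal_le_ofReal ?_)
    rw [Finset.card_univ]
    exact le_add_of_nonneg_left (by positivity)

/-- The matrix of the system satisfied by a solution together with a difference quotient. -/
def blockMatrix (V W : ι → ι → ℝ → ℂ) (δ : ℝ) : ι ⊕ ι → ι ⊕ ι → ℝ → ℂ
  | .inl i, .inl j => W i j
  | .inl _, .inr _ => fun _ => 0
  | .inr i, .inl j => fun y => (δ : ℂ)⁻¹ * (V i j y - W i j y)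
  | .inr i, .inr j => V i j

/-- For solutions `X`, `Y` belonging to `V`, `W`, the identity `V X - W Y = V (X - Y) + (V - W) Y`
shows that `δ⁻¹ (X - Y)` solves the equation of `V` with forcing linear in `Y`. Uniqueness
identifies the doubled solution. -/
lemma volterraSol_blockMatrix {d : ι → ℝ} {V W : ι → ι → ℝ → ℂ} {e : ι → ℂ} {θ : ℂ} {δ : ℝ}
    (hV : IntegrableMatrix V) (hW : IntegrableMatrix W)
    (hθ : θ.re ≤ 0) (hd : ∀ i, 0 ≤ d i) :
    volterraSol (Sum.elim d d) (blockMatrix V W δ) (Sum.elim e 0) θ = fun x =>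
      Sum.elim (volterraSol d W e θ x)
        (fun i => (δ : ℂ)⁻¹ * (volterraSol d V e θ x i - volterraSol d W e θ x i)) := by
  have hB : IntegrableMatrix (blockMatrix V W δ) := by
    refine ⟨?_, ?_⟩
    · rintro (i | i) (j | j)
      · exact hW.1 i j
      · exact measurable_const
      · exact ((hV.1 i j).sub (hW.1 i j)).const_mul _
      · exact hV.1 i j
    · rintro (i | i) (j | j)
      · exact hW.2 i j
      · exact integrable_zero _ _ _
      · exact ((hV.2 i j).sub (hW.2 i j)).const_mul _
      · exact hV.2 i j
  have hdd : ∀ i, 0 ≤ Sum.elim d d i := by rintro (i | i) <;> exact hd i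
  have sV := isVolterraSol_volterraSol (e := e) hV hθ hd
  have sW := isVolterraSol_volterraSol (e := e) hW hθ hd
  refine IsVolterraSol.unique hB hθ hdd (isVolterraSol_volterraSol hB hθ hdd) ⟨?_, ?_, ?_⟩
  · refine continuous_pi ?_
    rintro (i | i)
    · exact (continuous_apply i).comp sW.continuous
    · exact (((continuous_apply i).comp sV.continuous).sub
        ((continuous_apply i).comp sW.continuous)).const_mul _
  · obtain ⟨A, hA⟩ := sV.bounded
    obtain ⟨B, hB⟩ := sW.bounded
    have hA0 := (norm_nonneg _).trans (hA 0)
    have hB0 := (norm_nonneg _).trans (hB 0)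
    refine ⟨B + ‖(δ : ℂ)⁻¹‖ * (A + B), fun x => (pi_norm_le_iff_of_nonneg (by positivity)).2 ?_⟩
    rintro (i | i)
    · exact ((norm_le_pi_norm _ i).trans (hB x)).trans (le_add_of_nonneg_right (by positivity))
    · rw [Sum.elim_inr, norm_mul]
      refine le_trans ?_ (le_add_of_nonneg_left hB0)
      gcongr
      exact (norm_sub_le _ _).trans (add_le_add ((norm_le_pi_norm _ i).trans (hA x))
        ((norm_le_pi_norm _ i).trans (hB x)))
  · obtain ⟨A, hA⟩ := sV.bounded
    obtain ⟨B, hB⟩ := sW.bounded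
    rintro x (i | i)
    · simp only [Sum.elim_inl]
      rw [sW.eq x i]
      simp [volterraOp, blockMatrix]
    · simp only [Sum.elim_inr, Pi.zero_apply, zero_add]
      rw [sV.eq x i, sW.eq x i, add_sub_add_left_eq_sub]
      unfold volterraOp
      rw [← integral_sub
        (integrableOn_exp_mul hθ (hd i) x
          (integrable_sum_mul hV sV.continuous.measurable hA i).integrableOn)
        (integrableOn_exp_mul hθ (hd i) x
          (integrable_sum_mul hW sW.continuous.measurable hB i).integrableOn),
        ← integral_const_mul]
      congr 1 with y
      simp only [Fintype.sum_sum_type, blockMatrix, Sum.elim_inl, Sum.elim_inr]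
      rw [← Finset.sum_add_distrib, ← mul_sub, ← Finset.sum_sub_distrib, mul_left_comm,
        Finset.mul_sum]
      congr 1
      refine Finset.sum_congr rfl fun j _ => ?_
      ring

/-- Bounds for solutions of Volterra systems and for their differences. -/
theorem exists_pair_bound (ι : Type*) [Fintype ι] (L : ℝ) : ∃ K : ℝ, 0 ≤ K ∧
    ∀ (d : ι → ℝ) (V W : ι → ι → ℝ → ℂ) (e : ι → ℂ) (δ : ℝ), 0 < δ →
      (∀ i, d i = 0 ∨ d i = 1) → (∀ j, e j = 0 ∨ d j = 0) → ‖e‖ ≤ 1 →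
      (∀ i, d i = 0 → ∀ y, ∑ j, V i j y * e j = 0) →
      (∀ i, d i = 0 → ∀ y, ∑ j, W i j y * e j = 0) →
      (∀ i j, Pair IsL21Bound (V i j) (W i j) L δ) →
      (∀ i, Pair IsH1Bound (fun z : ℝ => volterraSol d V e (theta z) 0 i - e i)
        (fun z : ℝ => volterraSol d W e (theta z) 0 i - e i) K δ) ∧
      ∀ x ≤ 0, ∀ i,
        l2norm volume (fun z : ℝ => ‖volterraSol d V e (theta z) x i - e i‖ₑ) ≤
          ENNReal.ofReal (K / wt x) ∧
        l2norm volume (fun z : ℝ => ‖volterraSol d W e (theta z) x i - e i‖ₑ) ≤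
          ENNReal.ofReal (K / wt x) ∧
        l2norm volume (fun z : ℝ => ‖volterraSol d V e (theta z) x i -
          volterraSol d W e (theta z) x i‖ₑ) ≤ ENNReal.ofReal (K * δ / wt x) := by
  obtain ⟨K₁, hK₁, h₁⟩ := IsAKNS.exists_bound ι
    (Fintype.card ι * (Fintype.card ι * (2 * L)) + Fintype.card ι * L)
  obtain ⟨K₂, hK₂, h₂⟩ := IsAKNS.exists_bound (ι ⊕ ι)
    (Fintype.card (ι ⊕ ι) * (Fintype.card (ι ⊕ ι) * (2 * L)) + Fintype.card (ι ⊕ ι) * L)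
  refine ⟨K₁ + K₂, by positivity, fun d V W e δ hδ hd he he1 hV0 hW0 hVW => ?_⟩
  -- An index is needed to know that `L` is nonnegative.
  rcases isEmpty_or_nonempty ι with hι | ⟨⟨i₀⟩⟩
  · exact ⟨fun i => hι.elim i, fun x _ i => hι.elim i⟩
  have hL : 0 ≤ L := (hVW i₀ i₀).1.nonneg
  have hδ' : (δ : ℂ) ≠ 0 := by exact_mod_cast hδ.ne'
  have aV := isAKNS_of_isL21Bound (fun i j => (hVW i j).1) hL hd he he1 hV0
  have aW := isAKNS_of_isL21Bound (fun i j => (hVW i j).2.1) hL hd he he1 hW0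
  have hsub : ∀ i j, IsL21Bound (fun y => (δ : ℂ)⁻¹ * (V i j y - W i j y)) L := fun i j => by
    have := IsL21Bound.const_mul _ _ (δ : ℂ)⁻¹ (hVW i j).2.2
    refine IsL21Bound.mono _ _ _ this (le_of_eq ?_)
    rw [norm_inv, Complex.norm_real, Real.norm_of_nonneg hδ.le]
    field_simp
  -- Division by `δ` brings the entries of `V - W` back to size `L`. The doubled system meets the
  -- same hypotheses uniformly in `δ`, and a bound for its lower half is a Lipschitz estimate.
  have aB : IsAKNS (Sum.elim d d) (blockMatrix V W δ) (Sum.elim e 0)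
      (Fintype.card (ι ⊕ ι) * (Fintype.card (ι ⊕ ι) * (2 * L)) + Fintype.card (ι ⊕ ι) * L) := by
    refine isAKNS_of_isL21Bound (L := L) ?_ hL ?_ ?_ ?_ ?_
    · rintro (i | i) (j | j)
      · exact (hVW i j).2.1
      · exact IsL21Bound.mono _ _ _ IsL21Bound.zero hL
      · exact hsub i j
      · exact (hVW i j).1
    · rintro (i | i) <;> exact hd i
    · rintro (i | i)
      · exact he i
      · exact Or.inl rfl
    · refine (pi_norm_le_iff_of_nonneg zero_le_one).2 ?_
      rintro (i | i)
      · exact (norm_le_pi_norm e i).trans he1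
      · simp
    · rintro (i | i) hi y
      · simpa [blockMatrix] using hW0 i hi y
      · have h1 := hV0 i hi y
        have h2 := hW0 i hi y
        simp only [Fintype.sum_sum_type, blockMatrix, Sum.elim_inl, Sum.elim_inr, Pi.zero_apply,
          mul_zero, Finset.sum_const_zero, add_zero]
        rw [show ∑ j, (δ : ℂ)⁻¹ * (V i j y - W i j y) * e j =
          (δ : ℂ)⁻¹ * (∑ j, V i j y * e j - ∑ j, W i j y * e j) by
            rw [← Finset.sum_sub_distrib, Finset.mul_sum]
            exact Finset.sum_congr rfl fun j _ => by ring, h1, h2]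
        simp
  obtain ⟨bV, bV'⟩ := h₁ d V e aV
  obtain ⟨bW, bW'⟩ := h₁ d W e aW
  obtain ⟨bB, bB'⟩ := h₂ _ _ _ aB
  have hre : ∀ z : ℝ, (theta z).re ≤ 0 := theta_ofReal_re
  have key : ∀ z : ℝ, _ := fun z : ℝ => volterraSol_blockMatrix (δ := δ) (e := e)
    aV.matrix aW.matrix (hre z) (phase_nonneg hd)
  simp only [key] at bB bB'
  have hwt := wt_pos
  have hcomp : ∀ (f : ℝ → ι → ℂ) (i : ι), l2norm volume (fun z => ‖f z i‖ₑ) ≤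
      l2norm volume (fun z => ‖f z‖ₑ) := fun f i => l2norm_mono fun z => enorm_apply_le_pi _ i
  refine ⟨fun i => ⟨(bV i).mono (by linarith), (bW i).mono (by linarith), ?_⟩,
    fun x hx i => ⟨?_, ?_, ?_⟩⟩
  · have := (bB (.inr i)).const_mul (δ : ℂ)
    refine IsH1Bound.mono (K := ‖(δ : ℂ)‖ * K₂) ?_ ?_
    · refine (congrArg (fun F => IsH1Bound F _) (funext fun z => ?_)).mp this
      simp only [Sum.elim_inr, Pi.zero_apply]
      field_simp
      ring
    · rw [Complex.norm_real, Real.norm_of_nonneg hδ.le]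
      nlinarith
  · refine (hcomp (fun z => volterraSol d V e (theta z) x - e) i).trans ((bV' x hx).trans ?_)
    exact ENNReal.ofReal_le_ofReal (by have := hwt x; gcongr; linarith)
  · refine (hcomp (fun z => volterraSol d W e (theta z) x - e) i).trans ((bW' x hx).trans ?_)
    exact ENNReal.ofReal_le_ofReal (by have := hwt x; gcongr; linarith)
  · have h3 := bB' x hx
    calc _ ≤ l2norm volume (fun z : ℝ => ENNReal.ofReal δ * ‖Sum.elim (volterraSol d W e (theta z) x)
            (fun i => (δ : ℂ)⁻¹ * (volterraSol d V e (theta z) x i - volterraSol d W e (theta z) x i))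
            - Sum.elim e 0‖ₑ) := by
          refine l2norm_mono fun z => ?_
          have h4 := enorm_apply_le_pi (Sum.elim (volterraSol d W e (theta z) x)
            (fun i => (δ : ℂ)⁻¹ * (volterraSol d V e (theta z) x i - volterraSol d W e (theta z) x i))
            - Sum.elim e 0) (.inr i)
          refine le_trans (le_of_eq ?_) (mul_le_mul_right h4 (ENNReal.ofReal δ))
          have h5 : ENNReal.ofReal δ = ‖(δ : ℂ)‖ₑ := by
            rw [← ofReal_norm, Complex.norm_real, Real.norm_of_nonneg hδ.le]
          rw [h5, ← enorm_mul]
          congr 1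
          simp only [Pi.sub_apply, Sum.elim_inr, Pi.zero_apply, sub_zero]
          field_simp
      _ ≤ ENNReal.ofReal δ * ENNReal.ofReal (K₂ / wt x) := by
          rw [l2norm_const_mul]
          · gcongr
          · have hc : ∀ V : ι → ι → ℝ → ℂ, IntegrableMatrix V →
                Continuous fun z : ℝ => volterraSol d V e (theta z) x := fun V hV =>
              (continuous_volterraSol (P := ℝ) (ϑ := fun z => theta z) hV (phase_nonneg hd)
                (continuous_theta.comp Complex.continuous_ofReal) hre).comp
                (by fun_prop : Continuous fun z : ℝ => (z, x))
            refine (Continuous.measurable (Continuous.sub ?_ continuous_const)).enorm.aemeasurable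
            refine continuous_pi ?_
            rintro (i | i)
            · exact (continuous_apply i).comp (hc W aW.matrix)
            · exact (((continuous_apply i).comp (hc V aV.matrix)).sub
                ((continuous_apply i).comp (hc W aW.matrix))).const_mul _
      _ ≤ _ := by
          rw [← ENNReal.ofReal_mul hδ.le]
          refine ENNReal.ofReal_le_ofReal ?_
          have := hwt x
          rw [mul_div_assoc', mul_comm δ]
          gcongr
          linarith

end Blocks

/-! ### The `3 × 3` system whose coefficients do not depend on `z`. -/

noncomputable section Lax

/-- The coefficient `conj u' + (i/2)|u|² conj u`. -/
def gcoef (u d : ℝ → ℂ) (x : ℝ) : ℂ :=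
  (starRingEnd ℂ) (d x) +
    Complex.I / 2 * (u x * ((starRingEnd ℂ) (u x) * (starRingEnd ℂ) (u x)))

/-- The matrix of the system satisfied by `(α, θ w - conj u α, w)`, which does not involve `z`. -/
def laxMatrix (u d : ℝ → ℂ) : Fin 3 → Fin 3 → ℝ → ℂ :=
  ![![fun _ => 0, fun x => -(Complex.I / 2) * u x, fun x => -1 * u x],
    ![fun x => -1 * gcoef u d x, fun _ => 0, fun x => u x * (starRingEnd ℂ) (u x)],
    ![fun x => -1 * (starRingEnd ℂ) (u x), fun _ => 0,
      fun x => -(Complex.I / 2) * (u x * (starRingEnd ℂ) (u x))]]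

/-- The phases of the system with matrix `laxMatrix`. -/
def laxPhase : Fin 3 → ℝ := ![0, 1, 1]

/-- The initial vector of the system with matrix `laxMatrix`. -/
def laxInit : Fin 3 → ℂ := ![1, 0, 0]

/-- The solution of the system with matrix `laxMatrix`. -/
def laxSol (u d : ℝ → ℂ) (z : ℂ) : ℝ → Fin 3 → ℂ :=
  volterraSol laxPhase (laxMatrix u d) laxInit (theta z)

variable {u d v e : ℝ → ℂ} {B δ : ℝ}

lemma IsPotPair.l21_mul_conj (h : IsPotPair u d v e B δ) :
    Pair IsL21Bound (fun x => u x * (starRingEnd ℂ) (u x)) (fun x => v x * (starRingEnd ℂ) (v x))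
      (4 * (4 * (B + 1) * (B + 1))) δ := by
  obtain ⟨hB, hδ⟩ := h.nonneg
  exact Pair.mul IsL21Bound.sup_mul IsL21Bound.add IsL21Bound.mono (by positivity) (by positivity)
    h.sup (h.l21_fst.conj IsL21Bound.conj)

lemma IsPotPair.l21_gcoef (h : IsPotPair u d v e B δ) :
    Pair IsL21Bound (gcoef u d) (gcoef v e) (300 * (B + 1) ^ 3) δ := by
  obtain ⟨hB, hδ⟩ := h.nonneg
  have h1 := Pair.mul IsL21Bound.sup_mul IsL21Bound.add IsL21Bound.mono (by positivity)
    (by positivity) (h.sup.conj IsSupBound.conj) (h.l21_fst.conj IsL21Bound.conj)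
  have h2 := Pair.mul IsL21Bound.sup_mul IsL21Bound.add IsL21Bound.mono (by positivity)
    (by positivity) h.sup h1
  have h3 := (h.l21_snd.conj IsL21Bound.conj).add IsL21Bound.add
    (h2.const_mul IsL21Bound.const_mul (Complex.I / 2))
  -- The derivative contributes `B + 1`. The two products contribute `256 (B + 1)³`, halved by `i /
  -- 2`. The round constant `300 (B + 1)³` is then used for all entries of `laxMatrix`.
  refine Pair.mono IsL21Bound.mono hδ h3 ?_
  have : ‖Complex.I / 2‖ = 1 / 2 := by simp
  rw [this]
  nlinarith [pow_nonneg hB 2, pow_nonneg hB 3]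

lemma IsPotPair.l21_laxMatrix (h : IsPotPair u d v e B δ) (i j : Fin 3) :
    Pair IsL21Bound (laxMatrix u d i j) (laxMatrix v e i j) (300 * (B + 1) ^ 3) δ := by
  obtain ⟨hB, hδ⟩ := h.nonneg
  have hI : ‖-(Complex.I / 2)‖ = 1 / 2 := by simp
  have h1 : ‖(-1 : ℂ)‖ = 1 := by simp
  have p1 : 0 ≤ B ^ 2 := by positivity
  have p2 : 0 ≤ B ^ 3 := by positivity
  have z : Pair IsL21Bound (fun _ => 0) (fun _ => 0) (300 * (B + 1) ^ 3) δ := by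
    have h0 := fun K (hK : 0 ≤ K) => IsL21Bound.mono _ _ _ IsL21Bound.zero hK
    refine ⟨h0 _ (by positivity), h0 _ (by positivity), ?_⟩
    simpa using h0 _ (by positivity : 0 ≤ 300 * (B + 1) ^ 3 * δ)
  fin_cases i <;> fin_cases j
  · exact z
  · refine Pair.mono IsL21Bound.mono hδ (h.l21_fst.const_mul IsL21Bound.const_mul _) ?_
    rw [hI]; nlinarith
  · refine Pair.mono IsL21Bound.mono hδ (h.l21_fst.const_mul IsL21Bound.const_mul _) ?_
    rw [h1]; nlinarith
  · refine Pair.mono IsL21Bound.mono hδ (h.l21_gcoef.const_mul IsL21Bound.const_mul _) ?_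
    rw [h1, one_mul]
  · exact z
  · refine Pair.mono IsL21Bound.mono hδ h.l21_mul_conj ?_
    nlinarith
  · refine Pair.mono IsL21Bound.mono hδ ((h.l21_fst.conj IsL21Bound.conj).const_mul
      IsL21Bound.const_mul _) ?_
    rw [h1]; nlinarith
  · exact z
  · refine Pair.mono IsL21Bound.mono hδ (h.l21_mul_conj.const_mul IsL21Bound.const_mul _) ?_
    rw [hI]; nlinarith

lemma laxPhase_eq (i : Fin 3) : laxPhase i = 0 ∨ laxPhase i = 1 := by
  fin_cases i <;> simp [laxPhase]

lemma laxInit_eq (i : Fin 3) : laxInit i = 0 ∨ laxPhase i = 0 := by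
  fin_cases i <;> simp [laxPhase, laxInit]

lemma norm_laxInit_le : ‖laxInit‖ ≤ 1 := by
  refine (pi_norm_le_iff_of_nonneg zero_le_one).2 fun i => ?_
  fin_cases i <;> simp [laxInit]

lemma laxMatrix_source (u d : ℝ → ℂ) (i : Fin 3) (hi : laxPhase i = 0) (y : ℝ) :
    ∑ j, laxMatrix u d i j y * laxInit j = 0 := by
  fin_cases i
  · simp [laxMatrix, laxInit, Fin.sum_univ_three]
  · simp [laxPhase] at hi
  · simp [laxPhase] at hi

lemma IsPot.integrableMatrix (h : IsPot u d B) : IntegrableMatrix (laxMatrix u d) := by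
  have hp : IsPotPair u d u d B B := by
    refine ⟨h, h, ?_⟩
    simp only [sub_self]
    have h0 := IsL21Bound.mono _ _ _ IsL21Bound.zero h.fst.nonneg
    exact ⟨IsPrim.const 0, h0, h0⟩
  exact ⟨fun i j => (hp.l21_laxMatrix i j).1.measurable,
    fun i j => (hp.l21_laxMatrix i j).1.integrable⟩

/-- Bounds in `z` for the solution of the system with matrix `laxMatrix`. -/
theorem exists_laxSol_bound (B : ℝ) : ∃ K : ℝ, 0 ≤ K ∧
    ∀ (u d v e : ℝ → ℂ) (δ : ℝ), 0 < δ → IsPotPair u d v e B δ →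
      (∀ i, Pair IsH1Bound (fun z : ℝ => laxSol u d z 0 i - laxInit i)
        (fun z : ℝ => laxSol v e z 0 i - laxInit i) K δ) ∧
      ∀ x ≤ 0, ∀ i,
        l2norm volume (fun z : ℝ => ‖laxSol u d z x i - laxInit i‖ₑ) ≤
          ENNReal.ofReal (K / wt x) ∧
        l2norm volume (fun z : ℝ => ‖laxSol v e z x i - laxInit i‖ₑ) ≤
          ENNReal.ofReal (K / wt x) ∧
        l2norm volume (fun z : ℝ => ‖laxSol u d z x i - laxSol v e z x i‖ₑ) ≤
          ENNReal.ofReal (K * δ / wt x) := by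
  obtain ⟨K, hK, h⟩ := exists_pair_bound (Fin 3) (300 * (B + 1) ^ 3)
  exact ⟨K, hK, fun u d v e δ hδ hp => h laxPhase (laxMatrix u d) (laxMatrix v e) laxInit δ hδ
    laxPhase_eq laxInit_eq norm_laxInit_le (laxMatrix_source u d) (laxMatrix_source v e)
    hp.l21_laxMatrix⟩

end Lax

end NLSGI

namespace NLSGI

/-! ### Passage between Volterra equations and differential equations. -/

noncomputable section VolterraODE

variable {ι : Type*} [Fintype ι] {d : ι → ℝ} {V : ι → ι → ℝ → ℂ} {e : ι → ℂ} {θ : ℂ}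
  {X : ℝ → ι → ℂ}

/-- Taking `e^{θ dᵢ x}` out of the kernel writes `Xᵢ - eᵢ` as an exponential times a primitive, and
the product rule gives the equation. -/
lemma IsVolterraSol.isPrim (hV : IntegrableMatrix V) (hθ : θ.re ≤ 0) (hd : ∀ i, 0 ≤ d i)
    (hX : IsVolterraSol d V e θ X) (i : ι) :
    IsPrim (fun x => X x i) (fun x => θ * d i * (X x i - e i) + ∑ j, V i j x * X x j) := by
  obtain ⟨M, hM⟩ := hX.bounded
  have hq := integrable_sum_mul hV hX.continuous.measurable hM i
  set q : ℝ → ℂ := fun y => ∑ j, V i j y * X y j with hq_def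
  have hexp : ∀ x y : ℝ, Complex.exp (-(θ * d i) * y) =
      Complex.exp (-(θ * d i) * x) * Complex.exp (θ * d i * (x - y)) := fun x y => by
    rw [← Complex.exp_add]; ring_nf
  have hi : ∀ x, IntegrableOn (fun y : ℝ => Complex.exp (-(θ * d i) * y) * q y) (Iic x) := fun x => by
    have := (integrableOn_exp_mul hθ (hd i) x hq.integrableOn).const_mul
      (Complex.exp (-(θ * d i) * x))
    refine this.congr (Filter.Eventually.of_forall fun y => ?_)
    simp only
    rw [hexp x y]
    exact (mul_assoc _ _ _).symm
  have hp := (IsPrim.const (e i)).add ((IsPrim.exp (θ * d i)).mul (IsPrim.integral_Iic hi))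
  have hone : ∀ x : ℝ, Complex.exp (θ * d i * x) * Complex.exp (-(θ * d i) * x) = 1 := fun x => by
    rw [← Complex.exp_add]; simp
  have hXi : ∀ x : ℝ, X x i - e i =
      Complex.exp (θ * d i * x) * ∫ y in Iic x, Complex.exp (-(θ * d i) * y) * q y := fun x => by
    rw [hX.eq x i, add_sub_cancel_left, ← integral_const_mul]
    unfold volterraOp
    congr 1 with y
    rw [← mul_assoc, hexp x y, ← mul_assoc, hone, one_mul]
  refine (congrArg₂ IsPrim (funext fun x => ?_) (funext fun x => ?_)).mp hp
  · rw [← hXi]; ring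
  · rw [zero_add, hXi, ← mul_assoc (Complex.exp _) (Complex.exp _), hone]
    ring

lemma IsVolterraSol.tendsto_atBot (hV : IntegrableMatrix V) (hθ : θ.re ≤ 0) (hd : ∀ i, 0 ≤ d i)
    (hX : IsVolterraSol d V e θ X) (i : ι) :
    Filter.Tendsto (fun x => X x i) Filter.atBot (nhds (e i)) := by
  obtain ⟨M, hM⟩ := hX.bounded
  have hq := integrable_sum_mul hV hX.continuous.measurable hM i
  rw [tendsto_iff_norm_sub_tendsto_zero]
  have h0 := tendsto_lintegral_Iic_atBot (f := fun y => ‖∑ j, V i j y * X y j‖ₑ) hq.2.ne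
  have h1 : Filter.Tendsto (fun x => ‖X x i - e i‖ₑ) Filter.atBot (nhds 0) := by
    refine tendsto_of_tendsto_of_tendsto_of_le_of_le tendsto_const_nhds h0 (fun x => zero_le)
      fun x => ?_
    simp only
    rw [hX.eq x i, add_sub_cancel_left]
    refine (enorm_integral_le_lintegral_enorm _).trans ?_
    exact setLIntegral_mono' measurableSet_Iic fun y hy => enorm_exp_mul_le hθ (hd i) hy _
  rw [← tendsto_zero_iff_norm_tendsto_zero, tendsto_zero_iff_enorm_tendsto_zero]
  exact h1

/-- Duhamel's formula for a function which vanishes at `-∞`. -/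
lemma IsPrim.eq_integral_exp_mul {p q : ℝ → ℂ} (hθ : θ.re = 0)
    (h : IsPrim p (fun x => θ * p x + q x)) (hq : Integrable q)
    (h0 : Filter.Tendsto p Filter.atBot (nhds 0)) (x : ℝ) :
    p x = ∫ y in Iic x, Complex.exp (θ * (x - y)) * q y := by
  have hexp : ∀ y : ℝ, ‖Complex.exp (-θ * y)‖ = 1 := fun y => by
    rw [Complex.norm_exp]; simp [hθ]
  have h1 := (IsPrim.exp (-θ)).mul h
  have h2 := h1.congr_deriv (g' := fun y => Complex.exp (-θ * y) * q y) fun y => by ring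
  have hi : Integrable (fun y : ℝ => Complex.exp (-θ * y) * q y) := by
    refine hq.bdd_mul (c := 1) ?_ (Filter.Eventually.of_forall fun y => (hexp y).le)
    exact (by fun_prop : Continuous fun y : ℝ => Complex.exp (-θ * y)).aestronglyMeasurable
  have h3 := intervalIntegral_tendsto_integral_Iic x hi.integrableOn Filter.tendsto_id
  have h4 : Filter.Tendsto (fun y : ℝ => Complex.exp (-θ * y) * p y) Filter.atBot (nhds 0) := by
    rw [tendsto_zero_iff_norm_tendsto_zero] at h0 ⊢
    refine h0.congr fun y => ?_
    rw [norm_mul, hexp, one_mul]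
  have h5 : Filter.Tendsto (fun y : ℝ => Complex.exp (-θ * x) * p x - Complex.exp (-θ * y) * p y)
      Filter.atBot (nhds (Complex.exp (-θ * x) * p x - 0)) := tendsto_const_nhds.sub h4
  have h6 := tendsto_nhds_unique (h3.congr fun y => (h2.eq y x).symm) h5
  calc p x = Complex.exp (θ * x) * (Complex.exp (-θ * x) * p x - 0) := by
        rw [sub_zero, ← mul_assoc, ← Complex.exp_add]; simp
    _ = _ := by
        rw [← h6, ← integral_const_mul]
        congr 1 with y
        rw [← mul_assoc, ← Complex.exp_add]
        ring_nf

end VolterraODE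

/-! ### Equivalence of the pair `(α, w)` and the triple on the real axis. -/

noncomputable section Reduction

variable {u d : ℝ → ℂ} {K : ℝ} {z : ℂ}

/-- The matrix of the linear system satisfied by the pair `(α, w)`. -/
def pairMatrix (u : ℝ → ℂ) (c c' : ℂ) : Fin 2 → Fin 2 → ℝ → ℂ :=
  ![![fun x => Complex.I / 2 * (u x * (starRingEnd ℂ) (u x)), fun x => c * u x],
    ![fun x => -c' * (starRingEnd ℂ) (u x), fun x => -(Complex.I / 2) * (u x * (starRingEnd ℂ) (u x))]]

/-- The phases of the system with matrix `pairMatrix`. -/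
def pairPhase : Fin 2 → ℝ := ![0, 1]

/-- The initial vector of the system with matrix `pairMatrix`. -/
def pairInit : Fin 2 → ℂ := ![1, 0]

lemma pairPhase_nonneg (i : Fin 2) : 0 ≤ pairPhase i := by
  fin_cases i <;> simp [pairPhase]

lemma IsPot.isL21Bound_mul_conj (h : IsPot u d K) :
    ∃ L, IsL21Bound (fun x => u x * (starRingEnd ℂ) (u x)) L :=
  ⟨_, IsL21Bound.sup_mul _ _ _ _ h.isSupBound (IsL21Bound.conj _ _ h.fst)⟩

/-- Two choices of the constants matter: `(k, k)` is the original system, and `(k², 1)` is the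
system after division of the second component by `k`. -/
lemma IsPot.integrableMatrix_pairMatrix (h : IsPot u d K) (c c' : ℂ) :
    IntegrableMatrix (pairMatrix u c c') := by
  obtain ⟨L, hL⟩ := h.isL21Bound_mul_conj
  have : ∀ i j, ∃ L, IsL21Bound (pairMatrix u c c' i j) L := by
    intro i j
    fin_cases i <;> fin_cases j
    · exact ⟨_, IsL21Bound.const_mul _ _ _ hL⟩
    · exact ⟨_, IsL21Bound.const_mul _ _ _ h.fst⟩
    · exact ⟨_, IsL21Bound.const_mul _ _ _ (IsL21Bound.conj _ _ h.fst)⟩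
    · exact ⟨_, IsL21Bound.const_mul _ _ _ hL⟩
  exact ⟨fun i j => (this i j).choose_spec.measurable, fun i j => (this i j).choose_spec.integrable⟩

lemma laxPhase_nonneg : ∀ i, 0 ≤ laxPhase i := phase_nonneg laxPhase_eq

lemma theta_re_nonpos (hz : 0 ≤ z.im) : (theta z).re ≤ 0 := by
  rw [theta_re]; linarith

lemma theta_re_zero (hz : z.im = 0) : (theta z).re = 0 := by
  rw [theta_re, hz]; simp

lemma IsPot.isVolterraSol_laxSol (h : IsPot u d K) (hz : 0 ≤ z.im) :
    IsVolterraSol laxPhase (laxMatrix u d) laxInit (theta z) (laxSol u d z) :=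
  isVolterraSol_volterraSol h.integrableMatrix (theta_re_nonpos hz) laxPhase_nonneg

/-- On the real axis the pair system determines the system with matrix `laxMatrix`. -/
lemma IsPot.laxSol_eq (h : IsPot u d K) (hz : z.im = 0) {Y : ℝ → Fin 2 → ℂ}
    (hY : IsVolterraSol pairPhase (pairMatrix u z 1) pairInit (theta z) Y) :
    laxSol u d z = fun x => ![Y x 0, theta z * Y x 1 - (starRingEnd ℂ) (u x) * Y x 0, Y x 1] := by
  have hθ := theta_re_zero hz
  have hM := h.integrableMatrix_pairMatrix z 1
  have e1 := (hY.isPrim hM hθ.le pairPhase_nonneg 0)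
  have e2 := (hY.isPrim hM hθ.le pairPhase_nonneg 1)
  have t1 := hY.tendsto_atBot hM hθ.le pairPhase_nonneg 0
  have t2 := hY.tendsto_atBot hM hθ.le pairPhase_nonneg 1
  simp only [pairPhase, pairInit, pairMatrix, Fin.sum_univ_two, Matrix.cons_val_zero,
    Matrix.cons_val_one, Complex.ofReal_zero, Complex.ofReal_one, mul_zero, mul_one, zero_mul,
    zero_add, sub_zero] at e1 e2 t1 t2
  -- The middle component is `β = θ w - ū α`. Differentiating `ū` here is what requires `u' ∈
  -- L^{2,1}`.
  have e3 := ((e2.const_mul (theta z)).sub (h.prim.conj.mul e1))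
  set X : ℝ → Fin 3 → ℂ := fun x =>
    ![Y x 0, theta z * Y x 1 - (starRingEnd ℂ) (u x) * Y x 0, Y x 1] with hX
  have hcont : Continuous X := by
    refine continuous_pi fun i => ?_
    fin_cases i
    · exact (show Continuous fun x => Y x 0 from (continuous_apply 0).comp hY.continuous)
    · exact e3.continuous
    · exact (show Continuous fun x => Y x 1 from (continuous_apply 1).comp hY.continuous)
  have hbdd : ∃ M, ∀ x, ‖X x‖ ≤ M := by
    obtain ⟨A, hA⟩ := hY.bounded
    have hA0 := (norm_nonneg _).trans (hA 0)
    have hU := h.isSupBound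
    have hU0 := hU.nonneg
    have hYi := fun x i => (norm_le_pi_norm (Y x) i).trans (hA x)
    refine ⟨A + (‖theta z‖ * A + 4 * K * A), fun x =>
      (pi_norm_le_iff_of_nonneg (by positivity)).2 fun i => ?_⟩
    fin_cases i
    · exact (hYi x 0).trans (le_add_of_nonneg_right (by positivity))
    · refine le_trans ?_ (le_add_of_nonneg_left hA0)
      refine (norm_sub_le _ _).trans ?_
      rw [norm_mul, norm_mul, RCLike.norm_conj]
      gcongr
      · exact hYi x 1
      · exact hU.le x
      · exact hYi x 0
    · exact (hYi x 1).trans (le_add_of_nonneg_right (by positivity))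
  obtain ⟨M, hM'⟩ := hbdd
  have hint := integrable_sum_mul h.integrableMatrix hcont.measurable hM'
  have hθ2 : theta z = 2 * Complex.I * (z + 1) := rfl
  have I2 := Complex.I_mul_I
  refine IsVolterraSol.unique h.integrableMatrix hθ.le laxPhase_nonneg
    (h.isVolterraSol_laxSol hz.ge) ⟨hcont, ⟨M, hM'⟩, fun x i => ?_⟩
  fin_cases i
  · have := hY.eq x 0
    simp only [volterraOp, pairPhase, pairInit, pairMatrix, Fin.sum_univ_two, Matrix.cons_val_zero,
      Matrix.cons_val_one, Complex.ofReal_zero, mul_zero, zero_mul, Complex.exp_zero,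
      one_mul] at this
    simp only [hX, volterraOp, laxPhase, laxInit, laxMatrix, Fin.sum_univ_three, Fin.zero_eta,
      Matrix.cons_val, Complex.ofReal_zero, mul_zero, zero_mul, Complex.exp_zero, one_mul]
    rw [this]
    congr 2 with y
    rw [hθ2]
    -- Inserting `β`, the terms `(i/2)|u|²α` cancel and `-(i/2) u θ w - u w` equals `z u w`.
    linear_combination (z + 1) * (u y) * (Y y 1) * I2
  -- All occurrences of `θ` other than `θ β` are eliminated through `θ w = β + ū α`, and the terms
  -- `|u|²β` cancel. Duhamel's formula then recovers the integral equation from the decay of `β` at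
  -- `-∞`.
  · have ep : IsPrim (fun x => X x 1) (fun x => theta z * X x 1 +
        ∑ j, laxMatrix u d 1 j x * X x j) := by
      refine e3.congr_deriv fun x => ?_
      simp only [hX, laxMatrix, Fin.sum_univ_three, Matrix.cons_val, gcoef]
      rw [hθ2]
      linear_combination (-(z + 1) * (u x) * (starRingEnd ℂ) (u x) * (Y x 1)) * I2
    have t0 : Filter.Tendsto (fun x => X x 1) Filter.atBot (nhds 0) := by
      have t3 : Filter.Tendsto (fun x => (starRingEnd ℂ) (u x)) Filter.atBot (nhds 0) := by
        have := (Complex.continuous_conj.tendsto 0).comp h.tendsto_atBot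
        rwa [map_zero] at this
      simpa [hX] using (t2.const_mul (theta z)).sub (t3.mul t1)
    have := ep.eq_integral_exp_mul hθ (hint 1) t0 x
    simpa [volterraOp, laxPhase, laxInit] using this
  · have := hY.eq x 1
    simp only [volterraOp, pairPhase, pairInit, pairMatrix, Fin.sum_univ_two, Matrix.cons_val_zero,
      Matrix.cons_val_one, Complex.ofReal_one, mul_one, zero_add] at this
    simp only [hX, volterraOp, laxPhase, laxInit, laxMatrix, Fin.sum_univ_three, Fin.reduceFinMk,
      Matrix.cons_val, Complex.ofReal_one, mul_one, zero_add, zero_mul, add_zero]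
    rw [this]

/-- Picard iteration solves the pair system, and `IsPot.laxSol_eq` recognizes its solution as the
outer components of the triple. -/
lemma IsPot.isVolterraSol_pair (h : IsPot u d K) (hz : z.im = 0) :
    IsVolterraSol pairPhase (pairMatrix u z 1) pairInit (theta z)
      (fun x => ![laxSol u d z x 0, laxSol u d z x 2]) := by
  have hY := isVolterraSol_volterraSol (e := pairInit) (h.integrableMatrix_pairMatrix z 1)
    (theta_re_zero hz).le pairPhase_nonneg
  refine (congrArg _ (funext fun x => ?_)).mp hY
  have := congrFun (h.laxSol_eq hz hY) x
  rw [this]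
  ext i
  fin_cases i <;> simp

/-- This relation lets a growing factor `θ` in front of `w` be exchanged for bounded quantities. -/
lemma IsPot.laxSol_one (h : IsPot u d K) (hz : z.im = 0) (x : ℝ) :
    laxSol u d z x 1 = theta z * laxSol u d z x 2 - (starRingEnd ℂ) (u x) * laxSol u d z x 0 := by
  have := congrFun (h.laxSol_eq hz (h.isVolterraSol_pair hz)) x
  have := congrFun this 1
  simpa using this

lemma IsPot.isPrim_laxSol_zero (h : IsPot u d K) (hz : z.im = 0) :
    IsPrim (fun x => laxSol u d z x 0) (fun x =>
      Complex.I / 2 * (u x * (starRingEnd ℂ) (u x)) * laxSol u d z x 0 +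
        z * u x * laxSol u d z x 2) := by
  have := (h.isVolterraSol_pair hz).isPrim (h.integrableMatrix_pairMatrix z 1)
    (theta_re_zero hz).le pairPhase_nonneg 0
  simpa [pairMatrix, pairPhase, Fin.sum_univ_two] using this

lemma IsPot.isPrim_laxSol_two (h : IsPot u d K) (hz : z.im = 0) :
    IsPrim (fun x => laxSol u d z x 2) (fun x => theta z * laxSol u d z x 2 +
      (-(starRingEnd ℂ) (u x) * laxSol u d z x 0 -
        Complex.I / 2 * (u x * (starRingEnd ℂ) (u x)) * laxSol u d z x 2)) := by
  have := (h.isVolterraSol_pair hz).isPrim (h.integrableMatrix_pairMatrix z 1)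
    (theta_re_zero hz).le pairPhase_nonneg 1
  refine this.congr_deriv fun x => ?_
  simp [pairMatrix, pairPhase, pairInit, Fin.sum_univ_two]
  ring

end Reduction

end NLSGI

namespace NLSGI

/-! ### Jost functions in terms of the triple, and the scattering relation. -/

noncomputable section Jost

variable {u d : ℝ → ℂ} {K : ℝ} {k z : ℂ} {φ : ℝ → ℂ × ℂ}

lemma isJost₁_intMinus_iff_isVolterraSol :
    IsJost₁ intMinus u k φ ↔ IsVolterraSol pairPhase (pairMatrix u k k) pairInit (theta (k ^ 2))
      (fun x => ![(φ x).1, (φ x).2]) := by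
  have e1 : ∀ x, volterraOp pairPhase (pairMatrix u k k) (theta (k ^ 2))
      (fun x => ![(φ x).1, (φ x).2]) x 0 = intMinus (fun y => Qfst u k y (φ y)) x := fun x => by
    simp only [volterraOp, pairPhase, pairMatrix, Fin.sum_univ_two, Matrix.cons_val_zero,
      Matrix.cons_val_one, Complex.ofReal_zero, mul_zero, zero_mul, Complex.exp_zero, one_mul,
      Complex.mul_conj']
    rfl
  have e2 : ∀ x, volterraOp pairPhase (pairMatrix u k k) (theta (k ^ 2))
      (fun x => ![(φ x).1, (φ x).2]) x 1 = intMinus (fun y =>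
        Complex.exp (2 * Complex.I * (k ^ 2 + 1) * (x - y)) * Qsnd u k y (φ y)) x := fun x => by
    simp only [volterraOp, pairPhase, pairMatrix, Fin.sum_univ_two, Matrix.cons_val_zero,
      Matrix.cons_val_one, Complex.ofReal_one, mul_one, Complex.mul_conj', theta, intMinus, Qsnd]
    congr 1 with y
    ring_nf
  have hnorm : ∀ x, ‖(![(φ x).1, (φ x).2] : Fin 2 → ℂ)‖ = ‖φ x‖ := fun x => by
    refine le_antisymm ((pi_norm_le_iff_of_nonneg (norm_nonneg _)).2 fun i => ?_) ?_
    · fin_cases i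
      · exact norm_fst_le (φ x)
      · exact norm_snd_le (φ x)
    · rw [Prod.norm_def]
      exact max_le (norm_le_pi_norm (![(φ x).1, (φ x).2] : Fin 2 → ℂ) 0)
        (norm_le_pi_norm (![(φ x).1, (φ x).2] : Fin 2 → ℂ) 1)
  constructor
  · rintro ⟨h1, ⟨M, h2⟩, h3, h4⟩
    refine ⟨?_, ⟨M, fun x => (hnorm x).trans_le (h2 x)⟩, fun x i => ?_⟩
    · refine continuous_pi fun i => ?_
      fin_cases i
      · exact h1.fst
      · exact h1.snd
    · fin_cases i
      · exact (h3 x).trans (congrArg _ (e1 x).symm)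
      · refine (h4 x).trans ((e2 x).symm.trans (zero_add _).symm)
  · rintro ⟨h1, ⟨M, h2⟩, h3⟩
    refine ⟨?_, ⟨M, fun x => (hnorm x).symm.trans_le (h2 x)⟩, fun x => ?_, fun x => ?_⟩
    · exact (((continuous_apply 0).comp h1).prodMk ((continuous_apply 1).comp h1))
    · exact (h3 x 0).trans (congrArg _ (e1 x))
    · exact (h3 x 1).trans ((zero_add _).trans (e2 x))

lemma theta_conj (hz : z.im = 0) : (starRingEnd ℂ) (theta z) = -theta z := by
  have : (starRingEnd ℂ) z = z := Complex.conj_eq_iff_im.2 hz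
  simp [theta, this, map_ofNat]

/-- The Jost function normalized at `-∞`. -/
lemma IsPot.isJost₁_intMinus_iff (h : IsPot u d K) (hk : (k ^ 2).im = 0) :
    IsJost₁ intMinus u k φ ↔
      φ = fun x => (laxSol u d (k ^ 2) x 0, k * laxSol u d (k ^ 2) x 2) := by
  have hM := h.integrableMatrix_pairMatrix k k
  have hθ := (theta_re_zero hk).le
  have hp := h.isVolterraSol_pair hk
  have hs : IsJost₁ intMinus u k fun x => (laxSol u d (k ^ 2) x 0, k * laxSol u d (k ^ 2) x 2) := by
    obtain ⟨h1, ⟨M, h2⟩, h3⟩ := hp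
    have c0 : Continuous fun x => laxSol u d (k ^ 2) x 0 := continuous_pi_iff.1 h1 0
    have c1 : Continuous fun x => laxSol u d (k ^ 2) x 2 := continuous_pi_iff.1 h1 1
    have hM0 := (norm_nonneg _).trans (h2 0)
    have b0 : ∀ x, ‖laxSol u d (k ^ 2) x 0‖ ≤ M := fun x =>
      (norm_le_pi_norm (![laxSol u d (k ^ 2) x 0, laxSol u d (k ^ 2) x 2] : Fin 2 → ℂ) 0).trans (h2 x)
    have b1 : ∀ x, ‖laxSol u d (k ^ 2) x 2‖ ≤ M := fun x =>
      (norm_le_pi_norm (![laxSol u d (k ^ 2) x 0, laxSol u d (k ^ 2) x 2] : Fin 2 → ℂ) 1).trans (h2 x)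
    refine isJost₁_intMinus_iff_isVolterraSol.2 ⟨?_, ⟨M + ‖k‖ * M, fun x => ?_⟩, fun x i => ?_⟩
    · refine continuous_pi fun i => ?_
      fin_cases i
      · exact c0
      · exact c1.const_mul k
    · refine (pi_norm_le_iff_of_nonneg (by positivity)).2 fun i => ?_
      fin_cases i
      · exact (b0 x).trans (le_add_of_nonneg_right (by positivity))
      · refine le_trans ?_ (le_add_of_nonneg_left hM0)
        refine (norm_mul _ _).trans_le ?_
        gcongr
        exact b1 x
    · fin_cases i
      · refine (h3 x 0).trans (congrArg (pairInit 0 + ·) ?_)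
        unfold volterraOp
        congr 1 with y
        simp [pairMatrix, Fin.sum_univ_two]
        ring_nf
      · have := h3 x 1
        simp only [pairInit, Matrix.cons_val_one, Matrix.cons_val_zero, zero_add] at this
        refine (congrArg (k * ·) this).trans (Eq.trans ?_ (zero_add _).symm)
        unfold volterraOp
        simp only
        rw [← integral_const_mul]
        congr 1 with y
        simp [pairMatrix, Fin.sum_univ_two]
        ring
  refine ⟨fun hφ => ?_, fun hφ => hφ ▸ hs⟩
  have := IsVolterraSol.unique hM hθ pairPhase_nonneg
    (isJost₁_intMinus_iff_isVolterraSol.1 hφ) (isJost₁_intMinus_iff_isVolterraSol.1 hs)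
  ext x : 1
  exact Prod.ext (congrFun (congrFun this x) 0) (congrFun (congrFun this x) 1)

lemma intPlus_eq (f : ℝ → ℂ) (x : ℝ) : intPlus f x = -intMinus (fun y => f (-y)) (-x) := by
  rw [intPlus, intMinus, integral_comp_neg_Iic, neg_neg]

lemma intMinus_neg (f : ℝ → ℂ) (x : ℝ) : intMinus (fun y => -f y) x = -intMinus f x :=
  integral_neg _

lemma intMinus_conj (f : ℝ → ℂ) (x : ℝ) :
    intMinus (fun y => (starRingEnd ℂ) (f y)) x = (starRingEnd ℂ) (intMinus f x) := integral_conj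

lemma norm_reflection (u : ℝ → ℂ) (x : ℝ) : ‖reflection u x‖ = ‖u (-x)‖ := by simp [reflection]

lemma forall_neg_iff {p : ℝ → Prop} : (∀ x, p x) ↔ ∀ x, p (-x) :=
  ⟨fun h x => h _, fun h x => by simpa using h (-x)⟩

/-- Reflection in `x` exchanges the ends of the line but reverses the phase; conjugation reverses it
back. It also replaces `k` by its conjugate, which has the same square when `k²` is real. -/
lemma isJost₁_intPlus_iff_intMinus :
    IsJost₁ intPlus u k φ ↔ IsJost₁ intMinus (reflection u) ((starRingEnd ℂ) k)
      (fun x => ((starRingEnd ℂ) (φ (-x)).1, (starRingEnd ℂ) (φ (-x)).2)) := by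
  set ψ : ℝ → ℂ × ℂ := fun x => ((starRingEnd ℂ) (φ (-x)).1, (starRingEnd ℂ) (φ (-x)).2) with hψ
  have hφ : φ = fun x => ((starRingEnd ℂ) (ψ (-x)).1, (starRingEnd ℂ) (ψ (-x)).2) := by
    ext x <;> simp [hψ]
  have hcc : Continuous (starRingEnd ℂ) := Complex.continuous_conj
  have c : Continuous φ ↔ Continuous ψ := by
    constructor <;> intro h
    · exact ((hcc.comp (h.comp continuous_neg).fst).prodMk (hcc.comp (h.comp continuous_neg).snd))
    · rw [hφ]
      exact ((hcc.comp (h.comp continuous_neg).fst).prodMk (hcc.comp (h.comp continuous_neg).snd))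
  have b : (∃ M : ℝ, ∀ x, ‖φ x‖ ≤ M) ↔ ∃ M : ℝ, ∀ x, ‖ψ x‖ ≤ M := by
    refine exists_congr fun M => forall_neg_iff.trans (forall_congr' fun x => ?_)
    simp [hψ, Prod.norm_def]
  have hinj : Function.Injective (starRingEnd ℂ) := (starRingEnd ℂ).injective
  have e1 : (∀ x, (φ x).1 = 1 + intPlus (fun y => Qfst u k y (φ y)) x) ↔
      ∀ x, (ψ x).1 = 1 + intMinus (fun y => Qfst (reflection u) ((starRingEnd ℂ) k) y (ψ y)) x := by
    refine forall_neg_iff.trans (forall_congr' fun x => ?_)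
    rw [← hinj.eq_iff, intPlus_eq, neg_neg, map_add, map_neg, ← intMinus_conj, ← intMinus_neg,
      map_one]
    refine Iff.of_eq (congrArg₂ _ rfl (congrArg (1 + ·) (congrArg (intMinus · x) ?_)))
    ext y
    simp only [Qfst, norm_reflection]
    simp [hψ, reflection, map_ofNat]
    ring
  have e2 : (∀ x, (φ x).2 = intPlus (fun y =>
        Complex.exp (2 * Complex.I * (k ^ 2 + 1) * (x - y)) * Qsnd u k y (φ y)) x) ↔
      ∀ x, (ψ x).2 = intMinus (fun y =>
        Complex.exp (2 * Complex.I * (((starRingEnd ℂ) k) ^ 2 + 1) * (x - y)) *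
          Qsnd (reflection u) ((starRingEnd ℂ) k) y (ψ y)) x := by
    refine forall_neg_iff.trans (forall_congr' fun x => ?_)
    rw [← hinj.eq_iff, intPlus_eq, neg_neg, map_neg, ← intMinus_conj, ← intMinus_neg]
    refine Iff.of_eq (congrArg₂ _ rfl (congrArg (intMinus · x) ?_))
    ext y
    simp only [Qsnd, norm_reflection]
    simp [hψ, reflection, ← Complex.exp_conj, map_ofNat]
    rw [← mul_neg]
    congr 1
    · congr 1; ring
    · ring
  exact ⟨fun h => ⟨c.1 h.1, b.1 h.2, e1.1 h.3, e2.1 h.4⟩,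
    fun h => ⟨c.2 h.1, b.2 h.2, e1.2 h.3, e2.2 h.4⟩⟩

/-- The kernel of `ϕ₊` already has the opposite phase, so reflection needs no conjugation here.
Exchanging the components with one sign restores the form of `Q`. -/
lemma isJost₂_intPlus_iff_intMinus :
    IsJost₂ intPlus u k φ ↔ IsJost₁ intMinus (reflection u) k (fun x => ((φ (-x)).2, -(φ (-x)).1)) := by
  set ψ : ℝ → ℂ × ℂ := fun x => ((φ (-x)).2, -(φ (-x)).1) with hψ
  have hφ : φ = fun x => (-(ψ (-x)).2, (ψ (-x)).1) := by
    ext x <;> simp [hψ]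
  have c : Continuous φ ↔ Continuous ψ := by
    constructor <;> intro h
    · exact ((h.comp continuous_neg).snd.prodMk (h.comp continuous_neg).fst.neg)
    · rw [hφ]
      exact ((h.comp continuous_neg).snd.neg.prodMk (h.comp continuous_neg).fst)
  have b : (∃ M : ℝ, ∀ x, ‖φ x‖ ≤ M) ↔ ∃ M : ℝ, ∀ x, ‖ψ x‖ ≤ M := by
    refine exists_congr fun M => forall_neg_iff.trans (forall_congr' fun x => ?_)
    simp [hψ, Prod.norm_def, and_comm]
  have e1 : (∀ x, (φ x).2 = 1 + intPlus (fun y => Qsnd u k y (φ y)) x) ↔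
      ∀ x, (ψ x).1 = 1 + intMinus (fun y => Qfst (reflection u) k y (ψ y)) x := by
    refine forall_neg_iff.trans (forall_congr' fun x => ?_)
    rw [intPlus_eq, neg_neg, ← intMinus_neg]
    refine Iff.of_eq (congrArg₂ _ rfl (congrArg (1 + ·) (congrArg (intMinus · x) ?_)))
    ext y
    simp only [Qfst, Qsnd, norm_reflection]
    simp [hψ, reflection]
  have e2 : (∀ x, (φ x).1 = intPlus (fun y =>
        Complex.exp (-2 * Complex.I * (k ^ 2 + 1) * (x - y)) * Qfst u k y (φ y)) x) ↔
      ∀ x, (ψ x).2 = intMinus (fun y =>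
        Complex.exp (2 * Complex.I * (k ^ 2 + 1) * (x - y)) * Qsnd (reflection u) k y (ψ y)) x := by
    refine forall_neg_iff.trans (forall_congr' fun x => ?_)
    rw [intPlus_eq, neg_neg, ← neg_inj, neg_neg]
    refine Iff.of_eq (congrArg₂ _ rfl (congrArg (intMinus · x) ?_))
    ext y
    simp only [Qfst, Qsnd, norm_reflection]
    simp [hψ, reflection]
    congr 1
    · congr 1; ring
    · ring
  exact ⟨fun h => ⟨c.1 h.1, b.1 h.2, e1.1 h.4, e2.1 h.3⟩,
    fun h => ⟨c.2 h.1, b.2 h.2, e2.2 h.4, e1.2 h.3⟩⟩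

/-- The Jost function `φ₊`, in terms of the reflected potential. -/
lemma IsPot.isJost₁_intPlus_iff (h : IsPot u d K) (hk : (k ^ 2).im = 0) :
    IsJost₁ intPlus u k φ ↔ φ = fun x =>
      ((starRingEnd ℂ) (laxSol (reflection u) (reflectDeriv d) (k ^ 2) (-x) 0),
        k * (starRingEnd ℂ) (laxSol (reflection u) (reflectDeriv d) (k ^ 2) (-x) 2)) := by
  have hk' : (starRingEnd ℂ) k ^ 2 = k ^ 2 := by
    rw [← map_pow]; exact Complex.conj_eq_iff_im.2 hk
  rw [isJost₁_intPlus_iff_intMinus, h.reflect.isJost₁_intMinus_iff (by rwa [hk']), hk']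
  constructor <;> intro hφ
  · ext x
    · have := congrArg Prod.fst (congrFun hφ (-x))
      simpa using congrArg (starRingEnd ℂ) this
    · have := congrArg Prod.snd (congrFun hφ (-x))
      simpa using congrArg (starRingEnd ℂ) this
  · rw [hφ]
    ext x <;> simp

/-- The Jost function `ϕ₊`, in terms of the reflected potential. -/
lemma IsPot.isJost₂_intPlus_iff (h : IsPot u d K) (hk : (k ^ 2).im = 0) :
    IsJost₂ intPlus u k φ ↔ φ = fun x =>
      (-(k * laxSol (reflection u) (reflectDeriv d) (k ^ 2) (-x) 2),
        laxSol (reflection u) (reflectDeriv d) (k ^ 2) (-x) 0) := by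
  rw [isJost₂_intPlus_iff_intMinus, h.reflect.isJost₁_intMinus_iff hk]
  constructor <;> intro hφ
  · ext x
    · have := congrArg Prod.snd (congrFun hφ (-x))
      simp only [neg_neg] at this
      rw [← this, neg_neg]
    · have := congrArg Prod.fst (congrFun hφ (-x))
      simpa using this
  · rw [hφ]
    ext x <;> simp

lemma epsilon_eq_of_iff {α : Type*} [Nonempty α] {p : α → Prop} {c : α} (h : ∀ x, p x ↔ x = c) :
    Classical.epsilon p = c := (h _).1 (Classical.epsilon_spec ⟨c, (h c).2 rfl⟩)

lemma IsPot.jost₁Minus_eq (h : IsPot u d K) (hk : (k ^ 2).im = 0) :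
    jost₁Minus u k = fun x => (laxSol u d (k ^ 2) x 0, k * laxSol u d (k ^ 2) x 2) :=
  epsilon_eq_of_iff fun _ => h.isJost₁_intMinus_iff hk

lemma IsPot.jost₁Plus_eq (h : IsPot u d K) (hk : (k ^ 2).im = 0) :
    jost₁Plus u k = fun x =>
      ((starRingEnd ℂ) (laxSol (reflection u) (reflectDeriv d) (k ^ 2) (-x) 0),
        k * (starRingEnd ℂ) (laxSol (reflection u) (reflectDeriv d) (k ^ 2) (-x) 2)) :=
  epsilon_eq_of_iff fun _ => h.isJost₁_intPlus_iff hk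

lemma IsPot.jost₂Plus_eq (h : IsPot u d K) (hk : (k ^ 2).im = 0) :
    jost₂Plus u k = fun x => (-(k * laxSol (reflection u) (reflectDeriv d) (k ^ 2) (-x) 2),
        laxSol (reflection u) (reflectDeriv d) (k ^ 2) (-x) 0) :=
  epsilon_eq_of_iff fun _ => h.isJost₂_intPlus_iff hk

/-- The quotient `b(k) / k`, as a function of `z = k²`. -/
def betaCoef (u d : ℝ → ℂ) (z : ℂ) : ℂ :=
  (starRingEnd ℂ) (laxSol (reflection u) (reflectDeriv d) z 0 0) * laxSol u d z 0 2 -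
    (starRingEnd ℂ) (laxSol (reflection u) (reflectDeriv d) z 0 2) * laxSol u d z 0 0

lemma IsPot.a_eq (h : IsPot u d K) (hk : (k ^ 2).im = 0) :
    a u k = laxSol u d (k ^ 2) 0 0 * laxSol (reflection u) (reflectDeriv d) (k ^ 2) 0 0 +
      k ^ 2 * laxSol u d (k ^ 2) 0 2 * laxSol (reflection u) (reflectDeriv d) (k ^ 2) 0 2 := by
  rw [a, h.jost₁Minus_eq hk, h.jost₂Plus_eq hk, det₂]
  simp only [neg_zero]
  ring

lemma IsPot.b_eq (h : IsPot u d K) (hk : (k ^ 2).im = 0) : b u k = k * betaCoef u d (k ^ 2) := by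
  rw [b, h.jost₁Minus_eq hk, h.jost₁Plus_eq hk, det₂, betaCoef]
  simp only [neg_zero]
  ring

lemma IsPot.isPrim_plus_zero (h : IsPot u d K) (hz : z.im = 0) :
    IsPrim (fun x => (starRingEnd ℂ) (laxSol (reflection u) (reflectDeriv d) z (-x) 0)) (fun x =>
      Complex.I / 2 * (u x * (starRingEnd ℂ) (u x)) *
        (starRingEnd ℂ) (laxSol (reflection u) (reflectDeriv d) z (-x) 0) +
        z * u x * (starRingEnd ℂ) (laxSol (reflection u) (reflectDeriv d) z (-x) 2)) := by
  have hz' : (starRingEnd ℂ) z = z := Complex.conj_eq_iff_im.2 hz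
  refine (h.reflect.isPrim_laxSol_zero hz).comp_neg.conj.congr_deriv fun x => ?_
  simp [reflection, hz', map_ofNat]
  ring

lemma IsPot.isPrim_plus_two (h : IsPot u d K) (hz : z.im = 0) :
    IsPrim (fun x => (starRingEnd ℂ) (laxSol (reflection u) (reflectDeriv d) z (-x) 2)) (fun x =>
      theta z * (starRingEnd ℂ) (laxSol (reflection u) (reflectDeriv d) z (-x) 2) +
      (-(starRingEnd ℂ) (u x) * (starRingEnd ℂ) (laxSol (reflection u) (reflectDeriv d) z (-x) 0) -
        Complex.I / 2 * (u x * (starRingEnd ℂ) (u x)) *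
          (starRingEnd ℂ) (laxSol (reflection u) (reflectDeriv d) z (-x) 2))) := by
  refine (h.reflect.isPrim_laxSol_two hz).comp_neg.conj.congr_deriv fun x => ?_
  simp [reflection, theta_conj hz, map_ofNat]
  ring

lemma IsPot.tendsto_laxSol (h : IsPot u d K) (hz : z.im = 0) (i : Fin 3) :
    Filter.Tendsto (fun x => laxSol u d z x i) Filter.atBot (nhds (laxInit i)) :=
  (h.isVolterraSol_laxSol hz.ge).tendsto_atBot h.integrableMatrix (theta_re_zero hz).le
    laxPhase_nonneg i

/-- The scattering relation, with the factor `k` removed. -/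
lemma IsPot.scattering (h : IsPot u d K) (hz : z.im = 0) (x : ℝ) :
    let α := fun y => laxSol u d z y 0
    let w := fun y => laxSol u d z y 2
    let A := fun y => (starRingEnd ℂ) (laxSol (reflection u) (reflectDeriv d) z (-y) 0)
    let W := fun y => (starRingEnd ℂ) (laxSol (reflection u) (reflectDeriv d) z (-y) 2)
    let s := α 0 * (starRingEnd ℂ) (A 0) + z * w 0 * (starRingEnd ℂ) (W 0)
    let t := A 0 * w 0 - W 0 * α 0
    α x = s * A x - z * t * Complex.exp (theta z * x) * (starRingEnd ℂ) (W x) ∧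
    w x = s * W x + t * Complex.exp (theta z * x) * (starRingEnd ℂ) (A x) := by
  intro α w A W s t
  have hz' : (starRingEnd ℂ) z = z := Complex.conj_eq_iff_im.2 hz
  have hθ' := theta_conj hz
  have pα : IsPrim α _ := h.isPrim_laxSol_zero hz
  have pw : IsPrim w _ := h.isPrim_laxSol_two hz
  have pA : IsPrim A _ := h.isPrim_plus_zero hz
  have pW : IsPrim W _ := h.isPrim_plus_two hz
  -- This is `det[φ₊, ϕ₊]`. Its derivative vanishes for real `z`, and its limit at `+∞` is `1`.
  have hN : A x * (starRingEnd ℂ) (A x) + z * W x * (starRingEnd ℂ) (W x) = 1 := by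
    have p := (pA.mul pA.conj).add ((pW.const_mul z).mul pW.conj)
    have hc := fun y => p.eq_of_deriv_zero (fun y => by
      simp only [map_add, map_sub, map_mul, map_neg, hz', hθ', Complex.conj_conj, map_div₀,
        Complex.conj_I, map_ofNat, A, W]
      ring) x (-y)
    have l0 := h.reflect.tendsto_laxSol hz 0
    have l2 := h.reflect.tendsto_laxSol hz 2
    have hcc : ∀ c, Filter.Tendsto (starRingEnd ℂ) (nhds c) (nhds ((starRingEnd ℂ) c)) := fun c =>
      Complex.continuous_conj.tendsto c
    have l0' := (hcc _).comp l0
    have l2' := (hcc _).comp l2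
    have l := ((l0'.mul ((hcc _).comp l0'))).add ((l2'.const_mul z).mul ((hcc _).comp l2'))
    have e : (starRingEnd ℂ) (laxInit 0) * (starRingEnd ℂ) ((starRingEnd ℂ) (laxInit 0)) +
        z * (starRingEnd ℂ) (laxInit 2) * (starRingEnd ℂ) ((starRingEnd ℂ) (laxInit 2)) = 1 := by
      simp [laxInit]
    rw [e] at l
    refine tendsto_nhds_unique (tendsto_const_nhds.congr fun y => hc y) (l.congr fun y => ?_)
    simp [A, W]
  -- This is `det[φ₋, ϕ₊]`, constant in `x` and equal to `a` at `0`.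
  have hs : α x * (starRingEnd ℂ) (A x) + z * w x * (starRingEnd ℂ) (W x) = s := by
    have p := (pα.mul pA.conj).add ((pw.const_mul z).mul pW.conj)
    exact p.eq_of_deriv_zero (fun y => by
      simp only [map_add, map_sub, map_mul, map_neg, hz', hθ', Complex.conj_conj, map_div₀,
        Complex.conj_I, map_ofNat, α, w, A, W]
      ring) x 0
  -- This is `det[φ₊, φ₋]` with a factor `k` removed. It solves a scalar equation with exponent `θ`.
  have ht : A x * w x - W x * α x = t * Complex.exp (theta z * x) := by
    have p := (IsPrim.exp (-theta z)).mul ((pA.mul pw).sub (pW.mul pα))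
    have h0 := p.eq_of_deriv_zero (fun y => by
      simp only [α, w, A, W]
      ring) x 0
    have e0 : Complex.exp (theta z * x) * Complex.exp (-theta z * x) = 1 := by
      rw [← Complex.exp_add]; simp
    simp only [Complex.ofReal_zero, mul_zero, Complex.exp_zero, one_mul] at h0
    rw [show t = A 0 * w 0 - W 0 * α 0 from rfl, ← h0, mul_right_comm, mul_comm (Complex.exp _)
      (Complex.exp _), e0, one_mul]
  -- Cramer's rule with the three determinants above.
  refine ⟨?_, ?_⟩
  · linear_combination (-(α x)) * hN + A x * hs - z * (starRingEnd ℂ) (W x) * ht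
  · linear_combination (-(w x)) * hN + W x * hs + (starRingEnd ℂ) (A x) * ht

theorem IsPot.scatteringWellDefined (h : IsPot u d K) (hk : (k ^ 2).im = 0) :
    ScatteringWellDefined u k := by
  refine ⟨⟨_, (h.isJost₁_intMinus_iff hk).2 rfl, fun _ => (h.isJost₁_intMinus_iff hk).1⟩,
    ⟨_, (h.isJost₁_intPlus_iff hk).2 rfl, fun _ => (h.isJost₁_intPlus_iff hk).1⟩,
    ⟨_, (h.isJost₂_intPlus_iff hk).2 rfl, fun _ => (h.isJost₂_intPlus_iff hk).1⟩, fun x => ?_⟩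
  have := h.scattering hk x
  simp only [neg_zero, Complex.conj_conj] at this
  obtain ⟨h1, h2⟩ := this
  have hθ : 2 * Complex.I * (k ^ 2 + 1) = theta (k ^ 2) := rfl
  rw [h.a_eq hk, h.b_eq hk, h.jost₁Minus_eq hk, h.jost₁Plus_eq hk, h.jost₂Plus_eq hk, hθ, betaCoef]
  ext
  · simp only [Prod.fst_add, Prod.smul_fst, smul_eq_mul]
    rw [h1]; ring
  · simp only [Prod.snd_add, Prod.smul_snd, smul_eq_mul]
    rw [h2]; ring

end Jost

/-! ### Independence of the representative of the potential. -/

noncomputable section Congr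

variable {u v : ℝ → ℂ} {k : ℂ}

lemma intMinus_congr_ae {f g : ℝ → ℂ} (h : f =ᵐ[volume] g) : intMinus f = intMinus g :=
  funext fun _ => integral_congr_ae (ae_restrict_of_ae h)

lemma intPlus_congr_ae {f g : ℝ → ℂ} (h : f =ᵐ[volume] g) : intPlus f = intPlus g :=
  funext fun _ => congrArg Neg.neg (integral_congr_ae (ae_restrict_of_ae h))

lemma isJost₁_congr_ae (h : u =ᵐ[volume] v) {J : (ℝ → ℂ) → ℝ → ℂ}
    (hJ : ∀ f g : ℝ → ℂ, f =ᵐ[volume] g → J f = J g) : IsJost₁ J u k = IsJost₁ J v k := by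
  ext φ
  have h1 : J (fun y => Qfst u k y (φ y)) = J (fun y => Qfst v k y (φ y)) :=
    hJ _ _ (h.mono fun y hy => by simp only [Qfst, hy])
  have h2 : ∀ x : ℝ, J (fun y =>
      Complex.exp (2 * Complex.I * (k ^ 2 + 1) * (x - y)) * Qsnd u k y (φ y)) = J (fun y =>
      Complex.exp (2 * Complex.I * (k ^ 2 + 1) * (x - y)) * Qsnd v k y (φ y)) := fun x =>
    hJ _ _ (h.mono fun y hy => by simp only [Qsnd, hy])
  exact ⟨fun H => ⟨H.1, H.2, h1 ▸ H.3, fun x => h2 x ▸ H.4 x⟩,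
    fun H => ⟨H.1, H.2, h1 ▸ H.3, fun x => h2 x ▸ H.4 x⟩⟩

lemma isJost₂_congr_ae (h : u =ᵐ[volume] v) {J : (ℝ → ℂ) → ℝ → ℂ}
    (hJ : ∀ f g : ℝ → ℂ, f =ᵐ[volume] g → J f = J g) : IsJost₂ J u k = IsJost₂ J v k := by
  ext φ
  have h1 : J (fun y => Qsnd u k y (φ y)) = J (fun y => Qsnd v k y (φ y)) :=
    hJ _ _ (h.mono fun y hy => by simp only [Qsnd, hy])
  have h2 : ∀ x : ℝ, J (fun y =>
      Complex.exp (-2 * Complex.I * (k ^ 2 + 1) * (x - y)) * Qfst u k y (φ y)) = J (fun y =>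
      Complex.exp (-2 * Complex.I * (k ^ 2 + 1) * (x - y)) * Qfst v k y (φ y)) := fun x =>
    hJ _ _ (h.mono fun y hy => by simp only [Qfst, hy])
  exact ⟨fun H => ⟨H.1, H.2, fun x => h2 x ▸ H.3 x, h1 ▸ H.4⟩,
    fun H => ⟨H.1, H.2, fun x => h2 x ▸ H.3 x, h1 ▸ H.4⟩⟩

lemma jost₁Minus_congr_ae (h : u =ᵐ[volume] v) : jost₁Minus u k = jost₁Minus v k := by
  rw [jost₁Minus, jost₁Minus, isJost₁_congr_ae h fun _ _ => intMinus_congr_ae]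

lemma jost₁Plus_congr_ae (h : u =ᵐ[volume] v) : jost₁Plus u k = jost₁Plus v k := by
  rw [jost₁Plus, jost₁Plus, isJost₁_congr_ae h fun _ _ => intPlus_congr_ae]

lemma jost₂Plus_congr_ae (h : u =ᵐ[volume] v) : jost₂Plus u k = jost₂Plus v k := by
  rw [jost₂Plus, jost₂Plus, isJost₂_congr_ae h fun _ _ => intPlus_congr_ae]

lemma a_congr_ae (h : u =ᵐ[volume] v) : a u = a v :=
  funext fun k => by rw [a, a, jost₁Minus_congr_ae h, jost₂Plus_congr_ae h]

lemma b_congr_ae (h : u =ᵐ[volume] v) : b u = b v :=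
  funext fun k => by rw [b, b, jost₁Minus_congr_ae h, jost₁Plus_congr_ae h]

lemma ScatteringWellDefined.congr_ae (h : u =ᵐ[volume] v) (hu : ScatteringWellDefined u k) :
    ScatteringWellDefined v k := by
  obtain ⟨h1, h2, h3, h4⟩ := hu
  refine ⟨?_, ?_, ?_, ?_⟩
  · rwa [← isJost₁_congr_ae h fun _ _ => intMinus_congr_ae]
  · rwa [← isJost₁_congr_ae h fun _ _ => intPlus_congr_ae]
  · rwa [← isJost₂_congr_ae h fun _ _ => intPlus_congr_ae]
  · rwa [← a_congr_ae h, ← b_congr_ae h, ← jost₁Minus_congr_ae h, ← jost₁Plus_congr_ae h,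
      ← jost₂Plus_congr_ae h]

end Congr

end NLSGI

namespace NLSGI

/-! ### Algebra of maps that are bounded and Lipschitz on bounded sets. -/

noncomputable section UniformBounds

variable {T T' : Type*} {R : ℝ → T → T → ℝ → Prop} {R' : ℝ → T' → T' → ℝ → Prop}
  {P P' Q : (ℝ → ℂ) → ℝ → Prop} {F G : T → ℝ → ℂ}

/-- The map `F` is bounded and Lipschitz continuous on bounded sets, where `R B s t δ` says that
`s` and `t` are of size at most `B` and at distance at most `δ`. -/
def UnifLip (R : ℝ → T → T → ℝ → Prop) (P : (ℝ → ℂ) → ℝ → Prop) (F : T → ℝ → ℂ) : Prop :=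
  ∀ B, ∃ K, 0 ≤ K ∧ ∀ s t δ, 0 < δ → R B s t δ → Pair P (F s) (F t) K δ

lemma UnifLip.add (hP : ∀ f g K L, P f K → P g L → P (fun x => f x + g x) (K + L))
    (hF : UnifLip R P F) (hG : UnifLip R P G) : UnifLip R P (fun s x => F s x + G s x) := by
  intro B
  obtain ⟨K, hK, h⟩ := hF B
  obtain ⟨L, hL, h'⟩ := hG B
  exact ⟨K + L, by positivity, fun s t δ hδ hR => (h s t δ hδ hR).add hP (h' s t δ hδ hR)⟩

lemma UnifLip.const_mul (hP : ∀ f K (c : ℂ), P f K → P (fun x => c * f x) (‖c‖ * K))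
    (hF : UnifLip R P F) (c : ℂ) : UnifLip R P (fun s x => c * F s x) := by
  intro B
  obtain ⟨K, hK, h⟩ := hF B
  exact ⟨‖c‖ * K, by positivity, fun s t δ hδ hR => (h s t δ hδ hR).const_mul hP c⟩

lemma UnifLip.conj (hP : ∀ f K, P f K → P (fun x => (starRingEnd ℂ) (f x)) K)
    (hF : UnifLip R P F) : UnifLip R P (fun s x => (starRingEnd ℂ) (F s x)) := by
  intro B
  obtain ⟨K, hK, h⟩ := hF B
  exact ⟨K, hK, fun s t δ hδ hR => (h s t δ hδ hR).conj hP⟩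

lemma UnifLip.mul (hm : ∀ f g K L, P f K → P' g L → Q (fun x => f x * g x) (2 * (K * L)))
    (ha : ∀ f g K L, Q f K → Q g L → Q (fun x => f x + g x) (K + L))
    (hmono : ∀ f K L, Q f K → K ≤ L → Q f L)
    (hF : UnifLip R P F) (hG : UnifLip R P' G) : UnifLip R Q (fun s x => F s x * G s x) := by
  intro B
  obtain ⟨K, hK, h⟩ := hF B
  obtain ⟨L, hL, h'⟩ := hG B
  exact ⟨4 * (K * L), by positivity, fun s t δ hδ hR =>
    Pair.mul hm ha hmono hK hL (h s t δ hδ hR) (h' s t δ hδ hR)⟩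

lemma UnifLip.comap (hF : UnifLip R P F) (π : T' → T)
    (hπ : ∀ B s t δ, R' B s t δ → R B (π s) (π t) δ) : UnifLip R' P (fun s => F (π s)) := by
  intro B
  obtain ⟨K, hK, h⟩ := hF B
  exact ⟨K, hK, fun s t δ hδ hR => h _ _ δ hδ (hπ _ _ _ _ hR)⟩

lemma UnifLip.imp (hPQ : ∀ f K, P f K → Q f K) (hF : UnifLip R P F) : UnifLip R Q F := by
  intro B
  obtain ⟨K, hK, h⟩ := hF B
  exact ⟨K, hK, fun s t δ hδ hR => ⟨hPQ _ _ (h s t δ hδ hR).1, hPQ _ _ (h s t δ hδ hR).2.1,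
    hPQ _ _ (h s t δ hδ hR).2.2⟩⟩

lemma UnifLip.congr (hF : UnifLip R P F) (h : ∀ B s t δ, R B s t δ → F s = G s ∧ F t = G t) :
    UnifLip R P G := by
  intro B
  obtain ⟨K, hK, h'⟩ := hF B
  refine ⟨K, hK, fun s t δ hδ hR => ?_⟩
  rw [← (h B s t δ hR).1, ← (h B s t δ hR).2]
  exact h' s t δ hδ hR

lemma UnifLip.congr_fun (hF : UnifLip R P F) (h : ∀ s x, F s x = G s x) : UnifLip R P G :=
  hF.congr fun _ s t _ _ => ⟨funext (h s), funext (h t)⟩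

/-- The function is constant and bounded by `K`. -/
def IsConstBound (f : ℝ → ℂ) (K : ℝ) : Prop := ∃ c : ℂ, (f = fun _ => c) ∧ ‖c‖ ≤ K

lemma IsConstBound.mul_h1 (f g : ℝ → ℂ) (K L : ℝ) (h : IsConstBound f K) (h' : IsH1Bound g L) :
    IsH1Bound (fun x => f x * g x) (2 * (K * L)) := by
  obtain ⟨c, rfl, hc⟩ := h
  have hL := h'.nonneg
  have hK := (norm_nonneg c).trans hc
  refine (h'.const_mul c).mono ?_
  nlinarith [mul_nonneg hK hL, mul_le_mul_of_nonneg_right hc hL]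

lemma IsConstBound.isSupBound (f : ℝ → ℂ) (K : ℝ) (h : IsConstBound f K) : IsSupBound f K := by
  obtain ⟨c, rfl, hc⟩ := h
  exact ⟨measurable_const, fun _ => hc⟩

lemma IsConstBound.conj (f : ℝ → ℂ) (K : ℝ) (h : IsConstBound f K) :
    IsConstBound (fun x => (starRingEnd ℂ) (f x)) K := by
  obtain ⟨c, rfl, hc⟩ := h
  exact ⟨(starRingEnd ℂ) c, rfl, by simpa using hc⟩

lemma IsH1Bound.isL2Bound (f : ℝ → ℂ) (K : ℝ) (h : IsH1Bound f K) : IsL2Bound f K :=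
  ⟨h.nonneg, h.continuous.measurable, h.l2⟩

lemma IsH1Bound.isSupBound (f : ℝ → ℂ) (K : ℝ) (h : IsH1Bound f K) : IsSupBound f K :=
  ⟨h.continuous.measurable, h.bounded⟩

end UniformBounds

/-! ### `H¹` bounds for the scattering data. -/

noncomputable section ScatteringBounds

/-- Pairs of potentials of size at most `B` and distance at most `δ`. -/
def PotRel (B : ℝ) (s t : (ℝ → ℂ) × (ℝ → ℂ)) (δ : ℝ) : Prop := IsPotPair s.1 s.2 t.1 t.2 B δ

variable {P : (ℝ → ℂ) → ℝ → Prop} {F : (ℝ → ℂ) × (ℝ → ℂ) → ℝ → ℂ}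

lemma UnifLip.reflect (hF : UnifLip PotRel P F) :
    UnifLip PotRel P (fun s => F (reflection s.1, reflectDeriv s.2)) :=
  hF.comap (R' := PotRel) (fun s : (ℝ → ℂ) × (ℝ → ℂ) => (reflection s.1, reflectDeriv s.2))
    fun _ _ _ _ h => IsPotPair.reflect h

lemma unifLip_laxSol (i : Fin 3) :
    UnifLip PotRel IsH1Bound (fun s (z : ℝ) => laxSol s.1 s.2 z 0 i - laxInit i) := by
  intro B
  obtain ⟨K, hK, h⟩ := exists_laxSol_bound B
  exact ⟨K, hK, fun s t δ hδ hR => (h _ _ _ _ δ hδ hR).1 i⟩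

lemma unifLip_apply_zero : UnifLip PotRel IsConstBound (fun s _ => s.1 0) := by
  intro B
  -- The absolute value keeps the constant nonnegative for negative `B`, where the relation is
  -- empty.
  refine ⟨4 * (|B| + 1), by positivity, fun s t δ hδ hR => ?_⟩
  have hB := hR.nonneg.1
  have := hR.sup
  rw [abs_of_nonneg hB]
  exact ⟨⟨_, rfl, this.1.2 0⟩, ⟨_, rfl, this.2.1.2 0⟩, ⟨_, rfl, this.2.2.2 0⟩⟩

/-- The coefficient `a`, in a form which makes sense for all `z` in the closed upper half-plane. -/
def aCoef (u d : ℝ → ℂ) (z : ℂ) : ℂ :=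
  laxSol u d z 0 0 * laxSol (reflection u) (reflectDeriv d) z 0 0 +
    ((2 * Complex.I)⁻¹ * (laxSol u d z 0 1 + (starRingEnd ℂ) (u 0) * laxSol u d z 0 0) -
      laxSol u d z 0 2) * laxSol (reflection u) (reflectDeriv d) z 0 2

variable {u d : ℝ → ℂ} {K : ℝ} {z : ℂ}

/-- Since `z = θ / (2i) - 1`, the growing product is rewritten by terms that also make sense, and
stay holomorphic, off the real axis. The continuation `aCoef` of `a` rests on this. -/
lemma IsPot.mul_laxSol_two (h : IsPot u d K) (hz : z.im = 0) : z * laxSol u d z 0 2 =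
    (2 * Complex.I)⁻¹ * (laxSol u d z 0 1 + (starRingEnd ℂ) (u 0) * laxSol u d z 0 0) -
      laxSol u d z 0 2 := by
  rw [h.laxSol_one hz]
  have hI := Complex.I_ne_zero
  unfold theta
  field_simp
  ring

lemma IsPot.aCoef_eq (h : IsPot u d K) {k : ℂ} (hk : (k ^ 2).im = 0) : aCoef u d (k ^ 2) = a u k := by
  rw [h.a_eq hk, aCoef, ← h.mul_laxSol_two hk]

/-- The product `2i(z + 1) b(k) / k`. -/
def sigmaCoef (u d : ℝ → ℂ) (z : ℂ) : ℂ :=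
  (starRingEnd ℂ) (laxSol (reflection u) (reflectDeriv d) z 0 0) * laxSol u d z 0 1 +
    (starRingEnd ℂ) (laxSol (reflection u) (reflectDeriv d) z 0 1) * laxSol u d z 0 0

/-- The terms with `u(0)` produced by the two middle components cancel, because the reflected
potential takes the value `-conj u(0)` at the origin. -/
lemma IsPot.theta_mul_betaCoef (h : IsPot u d K) (hz : z.im = 0) :
    theta z * betaCoef u d z = sigmaCoef u d z := by
  rw [sigmaCoef, h.laxSol_one hz, h.reflect.laxSol_one hz, betaCoef]
  simp only [map_sub, map_mul, theta_conj hz, Complex.conj_conj, reflection, neg_zero, map_neg]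
  ring

lemma IsPot.mul_betaCoef (h : IsPot u d K) (hz : z.im = 0) :
    z * betaCoef u d z = (2 * Complex.I)⁻¹ * sigmaCoef u d z - betaCoef u d z := by
  rw [← h.theta_mul_betaCoef hz]
  have hI := Complex.I_ne_zero
  unfold theta
  field_simp
  ring

lemma h1_add (f g : ℝ → ℂ) (K L : ℝ) (h : IsH1Bound f K) (h' : IsH1Bound g L) :
    IsH1Bound (fun x => f x + g x) (K + L) := h.add h'

lemma h1_const_mul (f : ℝ → ℂ) (K : ℝ) (c : ℂ) (h : IsH1Bound f K) :
    IsH1Bound (fun x => c * f x) (‖c‖ * K) := h.const_mul c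

lemma h1_conj (f : ℝ → ℂ) (K : ℝ) (h : IsH1Bound f K) :
    IsH1Bound (fun x => (starRingEnd ℂ) (f x)) K := h.conj

lemma h1_mul (f g : ℝ → ℂ) (K L : ℝ) (h : IsH1Bound f K) (h' : IsH1Bound g L) :
    IsH1Bound (fun x => f x * g x) (2 * (K * L)) := h.mul h'

lemma h1_mono (f : ℝ → ℂ) (K L : ℝ) (h : IsH1Bound f K) (hKL : K ≤ L) : IsH1Bound f L := h.mono hKL

variable {T : Type*} {R : ℝ → T → T → ℝ → Prop} {F G : T → ℝ → ℂ}

lemma UnifLip.h1_add (hF : UnifLip R IsH1Bound F) (hG : UnifLip R IsH1Bound G) :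
    UnifLip R IsH1Bound (fun s x => F s x + G s x) := UnifLip.add NLSGI.h1_add hF hG

lemma UnifLip.h1_mul (hF : UnifLip R IsH1Bound F) (hG : UnifLip R IsH1Bound G) :
    UnifLip R IsH1Bound (fun s x => F s x * G s x) :=
  UnifLip.mul NLSGI.h1_mul NLSGI.h1_add h1_mono hF hG

lemma UnifLip.h1_coef_mul (hF : UnifLip R IsConstBound F) (hG : UnifLip R IsH1Bound G) :
    UnifLip R IsH1Bound (fun s x => F s x * G s x) :=
  UnifLip.mul IsConstBound.mul_h1 NLSGI.h1_add h1_mono hF hG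

/-- Expanding both triples around `(1, 0, 0)` produces the constant `1` exactly once. Every other
term contains a factor in `H¹`, multiplied by bounded constants or by further such factors. -/
theorem unifLip_aCoef : UnifLip PotRel IsH1Bound (fun s (z : ℝ) => aCoef s.1 s.2 z - 1) := by
  have x0 := unifLip_laxSol 0
  have x1 := unifLip_laxSol 1
  have x2 := unifLip_laxSol 2
  have c := unifLip_apply_zero.conj IsConstBound.conj
  have y0 := x0.reflect
  have y2 := x2.reflect
  have t := (x1.h1_add (c.h1_coef_mul x0)).const_mul h1_const_mul (2 * Complex.I)⁻¹
  have t' := (c.h1_coef_mul y2).const_mul h1_const_mul (2 * Complex.I)⁻¹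
  refine ((((x0.h1_add y0).h1_add (x0.h1_mul y0)).h1_add
    ((t.h1_add (x2.const_mul h1_const_mul (-1))).h1_mul y2)).h1_add t').congr_fun fun s z => ?_
  simp [aCoef, laxInit]
  ring

theorem unifLip_betaCoef : UnifLip PotRel IsH1Bound (fun s (z : ℝ) => betaCoef s.1 s.2 z) := by
  have x0 := unifLip_laxSol 0
  have x2 := unifLip_laxSol 2
  have y0 := x0.reflect.conj h1_conj
  have y2 := x2.reflect.conj h1_conj
  refine (((y0.h1_mul x2).h1_add x2).h1_add
    (((y2.h1_mul x0).h1_add y2).const_mul h1_const_mul (-1))).congr_fun fun s z => ?_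
  simp [betaCoef, laxInit]
  ring

theorem unifLip_sigmaCoef : UnifLip PotRel IsH1Bound (fun s (z : ℝ) => sigmaCoef s.1 s.2 z) := by
  have x0 := unifLip_laxSol 0
  have x1 := unifLip_laxSol 1
  have y0 := x0.reflect.conj h1_conj
  have y1 := x1.reflect.conj h1_conj
  refine (((y0.h1_mul x1).h1_add x1).h1_add ((y1.h1_mul x0).h1_add y1)).congr_fun fun s z => ?_
  simp [sigmaCoef, laxInit]
  ring

/-- With `z = θ / (2i) - 1`, the function `k b(k)` is a combination of `sigmaCoef` and `betaCoef`.
-/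
theorem unifLip_mul_betaCoef :
    UnifLip PotRel IsH1Bound (fun s (z : ℝ) => z * betaCoef s.1 s.2 z) := by
  refine ((unifLip_sigmaCoef.const_mul h1_const_mul (2 * Complex.I)⁻¹).h1_add
    (unifLip_betaCoef.const_mul h1_const_mul (-1))).congr ?_
  have key : ∀ (s : (ℝ → ℂ) × (ℝ → ℂ)) (B : ℝ), IsPot s.1 s.2 B → ∀ z : ℝ,
      (2 * Complex.I)⁻¹ * sigmaCoef s.1 s.2 z + -1 * betaCoef s.1 s.2 z =
        z * betaCoef s.1 s.2 z := fun s B hs z => by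
    rw [hs.mul_betaCoef (Complex.ofReal_im z)]; ring
  exact fun _ s t _ hR => ⟨funext (key s _ hR.left), funext (key t _ hR.right)⟩

/-! ### Analytic continuation -/

lemma IsPot.continuousOn_laxSol (h : IsPot u d K) (x : ℝ) (i : Fin 3) :
    ContinuousOn (fun z => laxSol u d z x i) {z : ℂ | 0 ≤ z.im} := by
  rw [continuousOn_iff_continuous_domRestrict]
  have := continuous_volterraSol (P := {z : ℂ | 0 ≤ z.im}) (e := laxInit) h.integrableMatrix
    laxPhase_nonneg (continuous_theta.comp continuous_subtype_val) fun p => theta_re_nonpos p.2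
  exact (continuous_apply i).comp
    (this.comp (by fun_prop : Continuous fun p : {z : ℂ | 0 ≤ z.im} => (p, x)))

lemma IsPot.differentiableOn_laxSol (h : IsPot u d K) (x : ℝ) (i : Fin 3) :
    DifferentiableOn ℂ (fun z => laxSol u d z x i) {z : ℂ | 0 < z.im} := by
  refine (differentiableOn_volterraSol (e := laxInit) h.integrableMatrix laxPhase_nonneg x i).comp
    (t := {θ : ℂ | θ.re < 0}) (f := theta) ?_ fun z hz => ?_
  · unfold theta; fun_prop
  · have : 0 < z.im := hz
    change (theta z).re < 0
    rw [theta_re]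
    linarith

lemma IsPot.continuousOn_aCoef (h : IsPot u d K) : ContinuousOn (aCoef u d) {z : ℂ | 0 ≤ z.im} := by
  have x := h.continuousOn_laxSol 0
  have y := h.reflect.continuousOn_laxSol 0
  exact ((x 0).mul (y 0)).add
    (((continuousOn_const.mul ((x 1).add (continuousOn_const.mul (x 0)))).sub (x 2)).mul (y 2))

lemma IsPot.differentiableOn_aCoef (h : IsPot u d K) :
    DifferentiableOn ℂ (aCoef u d) {z : ℂ | 0 < z.im} := by
  have x := h.differentiableOn_laxSol 0
  have y := h.reflect.differentiableOn_laxSol 0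
  exact ((x 0).mul (y 0)).add
    ((((differentiableOn_const _).mul ((x 1).add ((differentiableOn_const _).mul (x 0)))).sub
      (x 2)).mul (y 2))

end ScatteringBounds

end NLSGI

namespace NLSGI

/-! ### `L²` bounds for limits of truncated oscillatory integrals. -/

noncomputable section OscillatoryLimits

lemma IsL2Bound.zero : IsL2Bound (fun _ => 0) 0 := ⟨le_rfl, measurable_const, by simp [normL2]⟩

lemma IsL2Bound.sum {J : Type*} (s : Finset J) {f : J → ℝ → ℂ} {L : J → ℝ}
    (h : ∀ i, IsL2Bound (f i) (L i)) : IsL2Bound (fun x => ∑ i ∈ s, f i x) (∑ i ∈ s, L i) := by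
  classical
  induction s using Finset.induction_on with
  | empty => simpa using IsL2Bound.zero
  | insert a s ha ih =>
    have := IsL2Bound.add _ _ _ _ (h a) ih
    refine (congrArg₂ IsL2Bound (funext fun x => ?_) ?_).mp this
    · rw [Finset.sum_insert ha]
    · rw [Finset.sum_insert ha]

lemma IsL2Bound.memLp {f : ℝ → ℂ} {K : ℝ} (h : IsL2Bound f K) : MemLp f 2 :=
  ⟨h.measurable.aestronglyMeasurable, h.le.trans_lt ENNReal.ofReal_lt_top⟩

lemma IsL2Bound.integrableOn_Icc {f : ℝ → ℂ} {K : ℝ} (h : IsL2Bound f K) (x y : ℝ) :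
    IntegrableOn f (Icc x y) := (h.memLp.restrict (Icc x y)).integrable one_le_two

/-- Fatou's lemma: a uniform `L²` bound survives pointwise convergence. -/
lemma IsL2Bound.of_tendsto {f : ℕ → ℝ → ℂ} {g : ℝ → ℂ} {K : ℝ} (h : ∀ n, IsL2Bound (f n) K)
    (hg : ∀ z, Filter.Tendsto (fun n => f n z) Filter.atTop (nhds (g z))) : IsL2Bound g K := by
  refine ⟨(h 0).nonneg, measurable_of_tendsto_metrizable (fun n => (h n).measurable)
    (tendsto_pi_nhds.2 hg), ?_⟩
  refine (Lp.eLpNorm_lim_le_liminf_eLpNorm (fun n => (h n).measurable.aestronglyMeasurable) g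
    (Filter.Eventually.of_forall hg)).trans ?_
  refine (Filter.liminf_le_liminf (Filter.Eventually.of_forall fun n => (h n).le)).trans ?_
  simp

lemma measurable_integral_exp_mul {F : ℝ → ℝ → ℂ} (hF : Measurable (Function.uncurry F)) (n : ℕ) :
    Measurable fun z : ℝ => ∫ y in Ioc (-(n : ℝ)) 0, Complex.exp (-theta z * y) * F z y := by
  refine (StronglyMeasurable.integral_prod_right (f := fun (z y : ℝ) =>
    Complex.exp (-theta z * y) * F z y) ?_).measurable
  refine (Measurable.mul ?_ hF).stronglyMeasurable
  have : Continuous fun p : ℝ × ℝ => Complex.exp (-theta p.1 * p.2) := by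
    unfold theta; fun_prop
  exact this.measurable

/-- A function in `L²` need not be integrable on a half-line. Truncation makes Plancherel
applicable, with a bound independent of `n`. -/
lemma isL2Bound_integral_exp_mul {s : ℝ → ℂ} {L : ℝ} (hs : IsL2Bound s L) (n : ℕ) :
    IsL2Bound (fun z : ℝ => ∫ y in Ioc (-(n : ℝ)) 0, Complex.exp (-theta z * y) * s y) (2 * L) := by
  have hL := hs.nonneg
  refine ⟨by positivity, measurable_integral_exp_mul (F := fun _ y => s y) (hs.measurable.comp measurable_snd) n, ?_⟩
  have hi : Integrable ((Ioc (-(n : ℝ)) 0).indicator s) :=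
    ((hs.integrableOn_Icc _ _).mono_set Ioc_subset_Icc_self).integrable_indicator measurableSet_Ioc
  have h2 := hs.memLp.indicator (measurableSet_Ioc (a := -(n : ℝ)) (b := 0))
  have h := l2norm_integral_exp_mul_le hi h2 0
  rw [normL2, eLpNorm_two_eq_l2norm]
  refine (le_of_eq ?_).trans (h.trans ?_)
  · congr 1 with z
    rw [← integral_indicator measurableSet_Ioc]
    congr 2 with y
    by_cases hy : y ∈ Ioc (-(n : ℝ)) 0
    · simp only [indicator_of_mem hy]
      congr 2
      simp [theta]
    · simp [indicator_of_notMem hy]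
  · rw [ENNReal.ofReal_mul (by norm_num), show ENNReal.ofReal 2 = 2 by norm_num]
    gcongr
    exact (eLpNorm_indicator_le _).trans hs.le

/-- By Minkowski the `L²` norm in `z` is at most the integral of `|c(y)| M / wt y`, which is finite
by Cauchy–Schwarz. The decay of `Y` thus makes up for `c` being in `L²` only. -/
lemma isL2Bound_integral_exp_mul_mul {c : ℝ → ℂ} {L M : ℝ} {Y : ℝ → ℝ → ℂ} (hc : IsL2Bound c L)
    (hY : Measurable (Function.uncurry Y)) (hM : 0 ≤ M)
    (h : ∀ y ≤ 0, l2norm volume (fun z => ‖Y z y‖ₑ) ≤ ENNReal.ofReal (M / wt y)) (n : ℕ) :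
    IsL2Bound (fun z : ℝ => ∫ y in Ioc (-(n : ℝ)) 0, Complex.exp (-theta z * y) * (c y * Y z y))
      (2 * (L * M)) := by
  have hL := hc.nonneg
  have hm : Measurable (Function.uncurry fun z y => c y * Y z y) :=
    (hc.measurable.comp measurable_snd).mul hY
  refine ⟨by positivity, measurable_integral_exp_mul hm n, ?_⟩
  rw [normL2, eLpNorm_two_eq_l2norm]
  have hexp : ∀ z y : ℝ, ‖Complex.exp (-theta z * y)‖ₑ = 1 := fun z y => by
    rw [← ofReal_norm, Complex.norm_exp]
    simp [theta_re]
  calc _ ≤ l2norm volume (fun z => ∫⁻ y in Ioc (-(n : ℝ)) 0, ‖c y * Y z y‖ₑ) := by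
        refine l2norm_mono fun z => (enorm_integral_le_lintegral_enorm _).trans (le_of_eq ?_)
        congr 1 with y
        rw [enorm_mul, hexp, one_mul]
    _ ≤ ∫⁻ y in Ioc (-(n : ℝ)) 0, l2norm volume (fun z => ‖c y * Y z y‖ₑ) :=
        l2norm_lintegral_le hm.enorm
    _ ≤ ∫⁻ y in Ioc (-(n : ℝ)) 0, ENNReal.ofReal M * (‖c y‖ₑ * ENNReal.ofReal (wt y)⁻¹) := by
        refine setLIntegral_mono' measurableSet_Ioc fun y hy => ?_
        have hYy : Measurable fun z => Y z y := hY.comp measurable_prodMk_right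
        simp_rw [enorm_mul]
        rw [l2norm_const_mul hYy.enorm.aemeasurable, mul_left_comm,
          ← ENNReal.ofReal_mul hM, ← div_eq_mul_inv]
        gcongr
        exact h y hy.2
    _ ≤ ENNReal.ofReal M * ∫⁻ y, ‖c y‖ₑ * ENNReal.ofReal (wt y)⁻¹ := by
        rw [lintegral_const_mul' _ _ ENNReal.ofReal_ne_top]
        exact mul_le_mul_right (setLIntegral_le_lintegral _ _) _
    _ ≤ ENNReal.ofReal M * ENNReal.ofReal (2 * L) := by
        gcongr
        exact hc.lintegral_mul_wt_inv_le
    _ = _ := by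
        rw [← ENNReal.ofReal_mul hM]
        congr 1; ring

/-- `L²` bound for a limit of truncated oscillatory integrals. -/
lemma isL2Bound_of_tendsto_integral {J : Type*} [Fintype J] {s f : ℝ → ℂ} {L₀ : ℝ}
    {c : J → ℝ → ℂ} {Y : J → ℝ → ℝ → ℂ} {L M : J → ℝ} (hs : IsL2Bound s L₀)
    (hc : ∀ j, IsL2Bound (c j) (L j)) (hY : ∀ j, Continuous (Function.uncurry (Y j)))
    (hM : ∀ j, 0 ≤ M j)
    (h : ∀ j, ∀ y ≤ 0, l2norm volume (fun z => ‖Y j z y‖ₑ) ≤ ENNReal.ofReal (M j / wt y))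
    (hf : ∀ z : ℝ, Filter.Tendsto (fun n : ℕ => ∫ y in Ioc (-(n : ℝ)) 0,
      Complex.exp (-theta z * y) * (s y + ∑ j, c j y * Y j z y)) Filter.atTop (nhds (f z))) :
    IsL2Bound f (2 * L₀ + ∑ j, 2 * (L j * M j)) := by
  refine IsL2Bound.of_tendsto (fun n => ?_) hf
  have h1 := isL2Bound_integral_exp_mul hs n
  have h2 := IsL2Bound.sum Finset.univ fun j =>
    isL2Bound_integral_exp_mul_mul (hc j) (hY j).measurable (hM j) (h j) n
  refine (congrArg (fun F => IsL2Bound F _) (funext fun z => ?_)).mp (IsL2Bound.add _ _ _ _ h1 h2)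
  have hexp : ContinuousOn (fun y : ℝ => Complex.exp (-theta z * y)) (Icc (-(n : ℝ)) 0) := by
    fun_prop
  have i1 : IntegrableOn (fun y : ℝ => Complex.exp (-theta z * y) * s y) (Ioc (-(n : ℝ)) 0) :=
    ((hs.integrableOn_Icc _ _).continuousOn_mul hexp isCompact_Icc).mono_set Ioc_subset_Icc_self
  have i2 : ∀ j, IntegrableOn (fun y : ℝ => Complex.exp (-theta z * y) * (c j y * Y j z y))
      (Ioc (-(n : ℝ)) 0) := fun j => by
    have hYz : ContinuousOn (Y j z) (Icc (-(n : ℝ)) 0) :=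
      ((hY j).comp (by fun_prop : Continuous fun y : ℝ => (z, y))).continuousOn
    exact ((((hc j).integrableOn_Icc _ _).mul_continuousOn hYz isCompact_Icc).continuousOn_mul hexp
      isCompact_Icc).mono_set Ioc_subset_Icc_self
  rw [← integral_finsetSum _ fun j _ => i2 j, ← integral_add i1 (integrable_finsetSum _ fun j _ => i2 j)]
  congr 1 with y
  rw [mul_add, Finset.mul_sum]

/-- A pair of limits of truncated oscillatory integrals. -/
lemma pair_of_tendsto_integral {J : Type*} [Fintype J] {s s' f f' : ℝ → ℂ} {L M δ : ℝ}
    {c c' : J → ℝ → ℂ} {Y Y' : J → ℝ → ℝ → ℂ} (hδ : 0 ≤ δ) (hL : 0 ≤ L) (hM : 0 ≤ M)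
    (hs : Pair IsL2Bound s s' L δ) (hc : ∀ j, Pair IsL2Bound (c j) (c' j) L δ)
    (hY : ∀ j, Continuous (Function.uncurry (Y j))) (hY' : ∀ j, Continuous (Function.uncurry (Y' j)))
    (h : ∀ j, ∀ y ≤ 0, l2norm volume (fun z => ‖Y j z y‖ₑ) ≤ ENNReal.ofReal (M / wt y))
    (h' : ∀ j, ∀ y ≤ 0, l2norm volume (fun z => ‖Y' j z y‖ₑ) ≤ ENNReal.ofReal (M / wt y))
    (hsub : ∀ j, ∀ y ≤ 0, l2norm volume (fun z => ‖Y j z y - Y' j z y‖ₑ) ≤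
      ENNReal.ofReal (M * δ / wt y))
    (hf : ∀ z : ℝ, Filter.Tendsto (fun n : ℕ => ∫ y in Ioc (-(n : ℝ)) 0,
      Complex.exp (-theta z * y) * (s y + ∑ j, c j y * Y j z y)) Filter.atTop (nhds (f z)))
    (hf' : ∀ z : ℝ, Filter.Tendsto (fun n : ℕ => ∫ y in Ioc (-(n : ℝ)) 0,
      Complex.exp (-theta z * y) * (s' y + ∑ j, c' j y * Y' j z y)) Filter.atTop (nhds (f' z))) :
    Pair IsL2Bound f f' (2 * L + Fintype.card J * (4 * (L * M))) δ := by
  have hLM : 0 ≤ L * M := mul_nonneg hL hM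
  refine ⟨IsL2Bound.mono _ _ _ (isL2Bound_of_tendsto_integral (L := fun _ => L) (M := fun _ => M)
      hs.1 (fun j => (hc j).1) hY (fun _ => hM) h hf) ?_,
    IsL2Bound.mono _ _ _ (isL2Bound_of_tendsto_integral (L := fun _ => L) (M := fun _ => M)
      hs.2.1 (fun j => (hc j).2.1) hY' (fun _ => hM) h' hf') ?_, ?_⟩
  · simp only [Finset.sum_const, Finset.card_univ, nsmul_eq_mul]
    gcongr
    linarith
  · simp only [Finset.sum_const, Finset.card_univ, nsmul_eq_mul]
    gcongr
    linarith
  -- The splitting `c Y - c' Y' = (c - c') Y + c' (Y - Y')` doubles the index set, and each half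
  -- carries one factor `δ`.
  · have := isL2Bound_of_tendsto_integral (J := J ⊕ J) (s := fun y => s y - s' y)
      (f := fun z => f z - f' z)
      (c := Sum.elim (fun j y => c j y - c' j y) c')
      (Y := Sum.elim Y (fun j z y => Y j z y - Y' j z y))
      (L := Sum.elim (fun _ => L * δ) (fun _ => L)) (M := Sum.elim (fun _ => M) (fun _ => M * δ))
      hs.2.2 ?_ ?_ ?_ ?_ ?_
    · refine IsL2Bound.mono _ _ _ this (le_of_eq ?_)
      simp only [Fintype.sum_sum_type, Sum.elim_inl, Sum.elim_inr, Finset.sum_const,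
        Finset.card_univ, nsmul_eq_mul]
      ring
    · rintro (j | j)
      · exact (hc j).2.2
      · exact (hc j).2.1
    · rintro (j | j)
      · exact hY j
      · exact (hY j).sub (hY' j)
    · rintro (j | j)
      · exact hM
      · exact mul_nonneg hM hδ
    · rintro (j | j)
      · exact h j
      · exact hsub j
    · intro z
      refine ((hf z).sub (hf' z)).congr fun n => ?_
      have hexp : ContinuousOn (fun y : ℝ => Complex.exp (-theta z * y)) (Icc (-(n : ℝ)) 0) := by
        fun_prop
      have key : ∀ (s : ℝ → ℂ) (c : J → ℝ → ℂ) (Y : J → ℝ → ℝ → ℂ) (K : ℝ) (K' : ℝ), IsL2Bound s K →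
          (∀ j, IsL2Bound (c j) K') → (∀ j, Continuous (Function.uncurry (Y j))) →
          IntegrableOn (fun y : ℝ => Complex.exp (-theta z * y) * (s y + ∑ j, c j y * Y j z y))
            (Ioc (-(n : ℝ)) 0) := fun s c Y K K' hs hc hY => by
        have i2 : ∀ j, IntegrableOn (fun y => c j y * Y j z y) (Icc (-(n : ℝ)) 0) := fun j =>
          ((hc j).integrableOn_Icc _ _).mul_continuousOn
            (((hY j).comp (by fun_prop : Continuous fun y : ℝ => (z, y))).continuousOn) isCompact_Icc
        exact (((hs.integrableOn_Icc _ _).add (integrable_finsetSum _ fun j _ => i2 j)).continuousOn_mul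
          hexp isCompact_Icc).mono_set Ioc_subset_Icc_self
      rw [← integral_sub (key s c Y L L hs.1 (fun j => (hc j).1) hY)
        (key s' c' Y' L L hs.2.1 (fun j => (hc j).2.1) hY')]
      congr 1 with y
      simp only [Fintype.sum_sum_type, Sum.elim_inl, Sum.elim_inr]
      rw [← Finset.sum_add_distrib, ← mul_sub, add_sub_add_comm, ← Finset.sum_sub_distrib]
      congr 2
      exact Finset.sum_congr rfl fun j _ => by ring

end OscillatoryLimits

end NLSGI

namespace NLSGI

/-! ### Potentials in `H² ∩ H^{1,1}`: the equation for `β'`. -/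

noncomputable section SecondOrder

variable {u d d2 v e e2 : ℝ → ℂ} {K B δ : ℝ} {z : ℂ}

/-- A potential `u` with `u' = d`, `d' = d2`, where `u`, `d` are of size `K` in `L^{2,1}` and
`d2` is of size `K` in `L²`. -/
structure IsPot₂ (u d d2 : ℝ → ℂ) (K : ℝ) : Prop where
  pot : IsPot u d K
  prim : IsPrim d d2
  l2 : IsL2Bound d2 K

/-- Two potentials as in `IsPot₂` of size at most `B` and distance at most `δ`. -/
structure PotRel₂ (B : ℝ) (s t : (ℝ → ℂ) × (ℝ → ℂ) × (ℝ → ℂ)) (δ : ℝ) : Prop where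
  left : IsPot₂ s.1 s.2.1 s.2.2 B
  right : IsPot₂ t.1 t.2.1 t.2.2 B
  sub : IsPot₂ (fun x => s.1 x - t.1 x) (fun x => s.2.1 x - t.2.1 x) (fun x => s.2.2 x - t.2.2 x) δ

lemma PotRel₂.pair {s t : (ℝ → ℂ) × (ℝ → ℂ) × (ℝ → ℂ)} (h : PotRel₂ B s t δ) :
    PotRel B (s.1, s.2.1) (t.1, t.2.1) δ := ⟨h.left.pot, h.right.pot, h.sub.pot⟩

lemma IsL2Bound.comp_neg {f : ℝ → ℂ} (h : IsL2Bound f K) : IsL2Bound (fun x => f (-x)) K := by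
  refine ⟨h.1, h.2.comp measurable_neg, le_trans (le_of_eq ?_) h.3⟩
  exact eLpNorm_comp_measurePreserving (p := 2) (f := Neg.neg) (g := f)
    (μ := (volume : Measure ℝ)) (ν := (volume : Measure ℝ)) h.2.aestronglyMeasurable
    (Measure.measurePreserving_neg volume)

/-- The second derivative of the reflection of a function with second derivative `d2`. -/
def reflectDeriv₂ (d2 : ℝ → ℂ) (x : ℝ) : ℂ := -1 * (starRingEnd ℂ) (d2 (-x))

lemma IsPot₂.reflect (h : IsPot₂ u d d2 K) :
    IsPot₂ (reflection u) (reflectDeriv d) (reflectDeriv₂ d2) K := by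
  refine ⟨h.pot.reflect, ?_, ?_⟩
  · refine h.prim.comp_neg.conj.congr_deriv fun x => ?_
    simp [reflectDeriv₂]
  · have := IsL2Bound.const_mul _ _ (-1) (IsL2Bound.conj _ _ h.l2.comp_neg)
    rwa [norm_neg, norm_one, one_mul] at this

lemma PotRel₂.reflect {s t : (ℝ → ℂ) × (ℝ → ℂ) × (ℝ → ℂ)} (h : PotRel₂ B s t δ) :
    PotRel₂ B (reflection s.1, reflectDeriv s.2.1, reflectDeriv₂ s.2.2)
      (reflection t.1, reflectDeriv t.2.1, reflectDeriv₂ t.2.2) δ := by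
  refine ⟨h.left.reflect, h.right.reflect, ?_⟩
  have := h.sub.reflect
  have e1 : reflection (fun x => s.1 x - t.1 x) = fun x => reflection s.1 x - reflection t.1 x := by
    ext x; simp [reflection]; ring
  have e2 : reflectDeriv (fun x => s.2.1 x - t.2.1 x) =
      fun x => reflectDeriv s.2.1 x - reflectDeriv t.2.1 x := by
    ext x; simp [reflectDeriv]
  have e3 : reflectDeriv₂ (fun x => s.2.2 x - t.2.2 x) =
      fun x => reflectDeriv₂ s.2.2 x - reflectDeriv₂ t.2.2 x := by
    ext x; simp [reflectDeriv₂]; ring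
  rwa [e1, e2, e3] at this

/-- The derivative of `gcoef`. -/
def gDeriv (u d d2 : ℝ → ℂ) (x : ℝ) : ℂ :=
  (starRingEnd ℂ) (d2 x) + Complex.I / 2 * ((starRingEnd ℂ) (u x) * ((starRingEnd ℂ) (u x) * d x) +
    2 * (u x * ((starRingEnd ℂ) (u x) * (starRingEnd ℂ) (d x))))

/-- The coefficients of the equation for the derivative of the second component of the solution
of the system with matrix `laxMatrix`. -/
def accelCoef (u d d2 : ℝ → ℂ) : Fin 3 → ℝ → ℂ :=
  ![fun x => -1 * gDeriv u d d2 x,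
    fun x => Complex.I / 2 * (u x * gcoef u d x) + u x * (starRingEnd ℂ) (u x),
    fun x => u x * gcoef u d x + ((starRingEnd ℂ) (u x) * d x + u x * (starRingEnd ℂ) (d x)) +
      -(Complex.I / 2) * (u x * ((starRingEnd ℂ) (u x) * (u x * (starRingEnd ℂ) (u x))))]

/-- The derivative of the second component of the solution of the system with
matrix `laxMatrix`. -/
def accel (u d : ℝ → ℂ) (z : ℂ) (x : ℝ) : ℂ :=
  theta z * laxSol u d z x 1 + (-gcoef u d x * laxSol u d z x 0 +
    u x * (starRingEnd ℂ) (u x) * laxSol u d z x 2)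

lemma IsPot.isPrim_laxSol_one (h : IsPot u d K) (hz : z.im = 0) :
    IsPrim (fun x => laxSol u d z x 1) (accel u d z) := by
  refine ((h.isVolterraSol_laxSol hz.ge).isPrim h.integrableMatrix (theta_re_zero hz).le
    laxPhase_nonneg 1).congr_deriv fun x => ?_
  simp [laxMatrix, laxPhase, laxInit, Fin.sum_univ_three, accel]

lemma IsPot₂.isPrim_gcoef (h : IsPot₂ u d d2 K) : IsPrim (gcoef u d) (gDeriv u d d2) := by
  have hu := h.pot.prim
  refine (h.prim.conj.add ((hu.mul (hu.conj.mul hu.conj)).const_mul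
    (Complex.I / 2))).congr_deriv fun x => ?_
  simp only [gDeriv]
  ring

/-- Differentiating the middle row once more produces `|u|² θ w` from `w'`. Replacing `θ w` by `β +
ū α` leaves coefficients free of `z`, in which `u''` enters linearly. -/
lemma IsPot₂.isPrim_accel (h : IsPot₂ u d d2 K) (hz : z.im = 0) :
    IsPrim (accel u d z) (fun x => theta z * accel u d z x +
      ∑ i, accelCoef u d d2 i x * laxSol u d z x i) := by
  have hp := h.pot
  have pu := hp.prim
  have row := (hp.isVolterraSol_laxSol hz.ge).isPrim hp.integrableMatrix (theta_re_zero hz).le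
    laxPhase_nonneg
  have p0 := row 0
  have p1 := hp.isPrim_laxSol_one hz
  have p2 := row 2
  have p := (p1.const_mul (theta z)).add (((h.isPrim_gcoef.const_mul (-1)).mul p0).add
    ((pu.mul pu.conj).mul p2))
  have e : accel u d z = fun x => theta z * laxSol u d z x 1 +
      (-1 * gcoef u d x * laxSol u d z x 0 + u x * (starRingEnd ℂ) (u x) * laxSol u d z x 2) := by
    ext x; simp only [accel]; ring
  rw [← e] at p
  refine p.congr_deriv fun x => ?_
  have h1 := hp.laxSol_one hz x
  simp only [accelCoef, Fin.sum_univ_three, Matrix.cons_val, laxMatrix, laxPhase, laxInit,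
    Complex.ofReal_zero, Complex.ofReal_one]
  linear_combination (-(u x * (starRingEnd ℂ) (u x))) * h1

lemma norm_exp_neg_theta (hz : z.im = 0) (y : ℝ) : ‖Complex.exp (-theta z * y)‖ = 1 := by
  rw [Complex.norm_exp]
  simp [theta_re_zero hz]

lemma IsPot₂.tendsto_accel (h : IsPot₂ u d d2 K) (hz : z.im = 0) :
    Filter.Tendsto (accel u d z) Filter.atBot (nhds 0) := by
  have hc : Filter.Tendsto (starRingEnd ℂ) (nhds 0) (nhds 0) := by
    simpa using Complex.continuous_conj.tendsto 0
  have tu := h.pot.tendsto_atBot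
  have td := h.prim.tendsto_atBot h.pot.snd.isL2Bound h.l2
  have t := h.pot.tendsto_laxSol hz
  have tc := hc.comp tu
  have tg : Filter.Tendsto (gcoef u d) Filter.atBot (nhds 0) := by
    have := (hc.comp td).add ((tu.mul (tc.mul tc)).const_mul (Complex.I / 2))
    rwa [mul_zero, mul_zero, mul_zero, add_zero] at this
  have := ((t 1).const_mul (theta z)).add ((tg.neg.mul (t 0)).add ((tu.mul tc).mul (t 2)))
  unfold accel
  simpa [laxInit] using this

/-- The derivative at the origin as a limit of oscillatory integrals. -/
lemma IsPot₂.tendsto_integral_accel (h : IsPot₂ u d d2 K) (z : ℝ) :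
    Filter.Tendsto (fun n : ℕ => ∫ y in Ioc (-(n : ℝ)) 0, Complex.exp (-theta z * y) *
      (accelCoef u d d2 0 y + ∑ j, accelCoef u d d2 j y * (laxSol u d z y j - laxInit j)))
      Filter.atTop (nhds (accel u d z 0)) := by
  have hz := Complex.ofReal_im z
  -- As the initial vector is `(1, 0, 0)`, its contribution is the single coefficient `accelCoef u d
  -- d2 0`. It goes to Plancherel, while the remaining terms carry a decaying factor.
  have p := ((IsPrim.exp (-theta z)).mul (h.isPrim_accel hz)).congr_deriv
    (g' := fun y => Complex.exp (-theta z * y) *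
      (accelCoef u d d2 0 y + ∑ j, accelCoef u d d2 j y * (laxSol u d z y j - laxInit j))) fun y => by
    simp only [Fin.sum_univ_three, laxInit, Matrix.cons_val]
    ring
  have t : Filter.Tendsto (fun y : ℝ => Complex.exp (-theta z * y) * accel u d z y)
      Filter.atBot (nhds 0) := by
    have h0 := h.tendsto_accel hz
    rw [tendsto_zero_iff_norm_tendsto_zero] at h0 ⊢
    refine h0.congr fun y => ?_
    rw [norm_mul, norm_exp_neg_theta hz, one_mul]
  have hn : Filter.Tendsto (fun n : ℕ => -(n : ℝ)) Filter.atTop Filter.atBot :=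
    Filter.tendsto_neg_atTop_atBot.comp tendsto_natCast_atTop_atTop
  have t2 : Filter.Tendsto (fun n : ℕ => accel u d z 0 -
      Complex.exp (-theta z * ((-(n : ℝ) : ℝ) : ℂ)) * accel u d z (-(n : ℝ)))
      Filter.atTop (nhds (accel u d z 0 - 0)) := tendsto_const_nhds.sub (t.comp hn)
  rw [sub_zero] at t2
  refine t2.congr fun n => ?_
  rw [← intervalIntegral.integral_of_le (by simp), ← p.eq]
  simp

end SecondOrder

/-! ### Weighted bounds in `z` for the scattering data. -/

noncomputable section SecondOrderBounds

variable {T : Type*} {R : ℝ → T → T → ℝ → Prop} {F G : T → ℝ → ℂ} {P : (ℝ → ℂ) → ℝ → Prop}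

lemma UnifLip.l2_add (hF : UnifLip R IsL2Bound F) (hG : UnifLip R IsL2Bound G) :
    UnifLip R IsL2Bound (fun s x => F s x + G s x) := UnifLip.add IsL2Bound.add hF hG

lemma UnifLip.sup_mul (hF : UnifLip R IsSupBound F) (hG : UnifLip R IsL2Bound G) :
    UnifLip R IsL2Bound (fun s x => F s x * G s x) :=
  UnifLip.mul IsL2Bound.sup_mul IsL2Bound.add IsL2Bound.mono hF hG

lemma PotRel.abs_eq {B : ℝ} {s t : (ℝ → ℂ) × (ℝ → ℂ)} {δ : ℝ} (h : PotRel B s t δ) : |B| = B :=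
  abs_of_nonneg (IsPotPair.nonneg h).1

lemma unifLip_fst : UnifLip PotRel IsL2Bound (fun s => s.1) := fun B =>
  ⟨|B| + 1, by positivity, fun _ _ _ _ h => h.abs_eq.symm ▸ (IsPotPair.l21_fst h).isL2Bound⟩

lemma unifLip_snd : UnifLip PotRel IsL2Bound (fun s => s.2) := fun B =>
  ⟨|B| + 1, by positivity, fun _ _ _ _ h => h.abs_eq.symm ▸ (IsPotPair.l21_snd h).isL2Bound⟩

lemma unifLip_sup : UnifLip PotRel IsSupBound (fun s => s.1) := fun B =>
  ⟨4 * (|B| + 1), by positivity, fun _ _ _ _ h => h.abs_eq.symm ▸ IsPotPair.sup h⟩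

lemma unifLip_gcoef : UnifLip PotRel IsL2Bound (fun s => gcoef s.1 s.2) := fun B =>
  ⟨300 * (|B| + 1) ^ 3, by positivity, fun _ _ _ _ h =>
    h.abs_eq.symm ▸ (IsPotPair.l21_gcoef h).isL2Bound⟩

lemma unifLip_deriv₂ : UnifLip PotRel₂ IsL2Bound (fun s => s.2.2) := by
  intro B
  refine ⟨|B| + 1, by positivity, fun s t δ hδ h => ?_⟩
  rw [h.pair.abs_eq]
  have hB := (IsPotPair.nonneg h.pair).1
  exact ⟨IsL2Bound.mono _ _ _ h.left.l2 (by linarith), IsL2Bound.mono _ _ _ h.right.l2 (by linarith),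
    IsL2Bound.mono _ _ _ h.sub.l2 (by nlinarith)⟩

lemma UnifLip.ofPotRel {F : (ℝ → ℂ) × (ℝ → ℂ) → ℝ → ℂ} (hF : UnifLip PotRel P F) :
    UnifLip PotRel₂ P (fun s => F (s.1, s.2.1)) :=
  hF.comap (R' := PotRel₂) (fun s : (ℝ → ℂ) × (ℝ → ℂ) × (ℝ → ℂ) => (s.1, s.2.1))
    fun _ _ _ _ h => h.pair

lemma UnifLip.reflect₂ {F : (ℝ → ℂ) × (ℝ → ℂ) × (ℝ → ℂ) → ℝ → ℂ} (hF : UnifLip PotRel₂ P F) :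
    UnifLip PotRel₂ P (fun s => F (reflection s.1, reflectDeriv s.2.1, reflectDeriv₂ s.2.2)) :=
  hF.comap (R' := PotRel₂) (fun s : (ℝ → ℂ) × (ℝ → ℂ) × (ℝ → ℂ) =>
    (reflection s.1, reflectDeriv s.2.1, reflectDeriv₂ s.2.2)) fun _ _ _ _ h => h.reflect

lemma unifLip_accelCoef (i : Fin 3) :
    UnifLip PotRel₂ IsL2Bound (fun s => accelCoef s.1 s.2.1 s.2.2 i) := by
  have u := unifLip_fst.ofPotRel
  have u' := u.conj IsL2Bound.conj
  have d := unifLip_snd.ofPotRel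
  have d' := d.conj IsL2Bound.conj
  have w := unifLip_sup.ofPotRel
  have w' := w.conj IsSupBound.conj
  have g := unifLip_gcoef.ofPotRel
  have c2 := unifLip_deriv₂.conj IsL2Bound.conj
  have n := w.sup_mul u'
  have gd : UnifLip PotRel₂ IsL2Bound (fun s => gDeriv s.1 s.2.1 s.2.2) :=
    c2.l2_add (((w'.sup_mul (w'.sup_mul d)).l2_add
      ((w.sup_mul (w'.sup_mul d')).const_mul IsL2Bound.const_mul 2)).const_mul
        IsL2Bound.const_mul (Complex.I / 2))
  fin_cases i
  · exact gd.const_mul IsL2Bound.const_mul (-1)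
  · exact ((w.sup_mul g).const_mul IsL2Bound.const_mul (Complex.I / 2)).l2_add n
  · exact ((w.sup_mul g).l2_add ((w'.sup_mul d).l2_add (w.sup_mul d'))).l2_add
      ((w.sup_mul (w'.sup_mul n)).const_mul IsL2Bound.const_mul (-(Complex.I / 2)))

lemma IsPot.continuous_laxSol {u d : ℝ → ℂ} {K : ℝ} (h : IsPot u d K) (j : Fin 3) :
    Continuous (Function.uncurry fun z y : ℝ => laxSol u d z y j - laxInit j) :=
  ((continuous_apply j).comp (continuous_uncurry_volterraSol (e := laxInit) h.integrableMatrix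
    laxPhase_nonneg)).sub continuous_const

theorem unifLip_accel : UnifLip PotRel₂ IsL2Bound (fun s (z : ℝ) => accel s.1 s.2.1 z 0) := by
  intro B
  choose L hL h using fun i => unifLip_accelCoef i B
  obtain ⟨M, hM, h'⟩ := exists_laxSol_bound B
  -- The sum serves as a common constant for the three coefficients.
  have hL0 : ∀ i, L i ≤ ∑ i, L i := fun i =>
    Finset.single_le_sum (fun j _ => hL j) (Finset.mem_univ i)
  refine ⟨2 * (∑ i, L i) + Fintype.card (Fin 3) * (4 * ((∑ i, L i) * M)), ?_, fun s t δ hδ hR => ?_⟩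
  · have := Finset.sum_nonneg fun i (_ : i ∈ Finset.univ) => hL i
    positivity
  have hc := fun i => Pair.mono IsL2Bound.mono hδ.le (h i s t δ hδ hR) (hL0 i)
  have hb := (h' _ _ _ _ δ hδ hR.pair).2
  exact pair_of_tendsto_integral (Y := fun j z y => laxSol s.1 s.2.1 z y j - laxInit j)
    (Y' := fun j z y => laxSol t.1 t.2.1 z y j - laxInit j) hδ.le
    (Finset.sum_nonneg fun i _ => hL i) hM (hc 0) hc
    (fun j => hR.left.pot.continuous_laxSol j) (fun j => hR.right.pot.continuous_laxSol j)
    (fun j y hy => (hb y hy j).1) (fun j y hy => (hb y hy j).2.1)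
    (fun j y hy => by simpa only [sub_sub_sub_cancel_right] using (hb y hy j).2.2)
    hR.left.tendsto_integral_accel hR.right.tendsto_integral_accel

/-- In both products `θ β` is replaced by `β'` minus lower order terms. The terms with `gcoef`
cancel, since its value at the origin is the conjugate of the one for the reflected potential; the
terms with `|u(0)|²` combine to `betaCoef`. -/
lemma theta_mul_sigmaCoef (u d : ℝ → ℂ) {z : ℂ} (hz : z.im = 0) :
    theta z * sigmaCoef u d z =
      (starRingEnd ℂ) (laxSol (reflection u) (reflectDeriv d) z 0 0) * accel u d z 0 -
      (starRingEnd ℂ) (accel (reflection u) (reflectDeriv d) z 0) * laxSol u d z 0 0 -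
      u 0 * (starRingEnd ℂ) (u 0) * betaCoef u d z := by
  simp only [sigmaCoef, accel, betaCoef, map_add, map_mul, map_neg, theta_conj hz, gcoef, reflection,
    reflectDeriv, neg_zero, Complex.conj_conj, map_div₀, Complex.conj_I, map_ofNat]
  ring

theorem unifLip_theta_mul_sigmaCoef :
    UnifLip PotRel₂ IsL2Bound (fun s (z : ℝ) => theta z * sigmaCoef s.1 s.2.1 z) := by
  have r := unifLip_accel
  have r' := r.reflect₂.conj IsL2Bound.conj
  have x := (unifLip_laxSol 0).ofPotRel.imp IsH1Bound.isSupBound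
  have y := ((unifLip_laxSol 0).reflect.ofPotRel.imp IsH1Bound.isSupBound).conj IsSupBound.conj
  have c := unifLip_apply_zero.ofPotRel.imp IsConstBound.isSupBound
  have c' := c.conj IsSupBound.conj
  have β := unifLip_betaCoef.ofPotRel.imp IsH1Bound.isL2Bound
  refine ((((y.sup_mul r).l2_add r).l2_add (((x.sup_mul r').l2_add r').const_mul
    IsL2Bound.const_mul (-1))).l2_add ((c.sup_mul (c'.sup_mul β)).const_mul
    IsL2Bound.const_mul (-1))).congr_fun fun s z => ?_
  rw [theta_mul_sigmaCoef _ _ (Complex.ofReal_im z)]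
  simp only [laxInit, Matrix.cons_val_zero, map_sub, map_one]
  ring

lemma IsL21Bound.of_mul (f : ℝ → ℂ) (K L : ℝ) (h : IsL2Bound f K)
    (h' : IsL2Bound (fun z => z * f z) L) : IsL21Bound f (K + L) := by
  refine ⟨add_nonneg h.nonneg h'.nonneg, h.measurable, ?_⟩
  have h1 := h.measurable.enorm
  have h2 := h'.measurable.enorm
  have e1 := h.le
  have e2 := h'.le
  rw [ENNReal.ofReal_add h.nonneg h'.nonneg]
  rw [normL2, eLpNorm_two_eq_l2norm] at e1 e2
  rw [normL21, normL2, eLpNorm_two_eq_l2norm]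
  refine le_trans (l2norm_mono fun z => ?_) ((l2norm_add_le h1.aemeasurable h2.aemeasurable).trans
    (add_le_add e1 e2))
  rw [← ofReal_norm, ← ofReal_norm, ← ofReal_norm, ← ENNReal.ofReal_add (norm_nonneg _) (norm_nonneg _)]
  refine ENNReal.ofReal_le_ofReal ?_
  rw [norm_mul, norm_mul, Complex.norm_real, Complex.norm_real,
    Real.norm_of_nonneg (Real.sqrt_nonneg _), ← one_add_mul]
  gcongr
  rw [Real.norm_eq_abs]
  refine Real.sqrt_le_iff.2 ⟨by positivity, ?_⟩
  nlinarith [abs_nonneg z, sq_abs z]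

lemma UnifLip.l21_of_mul (hF : UnifLip R IsL2Bound F)
    (hG : UnifLip R IsL2Bound (fun s (z : ℝ) => z * F s z)) : UnifLip R IsL21Bound F := by
  intro B
  obtain ⟨K, hK, h⟩ := hF B
  obtain ⟨L, hL, h'⟩ := hG B
  refine ⟨K + L, by positivity, fun s t δ hδ hR => ?_⟩
  obtain ⟨a1, a2, a3⟩ := h s t δ hδ hR
  obtain ⟨b1, b2, b3⟩ := h' s t δ hδ hR
  refine ⟨IsL21Bound.of_mul _ _ _ a1 b1, IsL21Bound.of_mul _ _ _ a2 b2, ?_⟩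
  rw [add_mul]
  simp only [← mul_sub] at b3
  exact IsL21Bound.of_mul _ _ _ a3 b3

theorem unifLip_betaCoef_l21 :
    UnifLip PotRel₂ IsL21Bound (fun s (z : ℝ) => betaCoef s.1 s.2.1 z) :=
  (unifLip_betaCoef.ofPotRel.imp IsH1Bound.isL2Bound).l21_of_mul
    (unifLip_mul_betaCoef.ofPotRel.imp IsH1Bound.isL2Bound)

theorem unifLip_mul_betaCoef_l21 :
    UnifLip PotRel₂ IsL21Bound (fun s (z : ℝ) => z * betaCoef s.1 s.2.1 z) := by
  have β := unifLip_betaCoef.ofPotRel.imp IsH1Bound.isL2Bound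
  have σ := unifLip_sigmaCoef.ofPotRel.imp IsH1Bound.isL2Bound
  have τ := unifLip_theta_mul_sigmaCoef
  refine (unifLip_mul_betaCoef.ofPotRel.imp IsH1Bound.isL2Bound).l21_of_mul ?_
  -- From `z = θ / (2i) - 1` one has `z² = -θ²/4 + iθ + 1`; applied to `betaCoef` this gives the
  -- three terms.
  refine (((τ.const_mul IsL2Bound.const_mul (-(1 / 4))).l2_add
    (σ.const_mul IsL2Bound.const_mul Complex.I)).l2_add β).congr ?_
  have key : ∀ (s : (ℝ → ℂ) × (ℝ → ℂ) × (ℝ → ℂ)) (B : ℝ), IsPot₂ s.1 s.2.1 s.2.2 B → ∀ z : ℝ,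
      -(1 / 4) * (theta z * sigmaCoef s.1 s.2.1 z) + Complex.I * sigmaCoef s.1 s.2.1 z +
        betaCoef s.1 s.2.1 z = z * (z * betaCoef s.1 s.2.1 z) := fun s B hs z => by
    rw [← hs.pot.theta_mul_betaCoef (Complex.ofReal_im z), theta]
    have I2 := Complex.I_mul_I
    linear_combination (-(z + 1) ^ 2 + 2 * (z + 1)) * betaCoef s.1 s.2.1 z * I2
  exact fun _ s t _ hR => ⟨funext (key s _ hR.left), funext (key t _ hR.right)⟩

end SecondOrderBounds

end NLSGI

namespace NLSGI

/-! ### Continuous representatives of Sobolev functions. -/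

noncomputable section Representatives

lemma le_rpow_half {x s : ℝ≥0∞} (h : x ^ 2 ≤ s) : x ≤ s ^ (1 / 2 : ℝ) := by
  rw [one_div, ENNReal.le_rpow_inv_iff two_pos]
  exact_mod_cast h

/-- `s` consists of the continuous representative of `u` and a measurable weak derivative. -/
structure IsRep (u : ℝ → ℂ) (s : (ℝ → ℂ) × (ℝ → ℂ)) : Prop where
  ae_eq : u =ᵐ[volume] s.1
  prim : IsPrim s.1 s.2
  measurable : Measurable s.2

/-- `s` consists of the continuous representatives of `u`, of its weak derivative, and a
measurable second weak derivative. -/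
structure IsRep₂ (u : ℝ → ℂ) (s : (ℝ → ℂ) × (ℝ → ℂ) × (ℝ → ℂ)) : Prop where
  ae_eq : u =ᵐ[volume] s.1
  prim : IsPrim s.1 s.2.1
  prim₂ : IsPrim s.2.1 s.2.2
  measurable : Measurable s.2.2

lemma IsRep₂.isRep {u : ℝ → ℂ} {s : (ℝ → ℂ) × (ℝ → ℂ) × (ℝ → ℂ)} (h : IsRep₂ u s) :
    IsRep u (s.1, s.2.1) := ⟨h.ae_eq, h.prim, h.prim₂.continuous.measurable⟩

lemma IsRep.sub {u v : ℝ → ℂ} {s t : (ℝ → ℂ) × (ℝ → ℂ)} (h : IsRep u s) (h' : IsRep v t) :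
    IsRep (u - v) (fun x => s.1 x - t.1 x, fun x => s.2 x - t.2 x) :=
  ⟨h.1.sub h'.1, h.2.sub h'.2, h.3.sub h'.3⟩

lemma IsRep₂.sub {u v : ℝ → ℂ} {s t : (ℝ → ℂ) × (ℝ → ℂ) × (ℝ → ℂ)} (h : IsRep₂ u s)
    (h' : IsRep₂ v t) : IsRep₂ (u - v)
      (fun x => s.1 x - t.1 x, fun x => s.2.1 x - t.2.1 x, fun x => s.2.2 x - t.2.2 x) :=
  ⟨h.1.sub h'.1, h.2.sub h'.2, h.3.sub h'.3, h.4.sub h'.4⟩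

lemma MemH11.exists_isRep {u : ℝ → ℂ} (h : MemH11 u) : ∃ s, IsRep u s := by
  obtain ⟨g, hg⟩ : ∃ g, IsWeakDeriv u g := by
    by_contra! hn
    simp [MemH11, normH11, hn] at h
  obtain ⟨F, hF, hp⟩ := hg.exists_isPrim
  have hm := hg.2.aestronglyMeasurable
  exact ⟨(F, hm.mk g), hF, hp.congr_deriv_ae hm.ae_eq_mk, hm.stronglyMeasurable_mk.measurable⟩

lemma MemH2.exists_isRep₂ {u : ℝ → ℂ} (h : MemH2 u) : ∃ s, IsRep₂ u s := by
  obtain ⟨g, k, hg, hk⟩ : ∃ g k, IsWeakDeriv u g ∧ IsWeakDeriv g k := by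
    by_contra! hn
    refine h.ne ?_
    unfold normH2
    simp only [iInf_eq_top]
    exact fun g k hg hk => absurd hk (hn g k hg)
  obtain ⟨F, hF, hp⟩ := hg.exists_isPrim
  obtain ⟨D, hD, hq⟩ := hk.exists_isPrim
  have hm := hk.2.aestronglyMeasurable
  exact ⟨(F, D, hm.mk k), hF, hp.congr_deriv_ae hD, hq.congr_deriv_ae hm.ae_eq_mk,
    hm.stronglyMeasurable_mk.measurable⟩

lemma IsRep.isWeakDeriv {u : ℝ → ℂ} {s : (ℝ → ℂ) × (ℝ → ℂ)} (h : IsRep u s) : IsWeakDeriv u s.2 :=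
  h.prim.isWeakDeriv.congr_ae h.ae_eq.symm (ae_eq_refl _)

lemma IsRep.isPot {u : ℝ → ℂ} {s : (ℝ → ℂ) × (ℝ → ℂ)} (h : IsRep u s) {K : ℝ} (hK : 0 ≤ K)
    (hu : normH11 u ≤ ENNReal.ofReal K) : IsPot s.1 s.2 K := by
  rw [h.isWeakDeriv.normH11_eq] at hu
  refine ⟨h.prim, ⟨hK, h.prim.continuous.measurable, ?_⟩, ⟨hK, h.measurable, ?_⟩⟩
  · rw [← normL21_congr_ae h.ae_eq]
    exact (le_rpow_half le_self_add).trans hu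
  · exact (le_rpow_half le_add_self).trans hu

lemma IsRep₂.isPot₂ {u : ℝ → ℂ} {s : (ℝ → ℂ) × (ℝ → ℂ) × (ℝ → ℂ)} (h : IsRep₂ u s) {K : ℝ}
    (hK : 0 ≤ K) (hu : normH2 u + normH11 u ≤ ENNReal.ofReal K) : IsPot₂ s.1 s.2.1 s.2.2 K := by
  refine ⟨h.isRep.isPot hK (le_add_self.trans hu), h.prim₂, ⟨hK, h.measurable, ?_⟩⟩
  have h2 := le_self_add.trans hu
  rw [h.isRep.isWeakDeriv.normH2_eq h.prim₂.isWeakDeriv] at h2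
  exact (le_rpow_half le_add_self).trans h2

lemma IsRep.potRel {u v : ℝ → ℂ} {s t : (ℝ → ℂ) × (ℝ → ℂ)} (h : IsRep u s) (h' : IsRep v t)
    {B δ : ℝ} (hB : 0 ≤ B) (hδ : 0 ≤ δ) (hu : normH11 u ≤ ENNReal.ofReal B)
    (hv : normH11 v ≤ ENNReal.ofReal B) (huv : normH11 (u - v) ≤ ENNReal.ofReal δ) :
    PotRel B s t δ := ⟨h.isPot hB hu, h'.isPot hB hv, (h.sub h').isPot hδ huv⟩

lemma IsRep₂.potRel₂ {u v : ℝ → ℂ} {s t : (ℝ → ℂ) × (ℝ → ℂ) × (ℝ → ℂ)} (h : IsRep₂ u s)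
    (h' : IsRep₂ v t) {B δ : ℝ} (hB : 0 ≤ B) (hδ : 0 ≤ δ)
    (hu : normH2 u + normH11 u ≤ ENNReal.ofReal B) (hv : normH2 v + normH11 v ≤ ENNReal.ofReal B)
    (huv : normH2 (u - v) + normH11 (u - v) ≤ ENNReal.ofReal δ) : PotRel₂ B s t δ :=
  ⟨h.isPot₂ hB hu, h'.isPot₂ hB hv, (h.sub h').isPot₂ hδ huv⟩

/-- Membership of the scattering data in a space is read off from the Lipschitz statements on the
diagonal, where any positive `δ` will do. -/
lemma IsPot.potRel_self {s : (ℝ → ℂ) × (ℝ → ℂ)} {B : ℝ} (h : IsPot s.1 s.2 B) :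
    PotRel B s s 1 := by
  refine ⟨h, h, ?_⟩
  simp only [sub_self]
  have h0 := IsL21Bound.mono _ _ _ IsL21Bound.zero zero_le_one
  exact ⟨IsPrim.const 0, h0, h0⟩

lemma IsPot₂.potRel₂_self {s : (ℝ → ℂ) × (ℝ → ℂ) × (ℝ → ℂ)} {B : ℝ}
    (h : IsPot₂ s.1 s.2.1 s.2.2 B) : PotRel₂ B s s 1 := by
  refine ⟨h, h, (IsPot.potRel_self (s := (s.1, s.2.1)) h.pot).sub, ?_, ?_⟩
  · simp only [sub_self]
    exact IsPrim.const 0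
  · simp only [sub_self]
    exact IsL2Bound.mono _ _ _ IsL2Bound.zero zero_le_one

/-- The doubling argument requires `δ > 0`, while the distance `N` of two potentials may vanish.
Letting `δ` decrease to `N` covers this case. -/
lemma le_ofReal_mul_of_forall {X N : ℝ≥0∞} {c : ℝ} (hc : 0 < c)
    (h : ∀ δ, 0 < δ → N ≤ ENNReal.ofReal δ → X ≤ ENNReal.ofReal (c * δ)) :
    X ≤ ENNReal.ofReal c * N := by
  rcases eq_or_ne N ⊤ with rfl | hN
  · rw [ENNReal.mul_top (by simpa using hc)]; exact le_top
  · have h1 : ∀ n : ℕ, X ≤ ENNReal.ofReal (c * (N.toReal + 1 / ((n : ℝ) + 1))) := fun n => by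
      have hp : (0 : ℝ) < 1 / ((n : ℝ) + 1) := by positivity
      refine h _ (by positivity) ?_
      rw [← ENNReal.ofReal_toReal hN, ENNReal.toReal_ofReal ENNReal.toReal_nonneg]
      exact ENNReal.ofReal_le_ofReal (by linarith)
    have h2 : Filter.Tendsto (fun n : ℕ => ENNReal.ofReal (c * (N.toReal + 1 / ((n : ℝ) + 1))))
        Filter.atTop (nhds (ENNReal.ofReal (c * (N.toReal + 0)))) :=
      ENNReal.tendsto_ofReal ((tendsto_one_div_add_atTop_nhds_zero_nat.const_add _).const_mul c)
    have h3 := ge_of_tendsto' h2 h1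
    rwa [add_zero, ENNReal.ofReal_mul hc.le, ENNReal.ofReal_toReal hN] at h3

end Representatives

/-! ### From uniform bounds to membership and Lipschitz continuity. -/

noncomputable section Conclusions

variable {G : (ℝ → ℂ) × (ℝ → ℂ) → ℝ → ℂ} {H : (ℝ → ℂ) × (ℝ → ℂ) × (ℝ → ℂ) → ℝ → ℂ}

lemma UnifLip.memH1 (hG : UnifLip PotRel IsH1Bound G) {s : (ℝ → ℂ) × (ℝ → ℂ)} {B : ℝ}
    (hs : IsPot s.1 s.2 B) : MemH1 (G s) := by
  obtain ⟨K, -, h⟩ := hG B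
  exact (h s s 1 one_pos hs.potRel_self).1.normH1_le.trans_lt ENNReal.ofReal_lt_top

lemma UnifLip.memL21 (hH : UnifLip PotRel₂ IsL21Bound H) {s : (ℝ → ℂ) × (ℝ → ℂ) × (ℝ → ℂ)} {B : ℝ}
    (hs : IsPot₂ s.1 s.2.1 s.2.2 B) : MemL21 (H s) := by
  obtain ⟨K, -, h⟩ := hH B
  have := (h s s 1 one_pos hs.potRel₂_self).1
  exact ⟨this.measurable.aestronglyMeasurable, this.le.trans_lt ENNReal.ofReal_lt_top⟩

lemma UnifLip.exists_lipschitz (hG : UnifLip PotRel IsH1Bound G) (B : ℝ≥0) : ∃ C : ℝ≥0,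
    ∀ u v s t, IsRep u s → IsRep v t → normH11 u ≤ B → normH11 v ≤ B →
      normH1 (fun z => G s z - G t z) ≤ C * normH11 (u - v) := by
  obtain ⟨K, hK, h⟩ := hG B
  -- The factor `2` comes from `IsH1Bound.normH1_le`; the summand `1` makes the constant positive
  -- even when `K = 0`.
  refine ⟨(2 * K + 1).toNNReal, fun u v s t hs ht hu hv => ?_⟩
  refine le_ofReal_mul_of_forall (by positivity) fun δ hδ huv => ?_
  rw [← ENNReal.ofReal_coe_nnreal] at hu hv
  refine (h s t δ hδ (hs.potRel ht B.coe_nonneg hδ.le hu hv huv)).2.2.normH1_le.trans ?_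
  exact ENNReal.ofReal_le_ofReal (by nlinarith)

lemma UnifLip.exists_lipschitz₂ (hH : UnifLip PotRel₂ IsL21Bound H) (B : ℝ≥0) : ∃ C : ℝ≥0,
    ∀ u v s t, IsRep₂ u s → IsRep₂ v t → normH2 u + normH11 u ≤ B → normH2 v + normH11 v ≤ B →
      normL21 (fun z => H s z - H t z) ≤ C * (normH2 (u - v) + normH11 (u - v)) := by
  obtain ⟨K, hK, h⟩ := hH B
  refine ⟨(K + 1).toNNReal, fun u v s t hs ht hu hv => ?_⟩
  refine le_ofReal_mul_of_forall (by positivity) fun δ hδ huv => ?_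
  rw [← ENNReal.ofReal_coe_nnreal] at hu hv
  refine (h s t δ hδ (hs.potRel₂ ht B.coe_nonneg hδ.le hu hv huv)).2.2.le.trans ?_
  exact ENNReal.ofReal_le_ofReal (by nlinarith)

variable {u : ℝ → ℂ} {s : (ℝ → ℂ) × (ℝ → ℂ)} {κ : ℝ → ℂ} {B : ℝ}

lemma IsSqrt.sq_im (hκ : IsSqrt κ) (z : ℝ) : (κ z ^ 2).im = 0 := by
  rw [hκ z, Complex.ofReal_im]

lemma IsRep.a_eq (h : IsRep u s) (hs : IsPot s.1 s.2 B) (hκ : IsSqrt κ) (z : ℝ) :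
    a u (κ z) = aCoef s.1 s.2 z := by
  rw [a_congr_ae h.ae_eq, ← hs.aCoef_eq (hκ.sq_im z), hκ z]

lemma IsRep.mul_b_eq (h : IsRep u s) (hs : IsPot s.1 s.2 B) (hκ : IsSqrt κ) (z : ℝ) :
    κ z * b u (κ z) = z * betaCoef s.1 s.2 z := by
  rw [b_congr_ae h.ae_eq, hs.b_eq (hκ.sq_im z), hκ z, ← mul_assoc, ← sq, hκ z]

/-- At `z = 0` the left side takes the value `0` by the convention for the inverse of zero, so
equality is claimed almost everywhere only. -/
lemma IsRep.inv_mul_b_eq (h : IsRep u s) (hs : IsPot s.1 s.2 B) (hκ : IsSqrt κ) :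
    (fun z => (κ z)⁻¹ * b u (κ z)) =ᵐ[volume] fun z : ℝ => betaCoef s.1 s.2 z := by
  filter_upwards [Measure.ae_ne volume (0 : ℝ)] with z hz
  have hk : κ z ≠ 0 := fun h0 => hz (by
    have := hκ z
    rw [h0] at this
    simpa using this.symm)
  rw [b_congr_ae h.ae_eq, hs.b_eq (hκ.sq_im z), hκ z, inv_mul_cancel_left₀ hk]

end Conclusions

end NLSGI

open NLSGI in
theorem lemma4 :
    (∀ u : ℝ → ℂ, MemH11 u →
      (∀ k : ℂ, (k ^ 2).im = 0 → ScatteringWellDefined u k) ∧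
      (∃ A : ℂ → ℂ, ContinuousOn A {z : ℂ | 0 ≤ z.im} ∧
        DifferentiableOn ℂ A {z : ℂ | 0 < z.im} ∧
        ∀ k : ℂ, (k ^ 2).im = 0 → A (k ^ 2) = a u k) ∧
      (∀ κ : ℝ → ℂ, IsSqrt κ →
        MemH1 (fun z => a u (κ z) - 1) ∧
        MemH1 (fun z => κ z * b u (κ z)) ∧
        MemH1 (fun z => (κ z)⁻¹ * b u (κ z)))) ∧
    (∀ u : ℝ → ℂ, MemH2 u → MemH11 u →
      ∀ κ : ℝ → ℂ, IsSqrt κ →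
        MemL21 (fun z => κ z * b u (κ z)) ∧
        MemL21 (fun z => (κ z)⁻¹ * b u (κ z))) ∧
    (∀ B : ℝ≥0, ∃ C : ℝ≥0, ∀ u v : ℝ → ℂ, normH11 u ≤ B → normH11 v ≤ B →
      ∀ κ : ℝ → ℂ, IsSqrt κ →
        normH1 (fun z => (a u (κ z) - 1) - (a v (κ z) - 1)) ≤ C * normH11 (u - v) ∧
        normH1 (fun z => κ z * b u (κ z) - κ z * b v (κ z)) ≤ C * normH11 (u - v) ∧
        normH1 (fun z => (κ z)⁻¹ * b u (κ z) - (κ z)⁻¹ * b v (κ z)) ≤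
          C * normH11 (u - v)) ∧
    (∀ B : ℝ≥0, ∃ C : ℝ≥0, ∀ u v : ℝ → ℂ,
      normH2 u + normH11 u ≤ B → normH2 v + normH11 v ≤ B →
      ∀ κ : ℝ → ℂ, IsSqrt κ →
        normL21 (fun z => κ z * b u (κ z) - κ z * b v (κ z)) ≤
          C * (normH2 (u - v) + normH11 (u - v)) ∧
        normL21 (fun z => (κ z)⁻¹ * b u (κ z) - (κ z)⁻¹ * b v (κ z)) ≤
          C * (normH2 (u - v) + normH11 (u - v))) := by
  have top : ∀ B : ℝ≥0, (B : ℝ≥0∞) < ⊤ := fun B => ENNReal.coe_lt_top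
  have pot : ∀ u s, IsRep u s → MemH11 u → IsPot s.1 s.2 (normH11 u).toReal := fun u s hs hu =>
    hs.isPot ENNReal.toReal_nonneg (ENNReal.ofReal_toReal hu.ne).ge
  refine ⟨fun u hu => ?_, fun u hu2 hu κ hκ => ?_, fun B => ?_, fun B => ?_⟩
  · obtain ⟨s, hs⟩ := hu.exists_isRep
    have hp := pot u s hs hu
    refine ⟨fun k hk => (hp.scatteringWellDefined hk).congr_ae hs.ae_eq.symm,
      ⟨aCoef s.1 s.2, hp.continuousOn_aCoef, hp.differentiableOn_aCoef, fun k hk => ?_⟩,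
      fun κ hκ => ⟨?_, ?_, ?_⟩⟩
    · rw [hp.aCoef_eq hk, a_congr_ae hs.ae_eq]
    · simp_rw [hs.a_eq hp hκ]
      exact unifLip_aCoef.memH1 hp
    · simp_rw [hs.mul_b_eq hp hκ]
      exact unifLip_mul_betaCoef.memH1 hp
    · rw [MemH1, normH1_congr_ae (hs.inv_mul_b_eq hp hκ)]
      exact unifLip_betaCoef.memH1 hp
  · obtain ⟨s, hs⟩ := hu2.exists_isRep₂
    have hp := pot u _ hs.isRep hu
    have hp2 := hs.isPot₂ ENNReal.toReal_nonneg
      (ENNReal.ofReal_toReal (ENNReal.add_lt_top.2 ⟨hu2, hu⟩).ne).ge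
    refine ⟨?_, ?_⟩
    · simp_rw [hs.isRep.mul_b_eq hp hκ]
      exact unifLip_mul_betaCoef_l21.memL21 hp2
    · have he := hs.isRep.inv_mul_b_eq hp hκ
      obtain ⟨h1, h2⟩ := unifLip_betaCoef_l21.memL21 hp2
      exact ⟨h1.congr he.symm, (normL21_congr_ae he).trans_lt h2⟩
  · obtain ⟨C₁, h₁⟩ := unifLip_aCoef.exists_lipschitz B
    obtain ⟨C₂, h₂⟩ := unifLip_mul_betaCoef.exists_lipschitz B
    obtain ⟨C₃, h₃⟩ := unifLip_betaCoef.exists_lipschitz B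
    refine ⟨C₁ + C₂ + C₃, fun u v hu hv κ hκ => ?_⟩
    have hu' : MemH11 u := hu.trans_lt (top B)
    have hv' : MemH11 v := hv.trans_lt (top B)
    obtain ⟨s, hs⟩ := hu'.exists_isRep
    obtain ⟨t, ht⟩ := hv'.exists_isRep
    have ps := pot u s hs hu'
    have pt := pot v t ht hv'
    refine ⟨?_, ?_, ?_⟩
    · simp_rw [hs.a_eq ps hκ, ht.a_eq pt hκ]
      refine (h₁ u v s t hs ht hu hv).trans (mul_le_mul_left (ENNReal.coe_le_coe.2 ?_) _)
      exact (le_self_add).trans le_self_add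
    · simp_rw [hs.mul_b_eq ps hκ, ht.mul_b_eq pt hκ]
      refine (h₂ u v s t hs ht hu hv).trans (mul_le_mul_left (ENNReal.coe_le_coe.2 ?_) _)
      exact (le_add_self).trans le_self_add
    · refine (normH1_congr_ae ((hs.inv_mul_b_eq ps hκ).sub (ht.inv_mul_b_eq pt hκ))).trans_le ?_
      refine (h₃ u v s t hs ht hu hv).trans (mul_le_mul_left (ENNReal.coe_le_coe.2 ?_) _)
      exact le_add_self
  · obtain ⟨C₁, h₁⟩ := unifLip_mul_betaCoef_l21.exists_lipschitz₂ B
    obtain ⟨C₂, h₂⟩ := unifLip_betaCoef_l21.exists_lipschitz₂ B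
    refine ⟨C₁ + C₂, fun u v hu hv κ hκ => ?_⟩
    have hu' : MemH11 u := (le_add_self.trans hu).trans_lt (top B)
    have hv' : MemH11 v := (le_add_self.trans hv).trans_lt (top B)
    have hu2 : MemH2 u := (le_self_add.trans hu).trans_lt (top B)
    have hv2 : MemH2 v := (le_self_add.trans hv).trans_lt (top B)
    obtain ⟨s, hs⟩ := hu2.exists_isRep₂
    obtain ⟨t, ht⟩ := hv2.exists_isRep₂
    have ps := pot u _ hs.isRep hu'
    have pt := pot v _ ht.isRep hv'
    refine ⟨?_, ?_⟩
    · simp_rw [hs.isRep.mul_b_eq ps hκ, ht.isRep.mul_b_eq pt hκ]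
      refine (h₁ u v s t hs ht hu hv).trans (mul_le_mul_left (ENNReal.coe_le_coe.2 ?_) _)
      exact le_self_add
    · refine (normL21_congr_ae
        ((hs.isRep.inv_mul_b_eq ps hκ).sub (ht.isRep.inv_mul_b_eq pt hκ))).trans_le ?_
      refine (h₂ u v s t hs ht hu hv).trans (mul_le_mul_left (ENNReal.coe_le_coe.2 ?_) _)
      exact le_add_self
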